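/- Let $d\ge 1$ be an integer and $1<p<2$. There is a constant $c_{p,d}$, depending only on $p$ and $d$, such that the following holds. Let $(\varepsilon_{\mathbf u})_{\mathbf u\in\mathbb Z^d}$ be i.i.d. real random variables, let $f\colon\mathbb R^{\mathbb Z^d}\to\mathbb R$ be measurable (for the product $\sigma$-algebra), and suppose that the random field $X_{\mathbf i}=f\big((\varepsilon_{\mathbf i-\mathbf u})_{\mathbf u\in\mathbb Z^d}\big)$, $\mathbf i\in\mathbb Z^d$, is centered (integrable with mean zero). Let $\varepsilon'_{\mathbf 0}$ be a real random variable independent of $(\varepsilon_{\mathbf u})_{\mathbf u\in\mathbb Z^d}$ (defined on the same probability space or on an enlargement of it; for instance an independent copy of $\varepsilon_{\mathbf 0}$), and put $\varepsilon^*_{\mathbf 0}=\varepsilon'_{\mathbf 0}$ and $\varepsilon^*_{\mathbf u}=\varepsilon_{\mathbf u}$ for $\mathbf u\ne\mathbf 0$. Then $$\Big\|\sup_{\mathbf n\in\mathbb N^d}\frac{1}{\sqrt{|\mathbf n|\,LL(|\mathbf n|)}}\Big|\sum_{\mathbf 1\preccurlyeq\mathbf i\preccurlyeq\mathbf n}X_{\mathbf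 i}\Big|\Big\|_p\le c_{p,d}\sum_{j\ge 0}(j+1)^{d/2}\Big(\sum_{\mathbf i\in\mathbb Z^d,\ \|\mathbf i\|_\infty=j}\delta_{2,d-1}(\mathbf i)^2\Big)^{1/2}.$$ Here $\mathbb N=\{1,2,\dots\}$, $\mathbf 1=(1,\dots,1)$, $\preccurlyeq$ is the coordinatewise order, $|\mathbf n|=\prod_{q=1}^d n_q$, $\|\mathbf i\|_\infty=\max_{1\le q\le d}|i_q|$, $\|\cdot\|_p$ is the $\mathbb L^p$ norm, $L(x)=\max\{\ln x,1\}$ and $LL=L\circ L$. The physical dependence measure is $$\delta_{2,r}(\mathbf i)=\Big\|f\big((\varepsilon_{\mathbf i-\mathbf u})_{\mathbf u\in\mathbb Z^d}\big)-f\big((\varepsilon^*_{\mathbf i-\mathbf u})_{\mathbf u\in\mathbb Z^d}\big)\Big\|_{2,r},$$ where $\|Y\|_{2,r}=\inf\{\lambda>0:\mathbb E[\varphi_{2,r}(|Y|/\lambda)]\le 1\}$ with $\varphi_{2,r}(x)=x^2(1+\ln(1+x))^r$ and $\inf\emptyset=+\infty$; both sides of the inequality may be $+\infty$. -/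

import Mathlib

open MeasureTheory ProbabilityTheory
open scoped NNReal ENNReal

/-- `L x = max (log x) 1`. -/
noncomputable def logL (x : ℝ) : ℝ := max (Real.log x) 1

/-- `LL = L ∘ L`. -/
noncomputable def logLL (x : ℝ) : ℝ := logL (logL x)

/-- The function `φ_{p,r}(x) = x ^ p * (1 + log (1 + x)) ^ r` on `[0, ∞)`. -/
noncomputable def orliczFun (p r x : ℝ) : ℝ := x ^ p * (1 + Real.log (1 + x)) ^ r

/-- The Orlicz (Luxemburg) norm
`‖X‖_{p,r} = inf {l > 0 | E[φ_{p,r}(|X| / l)] ≤ 1}`, with value `∞` if there is no such `l`,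
that is, if `X` does not belong to the Orlicz space. -/
noncomputable def orliczNorm {Ω : Type*} [MeasurableSpace Ω] (P : Measure Ω) (p r : ℝ)
    (X : Ω → ℝ) : ℝ≥0∞ :=
  ⨅ (l : ℝ) (_ : 0 < l)
    (_ : ∫⁻ ω, ENNReal.ofReal (orliczFun p r (|X ω| / l)) ∂P ≤ 1), ENNReal.ofReal l

/-- The value at the site `i` of the functional `f` of the field `ε`:
the random variable `f ((ε (i - u))_u)`. -/
def functionalField {d : ℕ} {Ω : Type*} (f : ((Fin d → ℤ) → ℝ) → ℝ)
    (ε : (Fin d → ℤ) → Ω → ℝ) (i : Fin d → ℤ) (ω : Ω) : ℝ :=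
  f (fun u => ε (i - u) ω)

/-- The physical measure of dependence `δ_{2,r}(i)`: the norm `‖·‖_{2,r}` of
`f ((ε (i - u))_u) - f ((ε* (i - u))_u)`, where `ε*` is `ε` with `ε 0` replaced by `ε'`. -/
noncomputable def physDep {d : ℕ} {Ω : Type*} [MeasurableSpace Ω] (P : Measure Ω)
    (f : ((Fin d → ℤ) → ℝ) → ℝ) (ε : (Fin d → ℤ) → Ω → ℝ) (ε' : Ω → ℝ) (r : ℝ)
    (i : Fin d → ℤ) : ℝ≥0∞ :=
  orliczNorm P 2 r fun ω =>
    functionalField f ε i ω - functionalField f (Function.update ε 0 ε') i ω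

/-- The sum of the `X i` over the rectangle `1 ≼ i ≼ n`. -/
noncomputable def rectSum {d : ℕ} {Ω : Type*} (X : (Fin d → ℤ) → Ω → ℝ) (n : Fin d → ℕ+) (ω : Ω) : ℝ :=
  ∑ i ∈ Finset.Icc (1 : Fin d → ℤ) (fun q => ((n q : ℕ) : ℤ)), X i ω

/-- The maximal function `sup_n |∑_{1 ≼ i ≼ n} X i| / √(|n| LL(|n|))`, where `n` ranges over the
`d`-tuples of positive integers and `|n|` is the product of the coordinates of `n`. -/
noncomputable def maximalFun {d : ℕ} {Ω : Type*} (X : (Fin d → ℤ) → Ω → ℝ) (ω : Ω) : ℝ≥0∞ :=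
  ⨆ n : Fin d → ℕ+, ENNReal.ofReal
    (|rectSum X n ω| / √((∏ q, ((n q : ℕ) : ℝ)) * logLL (∏ q, ((n q : ℕ) : ℝ))))

/-! Everything takes place on the canonical space of i.i.d. fields, where the variable at site `i`
is `f` evaluated at the field reflected about `i`. Conditioning `f` on the coordinates in balls of
radius `j` writes it as the sum of the increments `shellDiff`, by Lévy's upward theorem
(`tendsto_fiberMean`), and Minkowski's inequality reduces the claim to one increment. Such an
increment `h` is centered and depends only on the coordinates of norm at most `j`. Two facts about
it are needed.

The first is a maximal inequality for fields of finite range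
(`exists_lintegral_maximalFun_rpow_le`). The lattice is cut into blocks of side `2 j + 1`, sorted
into `2 ^ d` parity classes. In one class distinct blocks involve disjoint sets of coordinates, so
exchanging two independent copies of the field near chosen blocks introduces arbitrary block signs
(`lintegral_boxMax_le_signed`). With the field frozen, the sites at a fixed position of their blocks
carry independent signs. Rademacher sums are subgaussian, Lévy's reflections in each direction bound
their maxima, and the series over dyadic rectangles converges because of the factor `LL`
(`exists_signed_maximal_bound`). Cauchy–Schwarz over the `(2 j + 1) ^ d` positions yields the weight
`(j + 1) ^ (d / 2)`. The remaining random scale is the supremum of the averages of `h ^ 2` over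
rectangles. It is controlled in `L ^ (p / 2)` by iterated maximal ergodic inequalities: one
direction is a weak type bound, which suffices as `p / 2 < 1`, and each of the others costs one
logarithm (`exists_lintegral_rectMax_rpow_le`). This is the origin of the exponent `d - 1` in the
dependence measure.

The second is that the size of `h` in `L ^ 2 log ^ (d - 1) L` is at most a constant times the `ℓ ^
2` norm of the coefficients on the sphere of radius `j` (`lintegral_layerSum_fiberMean_sub_le`). The
coordinates of the sphere are revealed one at a time. In the resulting martingale the increment at
`u` is unchanged if a function free of the coordinate `u` is subtracted from `f`; `f` with that
coordinate frozen at a good value is such a function, and Fubini's theorem provides the value from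
the dependence coefficient (`exists_lintegral_update_le`). A convex function of growth `y ^ 2 log ^
(d - 1) |y|` with controlled second differences then has a mean that grows at each step by a factor
`1 + K a ^ 2` at most, as for orthogonal increments in `L ^ 2`. -/

/-! ### Product laws: merging and exchanging coordinates of independent fields. -/

/-- The law on `ι → ℝ` of a field of independent random variables with common law `μ₀`. -/
noncomputable abbrev iidMeasure (ι : Type*) (μ₀ : Measure ℝ) : Measure (ι → ℝ) :=
  Measure.infinitePi fun _ => μ₀

lemma measurePreserving_reindex {ι κ : Type*} (μ₀ : Measure ℝ) [IsProbabilityMeasure μ₀]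
    {g : κ → ι} (hg : Function.Injective g) :
    MeasurePreserving (fun (z : ι → ℝ) k => z (g k)) (iidMeasure ι μ₀) (iidMeasure κ μ₀) :=
  ⟨by fun_prop, Measure.map_infinitePi_infinitePi_of_inj (P := fun _ => μ₀) hg⟩

/-- Two fields as a single field indexed by `ι × Bool`. -/
def interleave {ι : Type*} (z : (ι → ℝ) × (ι → ℝ)) (k : ι × Bool) : ℝ :=
  if k.2 then z.1 k.1 else z.2 k.1

lemma measurable_interleave {ι : Type*} : Measurable (interleave (ι := ι)) := by
  refine measurable_pi_lambda _ fun k => ?_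
  rcases k with ⟨i, b⟩
  cases b <;> simp only [interleave] <;> simp <;> fun_prop

lemma measurePreserving_interleave (ι : Type*) (μ₀ : Measure ℝ) [IsProbabilityMeasure μ₀] :
    MeasurePreserving (interleave (ι := ι)) ((iidMeasure ι μ₀).prod (iidMeasure ι μ₀))
      (iidMeasure (ι × Bool) μ₀) := by
  classical
  refine ⟨measurable_interleave, Measure.eq_infinitePi _ fun s t ht => ?_⟩
  rw [Measure.map_apply measurable_interleave
    (MeasurableSet.pi s.countable_toSet fun i _ => ht i)]
  set s₁ : Finset ι := (s.filter fun k => k.2 = true).image Prod.fst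
  set s₂ : Finset ι := (s.filter fun k => k.2 = false).image Prod.fst
  have hpre : interleave ⁻¹' (Set.pi (s : Set (ι × Bool)) t) =
      (Set.pi (s₁ : Set ι) fun i => t (i, true)) ×ˢ
        (Set.pi (s₂ : Set ι) fun i => t (i, false)) := by
    ext z
    simp only [Set.mem_preimage, Set.mem_pi, Finset.mem_coe, interleave, Prod.forall,
      Bool.forall_bool, Set.mem_prod, s₁, s₂, Finset.mem_image, Finset.mem_filter]
    constructor
    · intro h
      refine ⟨?_, ?_⟩
      · rintro i ⟨⟨j, b⟩, ⟨hj, hb⟩, rfl⟩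
        simp only at hb
        subst hb
        simpa using (h j).2 hj
      · rintro i ⟨⟨j, b⟩, ⟨hj, hb⟩, rfl⟩
        simp only at hb
        subst hb
        simpa using (h j).1 hj
    · rintro ⟨h1, h2⟩ i
      refine ⟨fun hi => ?_, fun hi => ?_⟩
      · simpa using h2 i ⟨(i, false), ⟨hi, rfl⟩, rfl⟩
      · simpa using h1 i ⟨(i, true), ⟨hi, rfl⟩, rfl⟩
  rw [hpre, Measure.prod_prod, Measure.infinitePi_pi _ fun i _ => ht _,
    Measure.infinitePi_pi _ fun i _ => ht _]
  have h1 : ∏ i ∈ s₁, μ₀ (t (i, true)) = ∏ k ∈ s.filter (fun k => k.2 = true), μ₀ (t k) := by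
    rw [Finset.prod_image]
    · refine Finset.prod_congr rfl fun k hk => ?_
      rw [← (Finset.mem_filter.1 hk).2]
    · rintro ⟨i, b⟩ hi ⟨j, c⟩ hj h
      have := (Finset.mem_filter.1 hi).2
      have := (Finset.mem_filter.1 hj).2
      simp_all
  have h2 : ∏ i ∈ s₂, μ₀ (t (i, false)) = ∏ k ∈ s.filter (fun k => ¬ k.2 = true), μ₀ (t k) := by
    have : s.filter (fun k => ¬ k.2 = true) = s.filter (fun k => k.2 = false) := by
      ext k; simp
    rw [this, Finset.prod_image]
    · refine Finset.prod_congr rfl fun k hk => ?_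
      rw [← (Finset.mem_filter.1 hk).2]
    · rintro ⟨i, b⟩ hi ⟨j, c⟩ hj h
      have := (Finset.mem_filter.1 hi).2
      have := (Finset.mem_filter.1 hj).2
      simp_all
  rw [h1, h2, Finset.prod_filter_mul_prod_filter_not]

open Classical in
/-- The field equal to `x` on `A` and to `y` off `A`. -/
noncomputable def merge {ι : Type*} (A : Set ι) (x y : ι → ℝ) (v : ι) : ℝ :=
  if v ∈ A then x v else y v

lemma measurable_merge {ι : Type*} (A : Set ι) :
    Measurable fun z : (ι → ℝ) × (ι → ℝ) => merge A z.1 z.2 := by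
  classical
  refine measurable_pi_lambda _ fun v => ?_
  by_cases h : v ∈ A <;> simp only [merge, h, if_true, if_false] <;> fun_prop

/-- Merging selects from the interleaved field one coordinate per site, along an injective map of
indices. -/
lemma measurePreserving_merge {ι : Type*} (μ₀ : Measure ℝ) [IsProbabilityMeasure μ₀] (A : Set ι) :
    MeasurePreserving (fun z : (ι → ℝ) × (ι → ℝ) => merge A z.1 z.2)
      ((iidMeasure ι μ₀).prod (iidMeasure ι μ₀)) (iidMeasure ι μ₀) := by
  classical
  have hg : Function.Injective fun v : ι => (v, decide (v ∈ A)) :=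
    fun v w h => (Prod.ext_iff.1 h).1
  convert (measurePreserving_reindex μ₀ hg).comp (measurePreserving_interleave ι μ₀) using 1
  ext z v
  by_cases h : v ∈ A <;> simp [merge, interleave, h]

/-- The exchange of the coordinates in `B` between two fields preserves the product law. -/
lemma measurePreserving_swap {ι : Type*} (μ₀ : Measure ℝ) [IsProbabilityMeasure μ₀] (B : Set ι) :
    MeasurePreserving
      (fun z : (ι → ℝ) × (ι → ℝ) => (merge B z.2 z.1, merge B z.1 z.2))
      ((iidMeasure ι μ₀).prod (iidMeasure ι μ₀))
      ((iidMeasure ι μ₀).prod (iidMeasure ι μ₀)) := by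
  classical
  set μ := iidMeasure ι μ₀
  let back : (ι × Bool → ℝ) → (ι → ℝ) × (ι → ℝ) := fun z => (fun v => z (v, true), fun v => z (v, false))
  have hback : Measurable back := by
    refine Measurable.prodMk ?_ ?_ <;> fun_prop
  have hbi : ∀ z, back (interleave z) = z := fun z => by
    ext v <;> simp [back, interleave]
  have hb : MeasurePreserving back (iidMeasure (ι × Bool) μ₀) (μ.prod μ) := by
    refine ⟨hback, ?_⟩
    rw [← (measurePreserving_interleave ι μ₀).map_eq,
      Measure.map_map hback measurable_interleave]
    have : back ∘ interleave = id := funext hbi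
    rw [this, Measure.map_id]
  -- The exchange is a relabelling of the interleaved field: the copy index is flipped at the sites
  -- of `B`.
  let e : ι × Bool → ι × Bool := fun k => (k.1, if k.1 ∈ B then !k.2 else k.2)
  have he : Function.Injective e := by
    rintro ⟨i, b⟩ ⟨j, c⟩ h
    simp only [e, Prod.mk.injEq] at h
    obtain ⟨rfl, h⟩ := h
    by_cases hi : i ∈ B <;> simp_all
  convert hb.comp ((measurePreserving_reindex μ₀ he).comp (measurePreserving_interleave ι μ₀))
    using 1
  ext z v
  · by_cases h : v ∈ B <;> simp [merge, interleave, back, e, h]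
  · by_cases h : v ∈ B <;> simp [merge, interleave, back, e, h]

lemma merge_eq_of_eqOn {ι : Type*} {A : Set ι} {x x' : ι → ℝ} (h : ∀ v ∈ A, x v = x' v)
    (y : ι → ℝ) : merge A x y = merge A x' y := by
  ext v
  by_cases hv : v ∈ A <;> simp [merge, hv, h]

lemma DependsOn.merge_eq {ι β : Type*} {A : Set ι} {F : (ι → ℝ) → β} (hF : DependsOn F A)
    (x y : ι → ℝ) : F (merge A x y) = F x :=
  hF fun v hv => by simp [merge, hv]

/-! ### Conditional means as integrals over fibers. -/

/-- The mean of `g` over the coordinates off `A`: a version of the conditional expectation of `g`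
given the coordinates in `A`. -/
noncomputable def fiberMean {ι : Type*} (μ₀ : Measure ℝ) (A : Set ι) (g : (ι → ℝ) → ℝ)
    (x : ι → ℝ) : ℝ :=
  ∫ y, g (merge A x y) ∂iidMeasure ι μ₀

section fiberMean
variable {ι : Type*} {μ₀ : Measure ℝ} {A : Set ι} {g h : (ι → ℝ) → ℝ}

lemma dependsOn_fiberMean : DependsOn (fiberMean μ₀ A g) A := fun x x' hx => by
  simp only [fiberMean, merge_eq_of_eqOn hx]

lemma fiberMean_empty : fiberMean μ₀ ∅ g = fun _ => ∫ y, g y ∂iidMeasure ι μ₀ := by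
  ext x
  have h (y : ι → ℝ) : merge ∅ x y = y := by ext v; simp [merge]
  simp only [fiberMean, h]

/-- Revealing a coordinate on which `h` does not depend changes nothing. Hence `g` and `g - h` have
the same martingale increment at `u`. -/
lemma fiberMean_insert_of_dependsOn {u : ι} (hh : DependsOn h {u}ᶜ) :
    fiberMean μ₀ (insert u A) h = fiberMean μ₀ A h := by
  ext x
  refine integral_congr_ae (Filter.Eventually.of_forall fun y => hh fun v hv => ?_)
  simp only [Set.mem_compl_iff, Set.mem_singleton_iff] at hv
  by_cases hA : v ∈ A <;> simp [merge, hv, hA]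

variable [IsProbabilityMeasure μ₀]

lemma measurable_fiberMean (hg : Measurable g) : Measurable (fiberMean μ₀ A g) :=
  (StronglyMeasurable.integral_prod_right (ν := iidMeasure ι μ₀)
    (f := fun x y => g (merge A x y))
    (hg.comp (measurable_merge A)).stronglyMeasurable).measurable

lemma integrable_comp_merge (hg : Integrable g (iidMeasure ι μ₀)) :
    Integrable (fun z : (ι → ℝ) × (ι → ℝ) => g (merge A z.1 z.2))
      ((iidMeasure ι μ₀).prod (iidMeasure ι μ₀)) :=
  (measurePreserving_merge μ₀ A).integrable_comp_of_integrable hg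

lemma integrable_fiberMean (hg : Integrable g (iidMeasure ι μ₀)) :
    Integrable (fiberMean μ₀ A g) (iidMeasure ι μ₀) :=
  (integrable_comp_merge hg).integral_prod_left

lemma fiberMean_sub (hg : Integrable g (iidMeasure ι μ₀)) (hh : Integrable h (iidMeasure ι μ₀)) :
    ∀ᵐ x ∂iidMeasure ι μ₀,
      fiberMean μ₀ A (fun y => g y - h y) x = fiberMean μ₀ A g x - fiberMean μ₀ A h x := by
  filter_upwards [(integrable_comp_merge (A := A) hg).prod_right_ae,
    (integrable_comp_merge (A := A) hh).prod_right_ae] with x h1 h2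
  exact integral_sub h1 h2

/-- Functions of the coordinates in `A` can be pulled out of the mean. -/
lemma integral_mul_fiberMean {Z : (ι → ℝ) → ℝ} (hZ : DependsOn Z A)
    (hZg : Integrable (fun x => Z x * g x) (iidMeasure ι μ₀)) :
    ∫ x, Z x * fiberMean μ₀ A g x ∂iidMeasure ι μ₀ = ∫ x, Z x * g x ∂iidMeasure ι μ₀ := by
  have h1 := integrable_comp_merge (A := A) hZg
  calc ∫ x, Z x * fiberMean μ₀ A g x ∂iidMeasure ι μ₀
      = ∫ x, ∫ y, Z (merge A x y) * g (merge A x y) ∂iidMeasure ι μ₀ ∂iidMeasure ι μ₀ := by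
        refine integral_congr_ae (Filter.Eventually.of_forall fun x => ?_)
        simp only [hZ.merge_eq, fiberMean, integral_const_mul]
    _ = ∫ z, Z (merge A z.1 z.2) * g (merge A z.1 z.2)
          ∂(iidMeasure ι μ₀).prod (iidMeasure ι μ₀) := (integral_prod _ h1).symm
    _ = ∫ x, Z x * g x ∂iidMeasure ι μ₀ := by
        have h3 := (measurePreserving_merge μ₀ A).map_eq
        conv_rhs => rw [← h3]
        rw [integral_map (measurable_merge A).aemeasurable]
        rw [h3]
        exact hZg.aestronglyMeasurable

lemma integral_fiberMean (hg : Integrable g (iidMeasure ι μ₀)) :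
    ∫ x, fiberMean μ₀ A g x ∂iidMeasure ι μ₀ = ∫ x, g x ∂iidMeasure ι μ₀ := by
  have := integral_mul_fiberMean (μ₀ := μ₀) (A := A) (g := g) (Z := fun _ => 1)
    (fun _ _ _ => rfl) (by simpa using hg)
  simpa using this

end fiberMean

/-! ### The maximal ergodic inequality. -/

/-- The maximal function of the averages of `G` along the orbits of `T`. -/
noncomputable def ergodicMax {α : Type*} (T : α → α) (G : α → ℝ≥0∞) (x : α) : ℝ≥0∞ :=
  ⨆ n : ℕ, (∑ k ∈ Finset.range (n + 1), G (T^[k] x)) / ((n + 1 : ℕ) : ℝ≥0∞)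

section ergodic
variable {α : Type*} {T : α → α} {G : α → ℝ≥0∞}

lemma ergodicMax_mono {G' : α → ℝ≥0∞} (h : ∀ x, G x ≤ G' x) (x : α) :
    ergodicMax T G x ≤ ergodicMax T G' x :=
  iSup_mono fun _ => ENNReal.div_le_div_right (Finset.sum_le_sum fun _ _ => h _) _

lemma ergodicMax_add_const_le (c : ℝ≥0∞) (x : α) :
    ergodicMax T (fun y => G y + c) x ≤ ergodicMax T G x + c := by
  refine iSup_le fun n => ?_
  rw [Finset.sum_add_distrib, Finset.sum_const, Finset.card_range, ENNReal.add_div]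
  refine add_le_add (le_iSup (fun n : ℕ => (∑ k ∈ Finset.range (n + 1), G (T^[k] x)) /
    ((n + 1 : ℕ) : ℝ≥0∞)) n) (le_of_eq ?_)
  rw [nsmul_eq_mul, mul_comm, ENNReal.mul_div_cancel_right (by positivity) (by simp)]

variable [MeasurableSpace α] {μ : Measure α}

lemma measurable_ergodicMax (hT : Measurable T) (hG : Measurable G) :
    Measurable (ergodicMax T G) :=
  Measurable.iSup fun _ => (Finset.measurable_fun_sum _ fun k _ =>
    hG.comp (hT.iterate k)).div_const _

/-- The maximal ergodic inequality. -/
theorem mul_measure_lt_ergodicMax_le (hT : MeasurePreserving T μ μ) (hG : Measurable G)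
    (t : ℝ≥0∞) : t * μ {x | t < ergodicMax T G x} ≤ ∫⁻ x, G x ∂μ := by
  rcases eq_or_ne t ⊤ with rfl | ht
  · simp
  rcases eq_or_ne (∫⁻ x, G x ∂μ) ⊤ with hI | hI
  · simp [hI]
  let S : ℕ → α → ℝ≥0∞ := fun n x => ∑ k ∈ Finset.range n, G (T^[k] x)
  have hS : ∀ n, Measurable (S n) := fun n => Finset.measurable_fun_sum _ fun k _ =>
    hG.comp (hT.measurable.iterate k)
  -- Subtraction is truncated at `0`, so this is the maximum of the positive parts, and `n = 0`
  -- contributes `0`.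
  let F : ℕ → α → ℝ≥0∞ := fun m x => (Finset.range (m + 1)).sup fun n => S n x - n * t
  have hF : ∀ m, Measurable (F m) := fun m => by
    simp only [F, Finset.sup_eq_iSup]
    exact .iSup fun n => .iSup fun _ => (hS n).sub_const _
  have hSint : ∀ n, ∫⁻ x, S n x ∂μ = n * ∫⁻ x, G x ∂μ := fun n => by
    simp only [S]
    rw [lintegral_finsetSum (Finset.range n) (f := fun k x => G (T^[k] x))
      fun k _ => hG.comp (hT.measurable.iterate k)]
    simp [(hT.iterate _).lintegral_comp hG]
  have hFfin : ∀ m, ∫⁻ x, F m x ∂μ ≠ ⊤ := fun m => by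
    refine ne_top_of_le_ne_top ?_ (lintegral_mono (g := S m) fun x => ?_)
    · rw [hSint]; exact ENNReal.mul_ne_top (by simp) hI
    · refine Finset.sup_le fun n hn => tsub_le_self.trans ?_
      exact Finset.sum_le_sum_of_subset (Finset.range_mono (by simpa [Nat.lt_succ_iff] using hn))
  -- Garsia's argument: a positive maximum is attained at some `n = k + 1`, and removing the first
  -- term of that orbit sum leaves a competitor for the maximum at `T x`.
  have hstep : ∀ m x, 0 < F m x → F m x + t ≤ G x + F m (T x) := by
    intro m x hx
    obtain ⟨n, hn, hnx⟩ := Finset.exists_mem_eq_sup (Finset.range (m + 1)) ⟨0, by simp⟩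
      fun n => S n x - n * t
    change F m x = S n x - n * t at hnx
    rw [hnx] at hx ⊢
    have hn0 : n ≠ 0 := by
      rintro rfl
      simp [S] at hx
    obtain ⟨k, rfl⟩ := Nat.exists_eq_succ_of_ne_zero hn0
    have hlt : ((k + 1 : ℕ) : ℝ≥0∞) * t < S (k + 1) x := by
      simpa using tsub_pos_iff_lt.1 hx
    have hsplit : S (k + 1) x = G x + S k (T x) := by
      simp only [S, Finset.sum_range_succ', Function.iterate_succ_apply, Function.iterate_zero, id]
      exact add_comm _ _
    have hk : ((k + 1 : ℕ) : ℝ≥0∞) * t = k * t + t := by push_cast; ring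
    calc S (k + 1) x - ((k + 1 : ℕ) : ℝ≥0∞) * t + t
        = S (k + 1) x - k * t := by
          rw [hk, ← tsub_tsub]
          refine tsub_add_cancel_of_le ?_
          rw [hk] at hlt
          exact ENNReal.le_sub_of_add_le_left (ENNReal.mul_ne_top (by simp) ht) hlt.le
      _ ≤ G x + (S k (T x) - k * t) := by rw [hsplit]; exact add_tsub_le_assoc
      _ ≤ G x + F m (T x) := by
          gcongr
          exact Finset.le_sup (f := fun n => S n (T x) - n * t)
            (by simp only [Finset.mem_range] at hn ⊢; omega)
  have hE : ∀ m, MeasurableSet {x | 0 < F m x} := fun m =>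
    measurableSet_lt measurable_const (hF m)
  have hbound : ∀ m, t * μ {x | 0 < F m x} ≤ ∫⁻ x, G x ∂μ := by
    intro m
    have h1 : ∫⁻ x in {x | 0 < F m x}, F m x + t ∂μ ≤ ∫⁻ x, G x + F m (T x) ∂μ :=
      (setLIntegral_mono ((hG.add ((hF m).comp hT.measurable)))
        fun x hx => hstep m x hx).trans (setLIntegral_le_lintegral _ _)
    rw [lintegral_add_left hG, hT.lintegral_comp (hF m), lintegral_add_left (hF m),
      setLIntegral_const] at h1
    -- Off this set `F m` vanishes, so both sides contain the same finite integral, which cancels.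
    have h2 : ∫⁻ x in {x | 0 < F m x}, F m x ∂μ = ∫⁻ x, F m x ∂μ := by
      refine setLIntegral_eq_of_support_subset fun x hx => ?_
      exact pos_iff_ne_zero.2 hx
    rw [h2, add_comm] at h1
    exact (ENNReal.add_le_add_iff_right (hFfin m)).1 h1
  have hmono : Monotone fun m => {x | 0 < F m x} := fun m m' hm x hx =>
    lt_of_lt_of_le (show 0 < F m x from hx)
      (Finset.sup_mono (Finset.range_mono (Nat.add_le_add_right hm 1)))
  have hsub : {x | t < ergodicMax T G x} ⊆ ⋃ m, {x | 0 < F m x} := by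
    intro x hx
    obtain ⟨n, hn⟩ := lt_iSup_iff.1 (show t < ergodicMax T G x from hx)
    refine Set.mem_iUnion.2 ⟨n + 1, ?_⟩
    have hn' : t * ((n + 1 : ℕ) : ℝ≥0∞) < S (n + 1) x := by
      rwa [ENNReal.lt_div_iff_mul_lt (by simp) (by simp)] at hn
    refine lt_of_lt_of_le (tsub_pos_iff_lt.2 ?_)
      (Finset.le_sup (f := fun n => S n x - n * t) (Finset.self_mem_range_succ (n + 1)))
    rwa [mul_comm]
  calc t * μ {x | t < ergodicMax T G x}
      ≤ t * μ (⋃ m, {x | 0 < F m x}) := by gcongr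
    _ = ⨆ m, t * μ {x | 0 < F m x} := by rw [hmono.measure_iUnion, ENNReal.mul_iSup]
    _ ≤ ∫⁻ x, G x ∂μ := iSup_le hbound

/-- Since `G` is at most its part above `t` plus `t`, the maximal function of that part must exceed
`t` wherever that of `G` exceeds `2 * t`. -/
lemma mul_measure_two_mul_lt_ergodicMax_le (hT : MeasurePreserving T μ μ) (hG : Measurable G)
    (t : ℝ≥0∞) :
    t * μ {x | 2 * t < ergodicMax T G x} ≤ ∫⁻ x, (if t < G x then G x else 0) ∂μ := by
  have hG' : Measurable fun x => if t < G x then G x else 0 :=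
    Measurable.ite (measurableSet_lt measurable_const hG) hG measurable_const
  refine le_trans ?_ (mul_measure_lt_ergodicMax_le hT hG' t)
  refine mul_le_mul_right (measure_mono fun x hx => ?_) t
  have hx : 2 * t < ergodicMax T G x := hx
  show t < _
  have h1 : ergodicMax T G x ≤ ergodicMax T (fun x => if t < G x then G x else 0) x + t := by
    refine le_trans (ergodicMax_mono (fun y => ?_) x) (ergodicMax_add_const_le t x)
    split_ifs with h
    · exact le_self_add
    · simpa using h
  by_contra! h2
  exact absurd (hx.trans_le (h1.trans (add_le_add_left h2 t))) (by rw [two_mul]; exact lt_irrefl _)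

end ergodic

/-! ### Dyadic layers and the classes `L log ^ r L`. -/

/-- `layerSum r x = ∑ (k + 1) ^ r * 2 ^ k` over the `k` with `2 ^ k < x`, which is of the order of
`x * log x ^ r`. -/
noncomputable def layerSum (r : ℕ) (x : ℝ≥0∞) : ℝ≥0∞ :=
  ∑' k : ℕ, ((k + 1 : ℕ) : ℝ≥0∞) ^ r * 2 ^ k * (if 2 ^ k < x then 1 else 0)

lemma exists_le_two_pow {x : ℝ≥0∞} (hx : x ≠ ⊤) : ∃ n : ℕ, x ≤ 2 ^ n := by
  obtain ⟨n, hn⟩ := ENNReal.exists_nat_gt hx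
  refine ⟨n, hn.le.trans ?_⟩
  exact_mod_cast Nat.lt_two_pow_self.le

/-- Each active layer doubles the bound, as `2 ^ m + 2 ^ m = 2 ^ (m + 1)`. For `x = ⊤` all layers
are active and the series diverges. -/
lemma le_two_pow_add_tsum (k : ℕ) (x : ℝ≥0∞) :
    x ≤ 2 ^ k + ∑' m : ℕ, if k ≤ m then 2 ^ m * (if 2 ^ m < x then (1 : ℝ≥0∞) else 0) else 0 := by
  set f : ℕ → ℝ≥0∞ := fun m => if k ≤ m then 2 ^ m * (if 2 ^ m < x then (1 : ℝ≥0∞) else 0) else 0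
  have key : ∀ n, k ≤ n → min x (2 ^ n) ≤ 2 ^ k + ∑ m ∈ Finset.range n, f m := by
    intro n hn
    induction n, hn using Nat.le_induction with
    | base => exact (min_le_right _ _).trans le_self_add
    | succ n hn ih =>
      rw [Finset.sum_range_succ, ← add_assoc]
      rcases le_or_gt x (2 ^ n) with h | h
      · rw [min_eq_left h] at ih
        exact (min_le_left _ _).trans (ih.trans le_self_add)
      · rw [min_eq_right h.le] at ih
        refine (min_le_right _ _).trans ?_
        have : f n = 2 ^ n := by simp [f, hn, h]
        rw [this, pow_succ, mul_two]
        gcongr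
  have key2 : ∀ n, k ≤ n → min x (2 ^ n) ≤ 2 ^ k + ∑' m, f m := fun n hn =>
    (key n hn).trans (by gcongr; exact ENNReal.sum_le_tsum _)
  rcases eq_or_ne x ⊤ with hx | hx
  · rw [hx]
    by_contra! h
    obtain ⟨n, hn⟩ := exists_le_two_pow h.ne
    have := key2 (n + k + 1) (by omega)
    rw [hx, min_eq_right le_top] at this
    have h2 : (2 : ℝ≥0∞) ^ n < 2 ^ (n + k + 1) :=
      by exact_mod_cast Nat.pow_lt_pow_right (by norm_num) (by omega)
    exact absurd (this.trans hn) (not_le.2 h2)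
  · obtain ⟨n, hn⟩ := exists_le_two_pow hx
    have := key2 (n + k) (by omega)
    rwa [min_eq_left (hn.trans (pow_le_pow_right₀ (by norm_num) (by omega)))] at this

lemma le_one_add_layerSum (x : ℝ≥0∞) : x ≤ 1 + layerSum 0 x := by
  simpa [layerSum] using le_two_pow_add_tsum 0 x

lemma ite_two_pow_lt_le (k : ℕ) (x : ℝ≥0∞) : (if 2 ^ k < x then x else 0) ≤
    2 * ∑' m : ℕ, if k ≤ m then 2 ^ m * (if 2 ^ m < x then (1 : ℝ≥0∞) else 0) else 0 := by
  split_ifs with h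
  · refine (le_two_pow_add_tsum k x).trans ?_
    rw [two_mul]
    gcongr
    refine le_trans ?_ (ENNReal.le_tsum k)
    simp [h]
  · exact zero_le

lemma rpow_le_one_add_tsum {s : ℝ} (hs : 0 < s) (x : ℝ≥0∞) :
    x ^ s ≤ 1 + ∑' k : ℕ, ((2 : ℝ≥0∞) ^ s) ^ (k + 1) * (if 2 ^ k < x then 1 else 0) := by
  rcases le_or_gt x 1 with h1 | h1
  · exact (ENNReal.rpow_le_one h1 hs.le).trans le_self_add
  have h2 : (1 : ℝ≥0∞) ≤ 2 ^ s := by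
    rw [← ENNReal.one_rpow s]; exact ENNReal.rpow_le_rpow (by norm_num) hs.le
  rcases eq_or_ne x ⊤ with rfl | hx
  · have : ∑' k : ℕ, ((2 : ℝ≥0∞) ^ s) ^ (k + 1) * (if (2 : ℝ≥0∞) ^ k < ⊤ then 1 else 0) = ⊤ := by
      refine eq_top_iff.2 ?_
      rw [← ENNReal.tsum_const_eq_top_of_ne_zero (α := ℕ) (c := 1) one_ne_zero]
      refine ENNReal.tsum_le_tsum fun k => ?_
      rw [if_pos (by simp), mul_one]
      exact one_le_pow₀ h2
    rw [this]; simp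
  · classical
    have hex := exists_le_two_pow hx
    have hn := Nat.find_spec hex
    have hmin := fun m => Nat.find_min hex (m := m)
    set n := Nat.find hex
    have hn0 : n ≠ 0 := by
      intro h0
      rw [h0, pow_zero] at hn
      exact absurd hn (not_le.2 h1)
    obtain ⟨k, hk⟩ := Nat.exists_eq_succ_of_ne_zero hn0
    have hk2 : 2 ^ k < x := not_le.1 (hmin k (by omega))
    refine le_trans ?_ le_add_self
    refine le_trans ?_ (ENNReal.le_tsum k)
    rw [if_pos hk2, mul_one, ← ENNReal.rpow_natCast, ← ENNReal.rpow_mul, mul_comm,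
      ENNReal.rpow_mul, ENNReal.rpow_natCast]
    rw [hk] at hn
    exact ENNReal.rpow_le_rpow hn hs.le

section ergodic_log
variable {α : Type*} [MeasurableSpace α] {μ : Measure α} {T : α → α} {G : α → ℝ≥0∞}

lemma lintegral_ite_lt (hG : Measurable G) (c : ℝ≥0∞) :
    ∫⁻ x, (if c < G x then (1 : ℝ≥0∞) else 0) ∂μ = μ {x | c < G x} := by
  rw [← lintegral_indicator_one (measurableSet_lt measurable_const hG)]
  refine lintegral_congr fun x => ?_
  by_cases h : c < G x <;> simp [h]

lemma lintegral_layerSum (hG : Measurable G) (r : ℕ) :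
    ∫⁻ x, layerSum r (G x) ∂μ =
      ∑' k : ℕ, ((k + 1 : ℕ) : ℝ≥0∞) ^ r * 2 ^ k * μ {x | 2 ^ k < G x} := by
  have hm : ∀ k : ℕ, MeasurableSet {x | 2 ^ k < G x} := fun k =>
    measurableSet_lt measurable_const hG
  have hm' : ∀ k : ℕ, Measurable fun x => if 2 ^ k < G x then (1 : ℝ≥0∞) else 0 := fun k =>
    Measurable.ite (hm k) measurable_const measurable_const
  simp only [layerSum]
  rw [lintegral_tsum fun k => ((hm' k).const_mul _).aemeasurable]
  refine tsum_congr fun k => ?_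
  rw [lintegral_const_mul _ (hm' k), lintegral_ite_lt hG]

lemma lintegral_ite_two_pow_lt_le (hG : Measurable G) (k : ℕ) :
    ∫⁻ x, (if 2 ^ k < G x then G x else 0) ∂μ ≤
      2 * ∑' m : ℕ, if k ≤ m then 2 ^ m * μ {x | 2 ^ m < G x} else 0 := by
  have hm : ∀ k : ℕ, MeasurableSet {x | 2 ^ k < G x} := fun k =>
    measurableSet_lt measurable_const hG
  have hm' : ∀ k : ℕ, Measurable fun x => if 2 ^ k < G x then (1 : ℝ≥0∞) else 0 := fun k =>
    Measurable.ite (hm k) measurable_const measurable_const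
  refine (lintegral_mono fun x => ite_two_pow_lt_le k (G x)).trans ?_
  have hf : ∀ m : ℕ, Measurable fun x =>
      if k ≤ m then 2 ^ m * (if 2 ^ m < G x then (1 : ℝ≥0∞) else 0) else 0 := fun m => by
    split_ifs
    · exact (hm' m).const_mul _
    · exact measurable_const
  rw [lintegral_const_mul _ (Measurable.tsum hf), lintegral_tsum fun m => (hf m).aemeasurable]
  gcongr with m
  split_ifs with h
  · rw [lintegral_const_mul _ (hm' m), lintegral_ite_lt hG]
  · simp

/-- A maximal function costs one logarithm. The truncated weak type bound is summed over dyadic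
levels; after exchanging the sums, level `m` is counted with weight `∑ (k + 2) ^ r` over `k ≤ m`, at
most `2 ^ r * (m + 1) ^ (r + 1)`. The lowest layer is a probability, whence the summand `1`. -/
lemma lintegral_layerSum_ergodicMax_le [IsProbabilityMeasure μ] (hT : MeasurePreserving T μ μ)
    (hG : Measurable G) (r : ℕ) :
    ∫⁻ x, layerSum r (ergodicMax T G x) ∂μ ≤
      1 + 2 ^ (r + 2) * ∫⁻ x, layerSum (r + 1) (G x) ∂μ := by
  rw [lintegral_layerSum (measurable_ergodicMax hT.measurable hG), lintegral_layerSum hG,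
    tsum_eq_zero_add' ENNReal.summable]
  refine add_le_add (by simpa using prob_le_one) ?_
  calc ∑' k : ℕ, ((k + 1 + 1 : ℕ) : ℝ≥0∞) ^ r * 2 ^ (k + 1) *
        μ {x | 2 ^ (k + 1) < ergodicMax T G x}
      ≤ ∑' k : ℕ, ∑' m : ℕ, if k ≤ m then
          4 * (((k + 2 : ℕ) : ℝ≥0∞) ^ r * (2 ^ m * μ {x | 2 ^ m < G x})) else 0 := by
        refine ENNReal.tsum_le_tsum fun k => ?_
        have h1 := (mul_measure_two_mul_lt_ergodicMax_le hT hG (2 ^ k)).trans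
          (lintegral_ite_two_pow_lt_le hG k)
        rw [← pow_succ'] at h1
        calc ((k + 1 + 1 : ℕ) : ℝ≥0∞) ^ r * 2 ^ (k + 1) * μ {x | 2 ^ (k + 1) < ergodicMax T G x}
            = 2 * ((k + 2 : ℕ) : ℝ≥0∞) ^ r *
              (2 ^ k * μ {x | 2 ^ (k + 1) < ergodicMax T G x}) := by rw [pow_succ]; ring
          _ ≤ 2 * ((k + 2 : ℕ) : ℝ≥0∞) ^ r *
              (2 * ∑' m : ℕ, if k ≤ m then 2 ^ m * μ {x | 2 ^ m < G x} else 0) := by gcongr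
          _ = _ := by
            rw [← mul_assoc, ← ENNReal.tsum_mul_left]
            refine tsum_congr fun m => ?_
            split_ifs
            · ring
            · simp
    _ = ∑' m : ℕ, ∑' k : ℕ, if k ≤ m then
          4 * (((k + 2 : ℕ) : ℝ≥0∞) ^ r * (2 ^ m * μ {x | 2 ^ m < G x})) else 0 :=
        ENNReal.tsum_comm
    _ ≤ ∑' m : ℕ, 2 ^ (r + 2) *
          (((m + 1 : ℕ) : ℝ≥0∞) ^ (r + 1) * 2 ^ m * μ {x | 2 ^ m < G x}) := by
        refine ENNReal.tsum_le_tsum fun m => ?_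
        rw [tsum_eq_sum (s := Finset.range (m + 1)) fun k hk => by
          rw [if_neg]; simpa [Nat.lt_succ_iff] using hk]
        calc ∑ k ∈ Finset.range (m + 1), (if k ≤ m then
              4 * (((k + 2 : ℕ) : ℝ≥0∞) ^ r * (2 ^ m * μ {x | 2 ^ m < G x})) else 0)
            ≤ ∑ k ∈ Finset.range (m + 1),
              4 * ((2 * ((m + 1 : ℕ) : ℝ≥0∞)) ^ r * (2 ^ m * μ {x | 2 ^ m < G x})) := by
              refine Finset.sum_le_sum fun k hk => ?_
              have hk' : k ≤ m := by simpa [Nat.lt_succ_iff] using hk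
              rw [if_pos hk']
              gcongr
              exact_mod_cast (by omega : k + 2 ≤ 2 * (m + 1))
          _ = _ := by
              rw [Finset.sum_const, Finset.card_range, nsmul_eq_mul]
              ring
    _ = _ := ENNReal.tsum_mul_left

/-- A bound for the constant of `lintegral_ergodicMax_rpow_le`. -/
noncomputable def ergodicConst (s : ℝ) : ℝ≥0∞ :=
  1 + 2 ^ s * (1 - 2 ^ (s - 1))⁻¹

lemma ergodicConst_ne_top {s : ℝ} (hs : s < 1) : ergodicConst s ≠ ⊤ := by
  refine ENNReal.add_ne_top.2 ⟨by simp, ENNReal.mul_ne_top ?_ ?_⟩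
  · simp [ENNReal.rpow_eq_top_iff]
  · refine ENNReal.inv_ne_top.2 (tsub_pos_iff_lt.2 ?_).ne'
    exact ENNReal.rpow_lt_one_of_one_lt_of_neg (by norm_num) (by linarith)

/-- Weak type `(1, 1)` alone controls the power `s < 1`: the levels form a geometric series of ratio
`2 ^ (s - 1)`. For `s ≥ 1` the constant `ergodicConst s` is infinite. -/
lemma lintegral_ergodicMax_rpow_le [IsProbabilityMeasure μ] (hT : MeasurePreserving T μ μ)
    (hG : Measurable G) {s : ℝ} (hs : 0 < s) :
    ∫⁻ x, ergodicMax T G x ^ s ∂μ ≤ ergodicConst s * (1 + ∫⁻ x, layerSum 0 (G x) ∂μ) := by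
  have hM := measurable_ergodicMax hT.measurable hG
  have hm : ∀ k : ℕ, MeasurableSet {x | 2 ^ k < ergodicMax T G x} := fun k =>
    measurableSet_lt measurable_const hM
  have hm' : ∀ k : ℕ, Measurable fun x => if 2 ^ k < ergodicMax T G x then (1 : ℝ≥0∞) else 0 :=
    fun k => Measurable.ite (hm k) measurable_const measurable_const
  have hI : ∫⁻ x, G x ∂μ ≤ 1 + ∫⁻ x, layerSum 0 (G x) ∂μ := by
    refine (lintegral_mono fun x => le_one_add_layerSum (G x)).trans ?_
    rw [lintegral_add_left measurable_const]
    simp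
  refine (lintegral_mono fun x => rpow_le_one_add_tsum hs _).trans ?_
  rw [lintegral_add_left measurable_const, lintegral_tsum fun k =>
    ((hm' k).const_mul _).aemeasurable, lintegral_one, measure_univ, ergodicConst, add_mul]
  refine add_le_add (by rw [one_mul]; exact le_self_add) ?_
  rw [← ENNReal.tsum_geometric, mul_assoc, ← ENNReal.tsum_mul_right, ← ENNReal.tsum_mul_left]
  refine ENNReal.tsum_le_tsum fun k => ?_
  rw [lintegral_const_mul _ (hm' k)]
  have h1 : ∫⁻ x, (if 2 ^ k < ergodicMax T G x then (1 : ℝ≥0∞) else 0) ∂μ =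
      μ {x | 2 ^ k < ergodicMax T G x} := lintegral_ite_lt hM _
  have h2 := (mul_measure_lt_ergodicMax_le hT hG (2 ^ k)).trans hI
  have h3 : ((2 : ℝ≥0∞) ^ s) ^ k = (2 ^ (s - 1)) ^ k * 2 ^ k := by
    rw [← mul_pow]
    nth_rewrite 3 [← ENNReal.rpow_one 2]
    rw [← ENNReal.rpow_add _ _ (by norm_num) (by simp), sub_add_cancel]
  rw [h1, pow_succ', h3]
  calc 2 ^ s * ((2 ^ (s - 1)) ^ k * 2 ^ k) * μ {x | 2 ^ k < ergodicMax T G x}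
      = 2 ^ s * ((2 ^ (s - 1)) ^ k * (2 ^ k * μ {x | 2 ^ k < ergodicMax T G x})) := by ring
    _ ≤ _ := by gcongr

end ergodic_log

/-! ### Lattice shifts and the strong maximal theorem. -/

/-- The field `η` translated by `v`. -/
def siteShift {d : ℕ} (v : Fin d → ℤ) (η : (Fin d → ℤ) → ℝ) (u : Fin d → ℤ) : ℝ := η (u - v)

/-- The field `ω` seen from the site `i`, with reversed orientation. -/
def siteReflect {d : ℕ} (i : Fin d → ℤ) (ω : (Fin d → ℤ) → ℝ) (u : Fin d → ℤ) : ℝ := ω (i - u)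

section shift
variable {d : ℕ}

lemma measurable_siteReflect (i : Fin d → ℤ) : Measurable (siteReflect i) := by
  unfold siteReflect; fun_prop

lemma siteReflect_add (i v : Fin d → ℤ) (ω : (Fin d → ℤ) → ℝ) :
    siteReflect (i + v) ω = siteShift v (siteReflect i ω) := by
  ext u
  simp only [siteReflect, siteShift]
  congr 1
  abel

lemma siteShift_add (v w : Fin d → ℤ) (η : (Fin d → ℤ) → ℝ) :
    siteShift (v + w) η = siteShift v (siteShift w η) := by
  ext u
  simp only [siteShift]
  congr 1
  abel

lemma siteShift_zero (η : (Fin d → ℤ) → ℝ) : siteShift 0 η = η := by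
  ext u; simp [siteShift]

lemma iterate_siteShift (v : Fin d → ℤ) (k : ℕ) (η : (Fin d → ℤ) → ℝ) :
    (siteShift v)^[k] η = siteShift (k • v) η := by
  induction k with
  | zero => simp [siteShift_zero]
  | succ k ih => rw [Function.iterate_succ_apply', ih, succ_nsmul', siteShift_add]

variable (μ₀ : Measure ℝ) [IsProbabilityMeasure μ₀]

lemma measurePreserving_siteShift (v : Fin d → ℤ) :
    MeasurePreserving (siteShift v) (iidMeasure _ μ₀) (iidMeasure _ μ₀) :=
  measurePreserving_reindex μ₀ (g := fun u => u - v) fun a b h => by simpa using h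

lemma measurePreserving_siteReflect (i : Fin d → ℤ) :
    MeasurePreserving (siteReflect i) (iidMeasure _ μ₀) (iidMeasure _ μ₀) :=
  measurePreserving_reindex μ₀ (g := fun u => i - u) fun a b h => by simpa using h

/-- The iterated maximal function along the coordinate directions in the list `l`. -/
noncomputable def iterMax (l : List (Fin d)) (g : ((Fin d → ℤ) → ℝ) → ℝ≥0∞) :
    ((Fin d → ℤ) → ℝ) → ℝ≥0∞ :=
  l.foldr (fun q G => ergodicMax (siteShift (Pi.single q 1)) G) g

omit [IsProbabilityMeasure μ₀] in
lemma measurable_siteShift (v : Fin d → ℤ) : Measurable (siteShift v) := by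
  unfold siteShift; fun_prop

lemma measurable_iterMax (l : List (Fin d)) {g : ((Fin d → ℤ) → ℝ) → ℝ≥0∞} (hg : Measurable g) :
    Measurable (iterMax l g) := by
  induction l with
  | nil => exact hg
  | cons q l ih => exact measurable_ergodicMax (measurable_siteShift _) ih

/-- The lattice points of a box in the coordinate subspace spanned by `l`. -/
def cornerBox (l : List (Fin d)) (n : Fin d → ℕ) : Finset (Fin d → ℕ) :=
  Fintype.piFinset fun q => if q ∈ l then Finset.range (n q) else {0}

lemma sum_cornerBox_cons {β : Type*} [AddCommMonoid β] {l : List (Fin d)} {q : Fin d} (hq : q ∉ l)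
    (n : Fin d → ℕ) (F : (Fin d → ℕ) → β) :
    ∑ k ∈ cornerBox (q :: l) n, F k =
      ∑ m ∈ Finset.range (n q), ∑ k ∈ cornerBox l n, F (k + Pi.single q m) := by
  rw [← Finset.sum_product']
  symm
  refine Finset.sum_bij' (fun x _ => x.2 + Pi.single q x.1)
    (fun k _ => (k q, Function.update k q 0)) ?_ ?_ ?_ ?_ ?_
  · rintro ⟨m, k⟩ h
    simp only [Finset.mem_product, Finset.mem_range, cornerBox, Fintype.mem_piFinset] at h ⊢
    intro a
    have hk := h.2 a
    rcases eq_or_ne a q with rfl | ha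
    · simp_all
    · simpa [ha] using hk
  · intro k h
    simp only [Finset.mem_product, Finset.mem_range, cornerBox, Fintype.mem_piFinset] at h ⊢
    refine ⟨by simpa using h q, fun a => ?_⟩
    rcases eq_or_ne a q with rfl | ha
    · simp [hq]
    · simpa [ha] using h a
  · rintro ⟨m, k⟩ h
    simp only [Finset.mem_product, Finset.mem_range, cornerBox, Fintype.mem_piFinset] at h
    have hk : k q = 0 := by simpa [hq] using h.2 q
    simp only [Pi.add_apply, Pi.single_eq_same, hk, zero_add, Prod.mk.injEq, true_and]
    ext a
    rcases eq_or_ne a q with rfl | ha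
    · simp [hk]
    · simp [ha]
  · intro k h
    ext a
    rcases eq_or_ne a q with rfl | ha
    · simp
    · simp [ha]
  · rintro ⟨m, k⟩ h
    rfl

/-- A box is averaged one direction at a time: the slices are bounded by `iterMax l g` at the
shifted fields, and these values are then averaged along the direction `q`. -/
lemma sum_cornerBox_le (l : List (Fin d)) (hl : l.Nodup) {n : Fin d → ℕ} (hn : ∀ q, n q ≠ 0)
    (g : ((Fin d → ℤ) → ℝ) → ℝ≥0∞) (η : (Fin d → ℤ) → ℝ) :
    ∑ k ∈ cornerBox l n, g (siteShift (fun q => (k q : ℤ)) η) ≤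
      (l.map fun q => (n q : ℝ≥0∞)).prod * iterMax l g η := by
  induction l generalizing η with
  | nil =>
    have : cornerBox ([] : List (Fin d)) n = {0} := by
      ext k
      simp [cornerBox, funext_iff]
    rw [this]
    simp only [Finset.sum_singleton, List.map_nil, List.prod_nil, one_mul]
    exact le_of_eq (congrArg g (siteShift_zero η))
  | cons q l ih =>
    rw [List.nodup_cons] at hl
    rw [sum_cornerBox_cons hl.1, List.map_cons, List.prod_cons]
    set P := (l.map fun q => (n q : ℝ≥0∞)).prod
    obtain ⟨N, hN⟩ := Nat.exists_eq_succ_of_ne_zero (hn q)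
    calc ∑ m ∈ Finset.range (n q), ∑ k ∈ cornerBox l n,
          g (siteShift (fun a => ((k + Pi.single q m : Fin d → ℕ) a : ℤ)) η)
        ≤ ∑ m ∈ Finset.range (n q),
          P * iterMax l g ((siteShift (Pi.single q 1))^[m] η) := by
          refine Finset.sum_le_sum fun m _ => ?_
          refine le_trans (le_of_eq ?_) (ih hl.2 _)
          refine Finset.sum_congr rfl fun k _ => ?_
          rw [iterate_siteShift, ← siteShift_add]
          congr 2
          ext a
          rcases eq_or_ne a q with rfl | ha
          · simp
          · simp [ha]
      _ = P * ∑ m ∈ Finset.range (n q), iterMax l g ((siteShift (Pi.single q 1))^[m] η) := by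
          rw [Finset.mul_sum]
      _ ≤ P * ((n q : ℝ≥0∞) * iterMax (q :: l) g η) := by
          gcongr
          rw [hN, mul_comm, ← ENNReal.div_le_iff_le_mul (by simp) (by simp)]
          exact le_iSup (fun N : ℕ => (∑ k ∈ Finset.range (N + 1),
            iterMax l g ((siteShift (Pi.single q 1))^[k] η)) / ((N + 1 : ℕ) : ℝ≥0∞)) N
      _ = _ := by ring

/-- The relation `r + l.length = m` records the exchange of one power of the logarithm for each
direction. -/
lemma exists_lintegral_layerSum_iterMax_le (m : ℕ) {B : ℝ≥0∞} (hB : B ≠ ⊤) :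
    ∃ C : ℝ≥0∞, C ≠ ⊤ ∧ ∀ (r : ℕ) (l : List (Fin d)) (μ₀ : Measure ℝ) [IsProbabilityMeasure μ₀]
      (g : ((Fin d → ℤ) → ℝ) → ℝ≥0∞), r + l.length = m → Measurable g →
      ∫⁻ η, layerSum m (g η) ∂iidMeasure _ μ₀ ≤ B →
      ∫⁻ η, layerSum r (iterMax l g η) ∂iidMeasure _ μ₀ ≤ C := by
  -- The induction gives a constant for each length of the list; only lengths up to `m` occur, so
  -- their sum serves for all.
  suffices h : ∀ k : ℕ, ∃ C : ℝ≥0∞, C ≠ ⊤ ∧ ∀ (r : ℕ) (l : List (Fin d)) (μ₀ : Measure ℝ)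
      [IsProbabilityMeasure μ₀] (g : ((Fin d → ℤ) → ℝ) → ℝ≥0∞), l.length = k → r + l.length = m →
      Measurable g → ∫⁻ η, layerSum m (g η) ∂iidMeasure _ μ₀ ≤ B →
      ∫⁻ η, layerSum r (iterMax l g η) ∂iidMeasure _ μ₀ ≤ C by
    choose C hC h using h
    refine ⟨∑ k ∈ Finset.range (m + 1), C k, ENNReal.sum_ne_top.2 fun k _ => hC k, ?_⟩
    intro r l μ₀ _ g hl hg hB'
    refine (h l.length r l μ₀ g rfl hl hg hB').trans ?_
    exact Finset.single_le_sum (f := C) (fun _ _ => zero_le)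
      (Finset.mem_range.2 (by omega))
  intro k
  induction k with
  | zero =>
    refine ⟨B, hB, fun r l μ₀ _ g hl hr hg hB' => ?_⟩
    obtain rfl := List.length_eq_zero_iff.1 hl
    obtain rfl : r = m := by simpa using hr
    exact hB'
  | succ k ih =>
    obtain ⟨C, hC, ih⟩ := ih
    refine ⟨1 + 2 ^ (m + 2) * C, by simp [hC, ENNReal.mul_eq_top], fun r l μ₀ _ g hl hr hg hB' => ?_⟩
    obtain ⟨q, l, rfl⟩ := List.exists_cons_of_ne_nil (List.ne_nil_of_length_eq_add_one hl)
    simp only [List.length_cons, add_left_inj] at hl hr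
    refine (lintegral_layerSum_ergodicMax_le (measurePreserving_siteShift μ₀ _)
      (measurable_iterMax l hg) r).trans ?_
    gcongr
    · norm_num
    · omega
    · exact ih (r + 1) l μ₀ g hl (by omega) hg hB'

end shift

/-- The maximal function of the averages of `u` over the rectangles `1 ≼ i ≼ n`. -/
noncomputable def rectMax {d : ℕ} (u : ((Fin d → ℤ) → ℝ) → ℝ≥0∞) (ω : (Fin d → ℤ) → ℝ) : ℝ≥0∞ :=
  ⨆ n : Fin d → ℕ+, (∑ i ∈ Finset.Icc (1 : Fin d → ℤ) (fun q => ((n q : ℕ) : ℤ)),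
    u (siteReflect i ω)) / ∏ q, ((n q : ℕ) : ℝ≥0∞)

lemma measurable_rectMax {d : ℕ} {u : ((Fin d → ℤ) → ℝ) → ℝ≥0∞} (hu : Measurable u) :
    Measurable (rectMax u) :=
  Measurable.iSup fun _ => (Finset.measurable_fun_sum _ fun i _ =>
    hu.comp (measurable_siteReflect i)).div_const _

lemma rectMax_le_iterMax {d : ℕ} (u : ((Fin d → ℤ) → ℝ) → ℝ≥0∞) (ω : (Fin d → ℤ) → ℝ) :
    rectMax u ω ≤ iterMax (List.finRange d) u (siteReflect 1 ω) := by
  refine iSup_le fun n => ?_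
  refine ENNReal.div_le_of_le_mul ?_
  have h := sum_cornerBox_le (List.finRange d) (List.nodup_finRange d) (n := fun q => n q)
    (fun q => (n q).ne_zero) u (siteReflect 1 ω)
  rw [mul_comm]
  convert h using 1
  · refine Finset.sum_bij' (fun i _ q => (i q - 1).toNat) (fun k _ q => (k q : ℤ) + 1) ?_ ?_ ?_ ?_ ?_
    · intro i hi
      simp only [Finset.mem_Icc, Pi.le_def, Pi.one_apply] at hi
      simp only [cornerBox, Fintype.mem_piFinset, List.mem_finRange, if_true, Finset.mem_range]
      intro q
      have := hi.1 q
      have := hi.2 q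
      have := (n q).pos
      omega
    · intro k hk
      simp only [cornerBox, Fintype.mem_piFinset, List.mem_finRange, if_true,
        Finset.mem_range] at hk
      simp only [Finset.mem_Icc, Pi.le_def, Pi.one_apply]
      exact ⟨fun q => by omega, fun q => by have := hk q; omega⟩
    · intro i hi
      simp only [Finset.mem_Icc, Pi.le_def, Pi.one_apply] at hi
      ext q
      have := hi.1 q
      simp only
      omega
    · intro k hk
      ext q
      simp
    · intro i hi
      simp only [Finset.mem_Icc, Pi.le_def, Pi.one_apply] at hi
      rw [← siteReflect_add]
      congr 2
      ext q
      have := hi.1 q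
      simp only [Pi.add_apply, Pi.one_apply]
      omega
  · rw [← List.ofFn_eq_map, List.prod_ofFn]

/-- The strong maximal theorem in the Zygmund class `L log^(d-1) L`. -/
theorem exists_lintegral_rectMax_rpow_le {d : ℕ} (hd : 1 ≤ d) {s : ℝ} (hs : 0 < s) (hs1 : s < 1)
    {B : ℝ≥0∞} (hB : B ≠ ⊤) :
    ∃ C : ℝ≥0∞, C ≠ ⊤ ∧ ∀ (μ₀ : Measure ℝ) [IsProbabilityMeasure μ₀]
      (u : ((Fin d → ℤ) → ℝ) → ℝ≥0∞), Measurable u →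
      ∫⁻ η, layerSum (d - 1) (u η) ∂iidMeasure _ μ₀ ≤ B →
      ∫⁻ ω, rectMax u ω ^ s ∂iidMeasure _ μ₀ ≤ C := by
  obtain ⟨C, hC, h⟩ := exists_lintegral_layerSum_iterMax_le (d := d) (d - 1) hB
  refine ⟨ergodicConst s * (1 + C), ENNReal.mul_ne_top (ergodicConst_ne_top hs1) (by simp [hC]),
    fun μ₀ _ u hu hu' => ?_⟩
  have hlen : (List.finRange d).length = d := List.length_finRange
  -- The outermost direction only needs the weak type bound, so `d` directions cost `d - 1`
  -- logarithms.
  obtain ⟨q, l, hl⟩ := List.exists_cons_of_ne_nil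
    (List.ne_nil_of_length_eq_add_one (n := d - 1) (by omega) : List.finRange d ≠ [])
  have hl' : l.length = d - 1 := by rw [hl, List.length_cons] at hlen; omega
  calc ∫⁻ ω, rectMax u ω ^ s ∂iidMeasure _ μ₀
      ≤ ∫⁻ ω, iterMax (List.finRange d) u (siteReflect 1 ω) ^ s ∂iidMeasure _ μ₀ :=
        lintegral_mono fun ω => ENNReal.rpow_le_rpow (rectMax_le_iterMax u ω) hs.le
    _ = ∫⁻ ω, iterMax (List.finRange d) u ω ^ s ∂iidMeasure _ μ₀ :=
        (measurePreserving_siteReflect μ₀ 1).lintegral_comp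
          ((measurable_iterMax _ hu).pow_const s)
    _ ≤ ergodicConst s * (1 + ∫⁻ ω, layerSum 0 (iterMax l u ω) ∂iidMeasure _ μ₀) := by
        rw [hl]
        exact lintegral_ergodicMax_rpow_le (measurePreserving_siteShift μ₀ _)
          (measurable_iterMax l hu) hs
    _ ≤ _ := by
        gcongr
        exact h 0 l μ₀ u (by omega) hu hu'

/-! ### Exponential moments of Rademacher sums. -/

/-- The sign `±1` encoded by a boolean. -/
def boolSign (b : Bool) : ℝ := if b then 1 else -1

lemma boolSign_not (b : Bool) : boolSign (!b) = -boolSign b := by cases b <;> simp [boolSign]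

/-- The sum over signs factorizes over `κ`, and `cosh x ≤ exp (x ^ 2 / 2)`. -/
lemma sum_exp_rademacher_le {κ : Type*} [Fintype κ] [DecidableEq κ] (y : κ → ℝ) (t : ℝ) :
    ∑ s : κ → Bool, Real.exp (t * ∑ k, boolSign (s k) * y k) ≤
      2 ^ Fintype.card κ * Real.exp (t ^ 2 * (∑ k, y k ^ 2) / 2) := by
  have h1 : ∀ s : κ → Bool, Real.exp (t * ∑ k, boolSign (s k) * y k) =
      ∏ k, Real.exp (t * (boolSign (s k) * y k)) := fun s => by
    rw [← Real.exp_sum, Finset.mul_sum]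
  simp only [h1]
  rw [← Fintype.piFinset_univ, ← Finset.prod_univ_sum (fun _ => Finset.univ)
    (fun k b => Real.exp (t * (boolSign b * y k)))]
  have h2 : t ^ 2 * (∑ k, y k ^ 2) / 2 = ∑ k, (t * y k) ^ 2 / 2 := by
    rw [Finset.mul_sum, Finset.sum_div]
    exact Finset.sum_congr rfl fun k _ => by ring
  rw [h2, Real.exp_sum, ← Finset.card_univ, ← Finset.prod_const, ← Finset.prod_mul_distrib]
  refine Finset.prod_le_prod (fun k _ => Finset.sum_nonneg fun b _ => (Real.exp_pos _).le)
    fun k _ => ?_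
  have := Real.cosh_le_exp_half_sq (t * y k)
  rw [Real.cosh_eq] at this
  simp only [Fintype.sum_bool, boolSign, if_true, Bool.false_eq_true, if_false, one_mul, neg_mul,
    mul_neg]
  linarith

lemma lintegral_exp_gaussian (t : ℝ) :
    ∫⁻ g, ENNReal.ofReal (Real.exp (t * g)) ∂gaussianReal 0 1 =
      ENNReal.ofReal (Real.exp (t ^ 2 / 2)) := by
  rw [← ofReal_integral_eq_lintegral_ofReal (integrable_exp_mul_gaussianReal t)
    (Filter.Eventually.of_forall fun _ => (Real.exp_pos _).le)]
  have := mgf_gaussianReal (p := gaussianReal 0 1) (X := id) (μ := 0) (v := 1) (by simp) t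
  simp only [mgf, id] at this
  rw [this]
  simp

lemma lintegral_exp_sq_gaussian_le :
    ∫⁻ g, ENNReal.ofReal (Real.exp (g ^ 2 / 4)) ∂gaussianReal 0 1 ≤ 2 := by
  rw [gaussianReal_of_var_ne_zero _ one_ne_zero,
    lintegral_withDensity_eq_lintegral_mul _ (measurable_gaussianPDF _ _) (by fun_prop)]
  have h1 : ∀ g : ℝ, (gaussianPDF 0 1 * fun g => ENNReal.ofReal (Real.exp (g ^ 2 / 4))) g =
      ENNReal.ofReal ((√(2 * Real.pi))⁻¹ * Real.exp (-(1 / 4) * g ^ 2)) := fun g => by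
    simp only [Pi.mul_apply, gaussianPDF, gaussianPDFReal]
    rw [← ENNReal.ofReal_mul (by positivity), mul_assoc, ← Real.exp_add]
    congr 2
    · simp
    · congr 1; simp; ring
  simp only [h1]
  rw [← ofReal_integral_eq_lintegral_ofReal
    ((integrable_exp_neg_mul_sq (by norm_num)).const_mul _)
    (Filter.Eventually.of_forall fun _ => by positivity), integral_const_mul, integral_gaussian]
  have h2 : (√(2 * Real.pi))⁻¹ * √(Real.pi / (1 / 4)) ≤ 2 := by
    rw [inv_mul_le_iff₀ (by positivity), show Real.pi / (1 / 4) = 2 * (2 * Real.pi) by ring,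
      Real.sqrt_mul (by norm_num), mul_comm]
    gcongr
    rw [Real.sqrt_le_left (by norm_num)]
    norm_num
  calc _ ≤ ENNReal.ofReal 2 := ENNReal.ofReal_le_ofReal h2
    _ = 2 := by simp

/-- Rademacher sums are square-exponentially integrable. -/
lemma sum_exp_sq_rademacher_le {κ : Type*} [Fintype κ] [DecidableEq κ] (y : κ → ℝ) :
    ∑ s : κ → Bool, Real.exp ((∑ k, boolSign (s k) * y k) ^ 2 / (4 * ∑ k, y k ^ 2)) ≤
      2 * 2 ^ Fintype.card κ := by
  set V := ∑ k, y k ^ 2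
  set T : (κ → Bool) → ℝ := fun s => ∑ k, boolSign (s k) * y k
  have hV0 : 0 ≤ V := Finset.sum_nonneg fun k _ => sq_nonneg _
  rcases hV0.eq_or_lt with hV | hV
  · rw [← hV]
    simp
  have hs : 0 < √(2 * V) := by positivity
  have hs2 : √(2 * V) ^ 2 = 2 * V := Real.sq_sqrt (by positivity)
  -- Gaussian linearization: `exp (T ^ 2 / (4 * V))` is the mean of `exp (T * g / √(2 * V))` for a
  -- standard Gaussian `g`. Summing over the signs first leaves the Gaussian mean of `exp (g ^ 2 /
  -- 4)`.
  have key : ENNReal.ofReal (∑ s, Real.exp (T s ^ 2 / (4 * V))) ≤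
      ENNReal.ofReal (2 * 2 ^ Fintype.card κ) := by
    calc ENNReal.ofReal (∑ s, Real.exp (T s ^ 2 / (4 * V)))
        = ∑ s, ∫⁻ g, ENNReal.ofReal (Real.exp (T s / √(2 * V) * g)) ∂gaussianReal 0 1 := by
          rw [ENNReal.ofReal_sum_of_nonneg fun _ _ => (Real.exp_pos _).le]
          refine Finset.sum_congr rfl fun s _ => ?_
          rw [lintegral_exp_gaussian, div_pow, hs2]
          congr 2
          field_simp
          norm_num
      _ = ∫⁻ g, ENNReal.ofReal (∑ s, Real.exp (g / √(2 * V) * T s)) ∂gaussianReal 0 1 := by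
          rw [← lintegral_finsetSum _ fun s _ => by fun_prop]
          refine lintegral_congr fun g => ?_
          rw [ENNReal.ofReal_sum_of_nonneg fun _ _ => (Real.exp_pos _).le]
          refine Finset.sum_congr rfl fun s _ => ?_
          congr 2; ring
      _ ≤ ∫⁻ g, 2 ^ Fintype.card κ * ENNReal.ofReal (Real.exp (g ^ 2 / 4)) ∂gaussianReal 0 1 := by
          refine lintegral_mono fun g => ?_
          refine (ENNReal.ofReal_le_ofReal (sum_exp_rademacher_le y (g / √(2 * V)))).trans ?_
          rw [ENNReal.ofReal_mul (by positivity), ENNReal.ofReal_pow (by norm_num),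
            ENNReal.ofReal_ofNat]
          have : (g / √(2 * V)) ^ 2 * V / 2 = g ^ 2 / 4 := by
            rw [div_pow, hs2]
            field_simp
            norm_num
          rw [show ∑ k, y k ^ 2 = V from rfl, this]
      _ ≤ 2 ^ Fintype.card κ * 2 := by
          rw [lintegral_const_mul _ (by fun_prop)]
          gcongr
          exact lintegral_exp_sq_gaussian_le
      _ = _ := by
          rw [ENNReal.ofReal_mul (by norm_num), ENNReal.ofReal_pow (by norm_num),
            ENNReal.ofReal_ofNat, mul_comm]
  exact (ENNReal.ofReal_le_ofReal_iff (by positivity)).1 key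

/-! ### Lévy's maximal inequality, with one reflection argument per direction. -/

section levy
variable {S : Type*} [Fintype S]

/-- Layer cake formula for the counting measure. -/
lemma sum_le_two_mul_sum_of_card_le {F G : S → ℝ≥0}
    (h : ∀ t : ℝ≥0, (Finset.univ.filter fun s => t < F s).card ≤
      2 * (Finset.univ.filter fun s => t < G s).card) :
    ∑ s, F s ≤ 2 * ∑ s, G s := by
  let _ : MeasurableSpace S := ⊤
  have key : ∀ H : S → ℝ≥0, ((∑ s, H s : ℝ≥0) : ℝ≥0∞) = ∫⁻ t in Set.Ioi (0 : ℝ),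
      Measure.count {s | t < (H s : ℝ)} := fun H => by
    rw [← lintegral_eq_lintegral_meas_lt Measure.count
      (Filter.Eventually.of_forall fun s => (H s).coe_nonneg) (measurable_from_top.aemeasurable),
      lintegral_count, tsum_fintype]
    push_cast
    exact Finset.sum_congr rfl fun s _ => by simp
  have hc : ∀ (H : S → ℝ≥0) (t : ℝ≥0), (Measure.count {s | (t : ℝ) < (H s : ℝ)} : ℝ≥0∞) =
      ((Finset.univ.filter fun s => t < H s).card : ℝ≥0∞) := fun H t => by
    have : {s | (t : ℝ) < (H s : ℝ)} = ((Finset.univ.filter fun s => t < H s : Finset S) : Set S) := by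
      ext s; simp
    rw [this, Measure.count_apply_finset]
  have : ((∑ s, F s : ℝ≥0) : ℝ≥0∞) ≤ ((2 * ∑ s, G s : ℝ≥0) : ℝ≥0∞) := by
    rw [ENNReal.coe_mul, key F, key G, ENNReal.coe_ofNat, ← lintegral_const_mul' _ _ (by simp)]
    refine setLIntegral_mono' measurableSet_Ioi fun t ht => ?_
    lift t to ℝ≥0 using (le_of_lt ht)
    rw [hc, hc]
    exact_mod_cast h t
  exact_mod_cast this

/-- Lévy's maximal inequality, for a sequence of reflections. -/
lemma sum_sup_le_two_mul_sum (M : ℕ) (W : ℕ → S → ℝ≥0) (R : ℕ → S → S)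
    (hR : ∀ l, Function.Injective (R l))
    (hinv : ∀ l ≤ M, ∀ l' ≤ l, ∀ s, W l' (R l s) = W l' s)
    (hmax : ∀ l ≤ M, ∀ s, W l s ≤ max (W M s) (W M (R l s))) :
    ∑ s, (Finset.range (M + 1)).sup (fun l => W l s) ≤ 2 * ∑ s, W M s := by
  classical
  refine sum_le_two_mul_sum_of_card_le fun t => ?_
  set A := Finset.univ.filter fun s => t < (Finset.range (M + 1)).sup fun l => W l s
  set B := Finset.univ.filter fun s => t < W M s
  have hA : ∀ s ∈ A, ∃ l, l ≤ M ∧ t < W l s := fun s hs => by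
    obtain ⟨l, hl, h⟩ := Finset.lt_sup_iff.1 (Finset.mem_filter.1 hs).2
    exact ⟨l, by simpa [Nat.lt_succ_iff] using hl, h⟩
  -- First passage above `t`. The value `0` off `A` plays no role.
  let τ : S → ℕ := fun s => if h : ∃ l, l ≤ M ∧ t < W l s then Nat.find h else 0
  have hτ : ∀ s ∈ A, τ s ≤ M ∧ t < W (τ s) s ∧ ∀ l < τ s, ¬ t < W l s := fun s hs => by
    have h := hA s hs
    simp only [τ, dif_pos h]
    refine ⟨(Nat.find_spec h).1, (Nat.find_spec h).2, fun l hl hlt => ?_⟩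
    exact Nat.find_min h hl ⟨hl.le.trans (Nat.find_spec h).1, hlt⟩
  have hτeq : ∀ s ∈ A, ∀ l, l ≤ M → t < W l s → (∀ l' < l, ¬ t < W l' s) → τ s = l := by
    intro s hs l hl h1 h2
    obtain ⟨_, h3, h4⟩ := hτ s hs
    rcases lt_trichotomy (τ s) l with h | h | h
    · exact absurd h3 (h2 _ h)
    · exact h
    · exact absurd h1 (h4 _ h)
  let ρ : S → S := fun s => R (τ s) s
  have hρA : ∀ s ∈ A, ρ s ∈ A ∧ τ (ρ s) = τ s := fun s hs => by
    obtain ⟨h1, h2, h3⟩ := hτ s hs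
    have h2' : t < W (τ s) (ρ s) := by rwa [hinv _ h1 _ le_rfl]
    have hmem : ρ s ∈ A := Finset.mem_filter.2 ⟨Finset.mem_univ _, Finset.lt_sup_iff.2
      ⟨τ s, by simpa [Nat.lt_succ_iff] using h1, h2'⟩⟩
    exact ⟨hmem, hτeq _ hmem _ h1 h2' fun l hl => by
      rw [hinv _ h1 _ hl.le]; exact h3 l hl⟩
  -- The reflection at time `τ` does not alter the past up to `τ`, so `τ` can be read off from `ρ
  -- s`, and each `R l` is injective.
  have hρ : Set.InjOn ρ A := fun s hs s' hs' h => by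
    have : τ s = τ s' := by rw [← (hρA s hs).2, ← (hρA s' hs').2, h]
    simp only [ρ, this] at h
    exact hR _ h
  have hsub : A ⊆ B ∪ (A.filter fun s => ρ s ∈ B) := fun s hs => by
    obtain ⟨h1, h2, _⟩ := hτ s hs
    rcases lt_max_iff.1 (h2.trans_le (hmax _ h1 s)) with h | h
    · exact Finset.mem_union_left _ (by simpa [B] using h)
    · exact Finset.mem_union_right _ (Finset.mem_filter.2 ⟨hs, by simpa [B] using h⟩)
  have hcard : (A.filter fun s => ρ s ∈ B).card ≤ B.card :=
    Finset.card_le_card_of_injOn ρ (fun s hs => (Finset.mem_filter.1 hs).2)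
      (hρ.mono fun s hs => (Finset.mem_filter.1 hs).1)
  calc A.card ≤ (B ∪ (A.filter fun s => ρ s ∈ B)).card := Finset.card_le_card hsub
    _ ≤ B.card + (A.filter fun s => ρ s ∈ B).card := Finset.card_union_le _ _
    _ ≤ 2 * B.card := by omega

end levy

section signed
variable {d : ℕ} {κ : Type*}

/-- The sum of `x i` over the sites `i ≼ n` of `F`, with the sign of `i` given by `s (k i)`. -/
noncomputable def signedSum (F : Finset (Fin d → ℤ)) (k : (Fin d → ℤ) → κ) (x : (Fin d → ℤ) → ℝ)
    (n : Fin d → ℕ) (s : κ → Bool) : ℝ :=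
  ∑ i ∈ F with ∀ q, i q ≤ (n q : ℤ), boolSign (s (k i)) * x i

open Classical in
/-- The reversal of the signs of the sites of `F` whose coordinate `q` exceeds `l`. -/
noncomputable def signFlip (F : Finset (Fin d → ℤ)) (k : (Fin d → ℤ) → κ) (q : Fin d) (l : ℕ)
    (s : κ → Bool) (c : κ) : Bool :=
  if ∃ i ∈ F, k i = c ∧ (l : ℤ) < i q then !s c else s c

lemma signFlip_injective (F : Finset (Fin d → ℤ)) (k : (Fin d → ℤ) → κ) (q : Fin d) (l : ℕ) :
    Function.Injective (signFlip F k q l) := by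
  intro s s' h
  ext c
  have := congrFun h c
  simp only [signFlip] at this
  split_ifs at this <;> simp_all

lemma signFlip_apply {F : Finset (Fin d → ℤ)} {k : (Fin d → ℤ) → κ} (hk : Set.InjOn k F)
    (q : Fin d) (l : ℕ) (s : κ → Bool) {i : Fin d → ℤ} (hi : i ∈ F) :
    boolSign (signFlip F k q l s (k i)) =
      if (l : ℤ) < i q then -boolSign (s (k i)) else boolSign (s (k i)) := by
  have : (∃ j ∈ F, k j = k i ∧ (l : ℤ) < j q) ↔ (l : ℤ) < i q := by
    constructor
    · rintro ⟨j, hj, hji, hl⟩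
      rwa [← hk hj hi hji]
    · exact fun h => ⟨i, hi, rfl, h⟩
  simp only [signFlip, this]
  split_ifs
  · rw [boolSign_not]
  · rfl

lemma signedSum_signFlip_of_le {F : Finset (Fin d → ℤ)} {k : (Fin d → ℤ) → κ}
    (hk : Set.InjOn k F) (x : (Fin d → ℤ) → ℝ) {n : Fin d → ℕ} {q : Fin d} {l : ℕ} (hn : n q ≤ l)
    (s : κ → Bool) : signedSum F k x n (signFlip F k q l s) = signedSum F k x n s := by
  refine Finset.sum_congr rfl fun i hi => ?_
  obtain ⟨hF, hle⟩ := Finset.mem_filter.1 hi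
  rw [signFlip_apply hk q l s hF, if_neg]
  have := hle q
  omega

/-- The sites beyond `l` in the direction `q` cancel between the configuration and its reflection;
the others are counted twice. -/
lemma two_mul_signedSum {F : Finset (Fin d → ℤ)} {k : (Fin d → ℤ) → κ} (hk : Set.InjOn k F)
    (x : (Fin d → ℤ) → ℝ) (n : Fin d → ℕ) (q : Fin d) {l M : ℕ} (hl : l ≤ M) (s : κ → Bool) :
    2 * signedSum F k x (Function.update n q l) s =
      signedSum F k x (Function.update n q M) s +
        signedSum F k x (Function.update n q M) (signFlip F k q l s) := by
  simp only [signedSum, Finset.sum_filter]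
  rw [Finset.mul_sum, ← Finset.sum_add_distrib]
  refine Finset.sum_congr rfl fun i hi => ?_
  rw [signFlip_apply hk q l s hi]
  have h1 : ∀ m : ℕ, (∀ a, i a ≤ ((Function.update n q m a : ℕ) : ℤ)) ↔
      i q ≤ m ∧ ∀ a, a ≠ q → i a ≤ (n a : ℤ) := fun m => by
    constructor
    · intro h
      exact ⟨by simpa using h q, fun a ha => by simpa [ha] using h a⟩
    · rintro ⟨h, h'⟩ a
      rcases eq_or_ne a q with rfl | ha
      · simpa using h
      · simpa [ha] using h' a ha
  rw [if_congr (h1 l) rfl rfl, if_congr (h1 M) rfl rfl, if_congr (h1 M) rfl rfl]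
  by_cases ha : ∀ a, a ≠ q → i a ≤ (n a : ℤ)
  · by_cases h2 : i q ≤ l
    · have h3 : i q ≤ M := by omega
      have h4 : ¬ (l : ℤ) < i q := by omega
      simp only [h2, h3, h4, true_and, if_false]
      split_ifs
      ring
    · have h4 : (l : ℤ) < i q := by omega
      simp only [h2, h4, false_and, if_false, if_true]
      split_ifs <;> ring
  · simp [ha]

/-- The points of `∏ [0, R q]` whose coordinates outside `J` are extremal. -/
def facetBox (R : Fin d → ℕ) (J : Finset (Fin d)) : Finset (Fin d → ℕ) :=
  Fintype.piFinset fun q => if q ∈ J then Finset.range (R q + 1) else {R q}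

variable [Fintype κ] [DecidableEq κ]

/-- Lévy's maximal inequality for multi-indexed Rademacher sums. -/
lemma sum_sup_signedSum_le {F : Finset (Fin d → ℤ)} {k : (Fin d → ℤ) → κ} (hk : Set.InjOn k F)
    (x : (Fin d → ℤ) → ℝ) (R : Fin d → ℕ) (J : Finset (Fin d)) {G : ℝ≥0 → ℝ≥0} (hG : Monotone G)  :
    ∑ s : κ → Bool, (facetBox R J).sup (fun n => G ‖signedSum F k x n s‖₊) ≤
      2 ^ J.card * ∑ s : κ → Bool, G ‖signedSum F k x R s‖₊ := by
  induction J using Finset.induction_on with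
  | empty =>
    have : facetBox R ∅ = {R} := by
      ext n; simp [facetBox, funext_iff]
    simp [this]
  | insert q J hq ih =>
    -- The maximum over the directions of `J` is treated as a process in the coordinate `q`; its
    -- value at the terminal time `R q` is the induction hypothesis.
    let W : ℕ → (κ → Bool) → ℝ≥0 := fun l s =>
      (facetBox R J).sup fun n => G ‖signedSum F k x (Function.update n q l) s‖₊
    have hupd : ∀ n ∈ facetBox R J, Function.update n q (R q) = n := fun n hn => by
      have := Fintype.mem_piFinset.1 hn q
      simp only [hq, if_false, Finset.mem_singleton] at this
      rw [← this, Function.update_eq_self]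
    have hWM : ∀ s, W (R q) s = (facetBox R J).sup fun n => G ‖signedSum F k x n s‖₊ := fun s =>
      Finset.sup_congr rfl fun n hn => by rw [hupd n hn]
    have h1 : ∀ s, (facetBox R (insert q J)).sup (fun n => G ‖signedSum F k x n s‖₊) ≤
        (Finset.range (R q + 1)).sup fun l => W l s := fun s => by
      refine Finset.sup_le fun n hn => ?_
      have hn' := Fintype.mem_piFinset.1 hn
      have hnq : n q ∈ Finset.range (R q + 1) := by simpa using hn' q
      refine le_trans ?_ (Finset.le_sup hnq)
      have hmem : Function.update n q (R q) ∈ facetBox R J := by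
        refine Fintype.mem_piFinset.2 fun a => ?_
        rcases eq_or_ne a q with rfl | ha
        · simp [hq]
        · have := hn' a
          simp only [Finset.mem_insert, ha, false_or] at this
          simpa [ha] using this
      refine le_trans (le_of_eq ?_) (Finset.le_sup hmem)
      rw [Function.update_idem, Function.update_eq_self]
    have h2 := sum_sup_le_two_mul_sum (R q) W (fun l => signFlip F k q l)
      (signFlip_injective F k q) (fun l hl l' hl' s => by
        refine Finset.sup_congr rfl fun n hn => ?_
        rw [signedSum_signFlip_of_le hk]
        simpa using hl') (fun l hl s => by
        refine Finset.sup_le fun n hn => ?_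
        have h3 := two_mul_signedSum hk x n q hl s
        have h4 : ‖signedSum F k x (Function.update n q l) s‖₊ ≤
            max ‖signedSum F k x (Function.update n q (R q)) s‖₊
              ‖signedSum F k x (Function.update n q (R q)) (signFlip F k q l s)‖₊ := by
          rw [← NNReal.coe_le_coe, NNReal.coe_max]
          simp only [coe_nnnorm, Real.norm_eq_abs]
          set a := signedSum F k x (Function.update n q l) s
          set b := signedSum F k x (Function.update n q (R q)) s
          set c := signedSum F k x (Function.update n q (R q)) (signFlip F k q l s)
          have : 2 * |a| ≤ |b| + |c| := by
            rw [← abs_two, ← abs_mul, h3]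
            exact abs_add_le _ _
          rcases le_total |b| |c| with h | h
          · rw [max_eq_right h]; linarith
          · rw [max_eq_left h]; linarith
        refine (hG h4).trans ?_
        rw [hG.map_max]
        exact max_le_max (Finset.le_sup (f := fun n =>
          G ‖signedSum F k x (Function.update n q (R q)) s‖₊) hn) (Finset.le_sup (f := fun n =>
          G ‖signedSum F k x (Function.update n q (R q)) (signFlip F k q l s)‖₊) hn))
    calc ∑ s : κ → Bool, (facetBox R (insert q J)).sup (fun n => G ‖signedSum F k x n s‖₊)
        ≤ ∑ s : κ → Bool, (Finset.range (R q + 1)).sup (fun l => W l s) :=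
          Finset.sum_le_sum fun s _ => h1 s
      _ ≤ 2 * ∑ s : κ → Bool, W (R q) s := h2
      _ ≤ 2 * (2 ^ J.card * ∑ s : κ → Bool, G ‖signedSum F k x R s‖₊) := by
          simp only [hWM]
          gcongr
      _ = _ := by rw [Finset.card_insert_of_notMem hq, pow_succ]; ring

/-- As `k` is injective on `F`, each sign multiplies at most one term, so grouping by signs
preserves the sum of squares. -/
lemma sum_exp_signedSum_le {F : Finset (Fin d → ℤ)} {k : (Fin d → ℤ) → κ} (hk : Set.InjOn k F)
    (x : (Fin d → ℤ) → ℝ) (R : Fin d → ℕ) :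
    ∑ s : κ → Bool, Real.exp (signedSum F k x R s ^ 2 /
      (4 * ∑ i ∈ F with ∀ q, i q ≤ (R q : ℤ), x i ^ 2)) ≤ 2 * 2 ^ Fintype.card κ := by
  set F' := F.filter fun i => ∀ q, i q ≤ (R q : ℤ)
  have hk' : Set.InjOn k F' := hk.mono fun i hi => (Finset.mem_filter.1 hi).1
  let y : κ → ℝ := fun c => ∑ i ∈ F' with k i = c, x i
  have h1 : ∀ s : κ → Bool, signedSum F k x R s = ∑ c, boolSign (s c) * y c := fun s => by
    simp only [signedSum, y, Finset.mul_sum]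
    rw [← Finset.sum_fiberwise F' k]
    refine Finset.sum_congr rfl fun c _ => Finset.sum_congr rfl fun i hi => ?_
    rw [(Finset.mem_filter.1 hi).2]
  have h2 : ∑ i ∈ F', x i ^ 2 = ∑ c, y c ^ 2 := by
    rw [← Finset.sum_fiberwise F' k]
    refine Finset.sum_congr rfl fun c _ => ?_
    have hcard : (F'.filter fun i => k i = c).card ≤ 1 := Finset.card_le_one.2 fun i hi j hj => by
      simp only [Finset.mem_filter] at hi hj
      exact hk' (by simpa using hi.1) (by simpa using hj.1) (hi.2.trans hj.2.symm)
    rcases Nat.le_one_iff_eq_zero_or_eq_one.1 hcard with h | h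
    · simp [y, Finset.card_eq_zero.1 h]
    · obtain ⟨i, hi⟩ := Finset.card_eq_one.1 h
      simp [y, hi]
  simp only [h1, h2]
  exact sum_exp_sq_rademacher_le y

/-- Square-exponential integrability of the maximum of multi-indexed Rademacher sums. -/
lemma sum_sup_exp_signedSum_le {F : Finset (Fin d → ℤ)} {k : (Fin d → ℤ) → κ} (hk : Set.InjOn k F)
    (x : (Fin d → ℤ) → ℝ) (R : Fin d → ℕ) :
    ∃ W : (κ → Bool) → ℝ, (∀ s, 0 ≤ W s) ∧
      (∀ s, ∀ n : Fin d → ℕ, n ≤ R → |signedSum F k x n s| ≤ W s) ∧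
      ((∑ i ∈ F with ∀ q, i q ≤ (R q : ℤ), x i ^ 2) = 0 → ∀ s, W s = 0) ∧
      ∑ s : κ → Bool, Real.exp (W s ^ 2 / (4 * ∑ i ∈ F with ∀ q, i q ≤ (R q : ℤ), x i ^ 2)) ≤
        2 ^ (d + 1) * 2 ^ Fintype.card κ := by
  set V := ∑ i ∈ F with ∀ q, i q ≤ (R q : ℤ), x i ^ 2 with hV
  have hV0 : 0 ≤ V := Finset.sum_nonneg fun i _ => sq_nonneg _
  let B := facetBox R Finset.univ
  have hB : ∀ n : Fin d → ℕ, n ∈ B ↔ n ≤ R := fun n => by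
    simp [B, facetBox, Pi.le_def]
  let W : (κ → Bool) → ℝ≥0 := fun s => B.sup fun n => ‖signedSum F k x n s‖₊
  refine ⟨fun s => W s, fun s => (W s).coe_nonneg, fun s n hn => ?_, fun h0 s => ?_, ?_⟩
  · have : ‖signedSum F k x n s‖₊ ≤ W s :=
      Finset.le_sup (f := fun n => ‖signedSum F k x n s‖₊) ((hB n).2 hn)
    simpa using NNReal.coe_le_coe.2 this
  -- When the variance is zero the exponent below is a division by zero and carries no information,
  -- hence the separate clause that `W` vanishes.
  · have hx : ∀ i ∈ F.filter (fun i => ∀ q, i q ≤ (R q : ℤ)), x i = 0 := fun i hi => by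
      have := (Finset.sum_eq_zero_iff_of_nonneg fun i _ => sq_nonneg (x i)).1 h0 i hi
      simpa using this
    have hz : W s = 0 := by
      refine le_antisymm (Finset.sup_le fun n hn => ?_) zero_le
      rw [nonpos_iff_eq_zero, nnnorm_eq_zero]
      refine Finset.sum_eq_zero fun i hi => ?_
      obtain ⟨hF, hle⟩ := Finset.mem_filter.1 hi
      rw [hx i (Finset.mem_filter.2 ⟨hF, fun q => (hle q).trans ?_⟩), mul_zero]
      exact_mod_cast (hB n).1 hn q
    simp [hz]
  · let G : ℝ≥0 → ℝ≥0 := fun y => Real.toNNReal (Real.exp ((y : ℝ) ^ 2 / (4 * V)))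
    have hG : Monotone G := fun a b hab => Real.toNNReal_le_toNNReal (by gcongr)
    have hGc : ∀ y, ((G y : ℝ≥0) : ℝ) = Real.exp ((y : ℝ) ^ 2 / (4 * V)) := fun y =>
      Real.coe_toNNReal _ (Real.exp_pos _).le
    have h1 := sum_sup_signedSum_le hk x R Finset.univ hG
    have h2 : ∀ s, G (W s) = B.sup fun n => G ‖signedSum F k x n s‖₊ := fun s => by
      have hne : B.Nonempty := ⟨R, (hB R).2 le_rfl⟩
      obtain ⟨n, hn, hnW⟩ := Finset.exists_mem_eq_sup B hne fun n => ‖signedSum F k x n s‖₊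
      refine le_antisymm ?_ (Finset.sup_le fun n hn => hG (Finset.le_sup
        (f := fun n => ‖signedSum F k x n s‖₊) hn))
      simp only [W]
      rw [hnW]
      exact Finset.le_sup (f := fun n => G ‖signedSum F k x n s‖₊) hn
    have h3 : ∑ s, G (W s) ≤ 2 ^ d * ∑ s : κ → Bool, G ‖signedSum F k x R s‖₊ := by
      simpa [h2] using h1
    have h4 : (∑ s, Real.exp ((W s : ℝ) ^ 2 / (4 * V))) ≤
        2 ^ d * ∑ s : κ → Bool, Real.exp (signedSum F k x R s ^ 2 / (4 * V)) := by
      have := NNReal.coe_le_coe.2 h3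
      simpa [hGc] using this
    refine h4.trans ?_
    have h5 := sum_exp_signedSum_le hk x R
    rw [← hV] at h5
    calc _ ≤ (2 : ℝ) ^ d * (2 * 2 ^ Fintype.card κ) := by gcongr
      _ = _ := by rw [pow_succ]; ring

end signed

/-! ### The bounded law of the iterated logarithm for signed sums. -/

lemma one_le_logL (x : ℝ) : 1 ≤ logL x := le_max_right _ _

lemma one_le_logLL (x : ℝ) : 1 ≤ logLL x := one_le_logL _

lemma logL_mono {x y : ℝ} (hx : 0 < x) (h : x ≤ y) : logL x ≤ logL y :=
  max_le_max (Real.log_le_log hx h) le_rfl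

lemma logLL_mono {x y : ℝ} (hx : 0 < x) (h : x ≤ y) : logLL x ≤ logLL y :=
  logL_mono (zero_lt_one.trans_le (one_le_logL x)) (logL_mono hx h)

/-- `LL x ≥ log (L x)`, and `L x ≥ max (m * log 2) 1 ≥ (m + 1) / 4`. -/
lemma exp_neg_logLL_le {x : ℝ} {m : ℕ} (h : 2 ^ m ≤ x) :
    Real.exp (-logLL x) ≤ 4 / ((m : ℝ) + 1) := by
  have hL : ((m : ℝ) + 1) / 4 ≤ logL x := by
    have h1 : (m : ℝ) * Real.log 2 ≤ logL x := by
      rw [← Real.log_pow]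
      exact (Real.log_le_log (by positivity) h).trans (le_max_left _ _)
    have h2 := one_le_logL x
    have h3 := Real.log_two_gt_d9
    nlinarith [(Nat.cast_nonneg m : (0 : ℝ) ≤ m)]
  have hpos : 0 < logL x := zero_lt_one.trans_le (one_le_logL x)
  calc Real.exp (-logLL x) ≤ Real.exp (-Real.log (logL x)) := by
        gcongr
        exact le_max_left _ _
    _ = (logL x)⁻¹ := by rw [Real.exp_neg, Real.exp_log hpos]
    _ ≤ (((m : ℝ) + 1) / 4)⁻¹ := by gcongr
    _ = _ := by rw [inv_div]

lemma sum_range_inv_sq_le_two (n : ℕ) :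
    ∑ m ∈ Finset.range n, 1 / ((m : ℝ) + 1) ^ 2 ≤ 2 := by
  have key : ∀ n : ℕ, ∑ m ∈ Finset.range (n + 1), 1 / ((m : ℝ) + 1) ^ 2 ≤ 2 - 1 / ((n : ℝ) + 1) := by
    intro n
    induction n with
    | zero => norm_num
    | succ n ih =>
      rw [Finset.sum_range_succ]
      have h : 1 / (((n + 1 : ℕ) : ℝ) + 1) ^ 2 ≤
          1 / ((n : ℝ) + 1) - 1 / (((n + 1 : ℕ) : ℝ) + 1) := by
        push_cast
        rw [div_sub_div _ _ (by positivity) (by positivity), div_le_div_iff₀ (by positivity)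
          (by positivity)]
        nlinarith [(Nat.cast_nonneg n : (0 : ℝ) ≤ n)]
      linarith
  cases n with
  | zero => simp
  | succ n => exact (key n).trans (by have : (0 : ℝ) ≤ 1 / ((n : ℝ) + 1) := by positivity
                                      linarith)

/-- Jensen's inequality with the missing mass `1 - ∑ a, w a` placed at the point `0`. -/
lemma exp_sum_mul_le {A : Type*} [Fintype A] (w y : A → ℝ) (hw : ∀ a, 0 ≤ w a)
    (hw1 : ∑ a, w a ≤ 1) :
    Real.exp (∑ a, w a * y a) ≤ ∑ a, w a * Real.exp (y a) + (1 - ∑ a, w a) := by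
  have := convexOn_exp.map_sum_le (t := Finset.univ)
    (w := fun o : Option A => o.elim (1 - ∑ a, w a) w) (p := fun o => o.elim 0 y)
    (by rintro (_ | a) _ <;> simp [hw, hw1]) (by simp [Fintype.sum_option]) (by simp)
  simp only [Fintype.sum_option, Option.elim, smul_eq_mul, mul_zero, zero_add, Real.exp_zero,
    mul_one] at this
  linarith

/-- The constant of `exists_signed_maximal_bound`. -/
noncomputable def signedConst (d : ℕ) : ℝ := 2 ^ d * (8 * d + 4 * (2 ^ (d + 1) * 32 ^ d))

lemma signedConst_pos (d : ℕ) : 0 < signedConst d := by unfold signedConst; positivity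

/-- The exponent `2 * d` gives a factor `exp (-LL) ^ 2` to each direction. The volume is at least `2
^ l q` for every `q`, so each factor is at most `16 / (l q + 1) ^ 2` and the sum splits into `d`
convergent series. -/
lemma sum_exp_neg_logLL_le (d N : ℕ) :
    ∑ l ∈ Fintype.piFinset (fun _ : Fin d => Finset.range N),
      Real.exp (-(2 * d * logLL (∏ q, (2 : ℝ) ^ l q))) ≤ 32 ^ d := by
  calc ∑ l ∈ Fintype.piFinset (fun _ : Fin d => Finset.range N),
      Real.exp (-(2 * d * logLL (∏ q, (2 : ℝ) ^ l q)))
      ≤ ∑ l ∈ Fintype.piFinset (fun _ : Fin d => Finset.range N),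
        ∏ q, 16 * (1 / ((l q : ℝ) + 1) ^ 2) := by
        refine Finset.sum_le_sum fun l _ => ?_
        have h1 : Real.exp (-(2 * d * logLL (∏ q, (2 : ℝ) ^ l q))) =
            ∏ _q : Fin d, Real.exp (-logLL (∏ q, (2 : ℝ) ^ l q)) ^ 2 := by
          rw [Finset.prod_const, Finset.card_univ, Fintype.card_fin, ← Real.exp_nat_mul,
            ← Real.exp_nat_mul]
          congr 1; push_cast; ring
        rw [h1]
        refine Finset.prod_le_prod (fun _ _ => by positivity) fun q _ => ?_
        have h2 : (2 : ℝ) ^ l q ≤ ∏ q, (2 : ℝ) ^ l q := by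
          rw [← Finset.mul_prod_erase _ _ (Finset.mem_univ q)]
          exact le_mul_of_one_le_right (by positivity)
            (Finset.one_le_prod fun _ _ => one_le_pow₀ (by norm_num))
        calc Real.exp (-logLL (∏ q, (2 : ℝ) ^ l q)) ^ 2 ≤ (4 / ((l q : ℝ) + 1)) ^ 2 := by
              gcongr; exact exp_neg_logLL_le h2
          _ = _ := by rw [div_pow]; ring
    _ = ∏ _q : Fin d, ∑ m ∈ Finset.range N, 16 * (1 / ((m : ℝ) + 1) ^ 2) :=
        (Finset.prod_univ_sum (fun _ : Fin d => Finset.range N)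
          (fun _ m => 16 * (1 / ((m : ℝ) + 1) ^ 2))).symm
    _ ≤ ∏ _q : Fin d, 32 := by
        refine Finset.prod_le_prod (fun _ _ => Finset.sum_nonneg fun _ _ => by positivity)
          fun q _ => ?_
        rw [← Finset.mul_sum]
        linarith [sum_range_inv_sq_le_two N]
    _ = 32 ^ d := by simp

/-- A bounded law of the iterated logarithm for signed sums: `k i` is the index of the sign of the
site `i`, and `a i` distinguishes between the sites with the same sign. -/
theorem exists_signed_maximal_bound {d : ℕ} {κ A : Type*} [Fintype κ] [DecidableEq κ] [Fintype A]
    [DecidableEq A] (R : ℕ) (k : (Fin d → ℤ) → κ) (a : (Fin d → ℤ) → A)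
    (hka : Set.InjOn (fun i => (k i, a i)) (Finset.Icc (1 : Fin d → ℤ) fun _ => (R : ℤ)))
    (x : (Fin d → ℤ) → ℝ) {v : ℝ} (hv0 : 0 < v)
    (hv : ∀ n : Fin d → ℕ+, ∑ i ∈ Finset.Icc (1 : Fin d → ℤ) (fun q => ((n q : ℕ) : ℤ)), x i ^ 2 ≤
      (∏ q, ((n q : ℕ) : ℝ)) * v) :
    ∃ W : (κ → Bool) → ℝ, (∀ s, 0 ≤ W s) ∧
      (∀ s, ∀ n : Fin d → ℕ+, (∀ q, (n q : ℕ) ≤ R) →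
        (∑ i ∈ Finset.Icc (1 : Fin d → ℤ) (fun q => ((n q : ℕ) : ℤ)), boolSign (s (k i)) * x i) ^ 2 ≤
          (∏ q, ((n q : ℕ) : ℝ)) * logLL (∏ q, ((n q : ℕ) : ℝ)) * W s) ∧
      ∑ s, W s ≤ signedConst d * (Fintype.card A * v) * 2 ^ Fintype.card κ := by
  set I : Finset (Fin d → ℤ) := Finset.Icc (1 : Fin d → ℤ) fun _ => (R : ℤ) with hI
  let F : A → Finset (Fin d → ℤ) := fun b => I.filter fun i => a i = b
  have hkF : ∀ b, Set.InjOn k (F b) := fun b i hi j hj hij => by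
    obtain ⟨hi1, hi2⟩ := Finset.mem_filter.1 hi
    obtain ⟨hj1, hj2⟩ := Finset.mem_filter.1 hj
    exact hka hi1 hj1 (Prod.ext hij (hi2.trans hj2.symm))
  -- Upper corner of the dyadic class `2 ^ l q ≤ n q < 2 ^ (l q + 1)`; its volume exceeds that of
  -- any rectangle of the class by a factor `2 ^ d` at most.
  let Rl : (Fin d → ℕ) → Fin d → ℕ := fun l q => 2 ^ (l q + 1)
  let V : (Fin d → ℕ) → A → ℝ := fun l b => ∑ i ∈ F b with ∀ q, i q ≤ (Rl l q : ℤ), x i ^ 2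
  choose W hW0 hWle hWz hWsum using fun (l : Fin d → ℕ) (b : A) =>
    sum_sup_exp_signedSum_le (hkF b) x (Rl l)
  let σ : (Fin d → ℕ) → ℝ := fun l => (∏ q, (Rl l q : ℝ)) * v
  have hσ : ∀ l, 0 < σ l := fun l => mul_pos (Finset.prod_pos fun q _ => by simp [Rl]) hv0
  have hV0 : ∀ l b, 0 ≤ V l b := fun l b => Finset.sum_nonneg fun _ _ => sq_nonneg _
  have hVσ : ∀ l, ∑ b, V l b ≤ σ l := fun l => by
    have h1 : ∑ b, V l b = ∑ i ∈ I with ∀ q, i q ≤ (Rl l q : ℤ), x i ^ 2 := by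
      rw [← Finset.sum_fiberwise (I.filter _) a]
      refine Finset.sum_congr rfl fun b _ => ?_
      simp only [V, F, Finset.filter_filter]
      refine Finset.sum_congr ?_ fun _ _ => rfl
      ext i
      simp only [Finset.mem_filter]
      tauto
    rw [h1]
    refine le_trans (Finset.sum_le_sum_of_subset_of_nonneg (fun i hi => ?_)
      fun _ _ _ => sq_nonneg _) ((hv fun q => ⟨Rl l q, by simp [Rl]⟩).trans_eq rfl)
    simp only [I, Finset.mem_filter, Finset.mem_Icc] at hi ⊢
    exact ⟨hi.1.1, fun q => hi.2 q⟩
  let Q : (Fin d → ℕ) → (κ → Bool) → ℝ := fun l s => (∑ b, W l b s ^ 2) / σ l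
  have hQexp : ∀ l, ∑ s, Real.exp (Q l s / 4) ≤ 2 ^ (d + 1) * 2 ^ Fintype.card κ := fun l => by
    -- Weighting the positions by their shares of the variance makes `Q / 4` a subconvex combination
    -- of exponents that are already controlled.
    let w : A → ℝ := fun b => V l b / σ l
    have hw : ∀ b, 0 ≤ w b := fun b => div_nonneg (hV0 l b) (hσ l).le
    have hw1 : ∑ b, w b ≤ 1 := by
      rw [← Finset.sum_div]
      exact (div_le_one (hσ l)).2 (hVσ l)
    have hQ : ∀ s, Q l s / 4 = ∑ b, w b * (W l b s ^ 2 / (4 * V l b)) := fun s => by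
      simp only [Q, Finset.sum_div]
      refine Finset.sum_congr rfl fun b _ => ?_
      rcases (hV0 l b).eq_or_lt with h | h
      · simp [w, ← h, hWz l b h.symm s]
      · have := hσ l
        simp only [w]
        field_simp
    calc ∑ s, Real.exp (Q l s / 4)
        ≤ ∑ s, (∑ b, w b * Real.exp (W l b s ^ 2 / (4 * V l b)) + (1 - ∑ b, w b)) :=
          Finset.sum_le_sum fun s _ => by rw [hQ]; exact exp_sum_mul_le _ _ hw hw1
      _ = ∑ b, w b * ∑ s, Real.exp (W l b s ^ 2 / (4 * V l b)) +
          (1 - ∑ b, w b) * 2 ^ Fintype.card κ := by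
          rw [Finset.sum_add_distrib, Finset.sum_comm]
          simp only [Finset.mul_sum, Finset.sum_const, Finset.card_univ, Fintype.card_fun,
            Fintype.card_bool, nsmul_eq_mul]
          push_cast
          ring
      _ ≤ ∑ b, w b * (2 ^ (d + 1) * 2 ^ Fintype.card κ) +
          (1 - ∑ b, w b) * (2 ^ (d + 1) * 2 ^ Fintype.card κ) := by
          refine add_le_add (Finset.sum_le_sum fun b _ =>
            mul_le_mul_of_nonneg_left (hWsum l b) (hw b)) (mul_le_mul_of_nonneg_left ?_
            (by linarith))
          exact le_mul_of_one_le_left (by positivity) (one_le_pow₀ (by norm_num))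
      _ = _ := by rw [← Finset.sum_mul]; ring
  let lam : (Fin d → ℕ) → ℝ := fun l => logLL (∏ q, (2 : ℝ) ^ l q)
  let Ls : Finset (Fin d → ℕ) := Fintype.piFinset fun _ => Finset.range (R + 1)
  -- An exponential union bound: one summable quantity dominates every dyadic class simultaneously.
  let E : (κ → Bool) → ℝ := fun s => ∑ l ∈ Ls, Real.exp (Q l s / 4 - 2 * d * lam l)
  refine ⟨fun s => Fintype.card A * v * 2 ^ d * (8 * d + 4 * E s), fun s => ?_, fun s n hn => ?_, ?_⟩
  · have : 0 ≤ E s := Finset.sum_nonneg fun _ _ => (Real.exp_pos _).le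
    positivity
  · let l : Fin d → ℕ := fun q => Nat.log 2 (n q)
    have hl1 : ∀ q, 2 ^ l q ≤ (n q : ℕ) := fun q => Nat.pow_log_le_self 2 (n q).ne_zero
    have hl2 : ∀ q, (n q : ℕ) ≤ Rl l q := fun q => (Nat.lt_pow_succ_log_self (by norm_num) _).le
    have hlmem : l ∈ Ls := Fintype.mem_piFinset.2 fun q => Finset.mem_range.2 (by
      have := Nat.lt_two_pow_self (n := l q)
      have := hl1 q
      have := hn q
      omega)
    have hprod : ∏ q, (2 : ℝ) ^ l q ≤ ∏ q, ((n q : ℕ) : ℝ) :=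
      Finset.prod_le_prod (fun _ _ => by positivity) fun q _ => by exact_mod_cast hl1 q
    have hppos : (0 : ℝ) < ∏ q, (2 : ℝ) ^ l q := Finset.prod_pos fun _ _ => by positivity
    have hlam : lam l ≤ logLL (∏ q, ((n q : ℕ) : ℝ)) := logLL_mono hppos hprod
    have hlam1 : 1 ≤ lam l := one_le_logLL _
    have hσn : σ l ≤ 2 ^ d * (∏ q, ((n q : ℕ) : ℝ)) * v := by
      simp only [σ, Rl]
      gcongr
      push_cast
      simp only [pow_succ]
      rw [Finset.prod_mul_distrib, Finset.prod_const, Finset.card_univ, Fintype.card_fin, mul_comm]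
      gcongr
    have hsplit : ∑ i ∈ Finset.Icc (1 : Fin d → ℤ) (fun q => ((n q : ℕ) : ℤ)),
        boolSign (s (k i)) * x i = ∑ b, signedSum (F b) k x (fun q => n q) s := by
      rw [← Finset.sum_fiberwise _ a]
      refine Finset.sum_congr rfl fun b _ => Finset.sum_congr ?_ fun _ _ => rfl
      ext i
      simp only [F, I, Finset.mem_filter, Finset.mem_Icc, Pi.le_def]
      constructor
      · rintro ⟨⟨h1, h2⟩, h3⟩
        exact ⟨⟨⟨h1, fun q => (h2 q).trans (by exact_mod_cast hn q)⟩, h3⟩, h2⟩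
      · rintro ⟨⟨⟨h1, _⟩, h3⟩, h2⟩
        exact ⟨⟨h1, h2⟩, h3⟩
    have hQ0 : 0 ≤ Q l s := div_nonneg (Finset.sum_nonneg fun _ _ => sq_nonneg _) (hσ l).le
    have hE : Real.exp (Q l s / 4 - 2 * d * lam l) ≤ E s :=
      Finset.single_le_sum (f := fun l => Real.exp (Q l s / 4 - 2 * d * lam l))
        (fun _ _ => (Real.exp_pos _).le) hlmem
    have hE0 : 0 ≤ E s := (Real.exp_pos _).le.trans hE
    -- From `y + 1 ≤ exp y` one gets `Q / 4 - 2 * d * lam ≤ E`; then `lam ≥ 1` is factored out.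
    have hQle : Q l s ≤ lam l * (8 * d + 4 * E s) := by
      have h1 := Real.add_one_le_exp (Q l s / 4 - 2 * d * lam l)
      nlinarith [mul_le_mul_of_nonneg_right hlam1 hE0]
    calc (∑ i ∈ Finset.Icc (1 : Fin d → ℤ) (fun q => ((n q : ℕ) : ℤ)),
          boolSign (s (k i)) * x i) ^ 2
        = (∑ b, signedSum (F b) k x (fun q => n q) s) ^ 2 := by rw [hsplit]
      -- Cauchy–Schwarz over the positions: the source of the factor `Fintype.card A`, later `(2 j +
      -- 1) ^ d`.
      _ ≤ Fintype.card A * ∑ b, signedSum (F b) k x (fun q => n q) s ^ 2 := sq_sum_le_card_mul_sum_sq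
      _ ≤ Fintype.card A * ∑ b, W l b s ^ 2 := by
          refine mul_le_mul_of_nonneg_left (Finset.sum_le_sum fun b _ => ?_) (Nat.cast_nonneg _)
          rw [sq_le_sq, abs_of_nonneg (hW0 l b s)]
          exact hWle l b s (fun q => n q) hl2
      _ = Fintype.card A * (σ l * Q l s) := by
          rw [mul_div_cancel₀ _ (hσ l).ne']
      _ ≤ Fintype.card A * ((2 ^ d * (∏ q, ((n q : ℕ) : ℝ)) * v) *
          (logLL (∏ q, ((n q : ℕ) : ℝ)) * (8 * d + 4 * E s))) := by
          gcongr
          exact hQle.trans (by gcongr)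
      _ = _ := by ring
  · have hEsum : ∑ s, E s ≤ 32 ^ d * (2 ^ (d + 1) * 2 ^ Fintype.card κ) := by
      simp only [E]
      rw [Finset.sum_comm]
      calc ∑ l ∈ Ls, ∑ s, Real.exp (Q l s / 4 - 2 * d * lam l)
          = ∑ l ∈ Ls, Real.exp (-(2 * d * lam l)) * ∑ s, Real.exp (Q l s / 4) := by
            refine Finset.sum_congr rfl fun l _ => ?_
            rw [Finset.mul_sum]
            refine Finset.sum_congr rfl fun s _ => ?_
            rw [← Real.exp_add]; congr 1; ring
        _ ≤ ∑ l ∈ Ls, Real.exp (-(2 * d * lam l)) * (2 ^ (d + 1) * 2 ^ Fintype.card κ) := by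
            gcongr with l
            exact hQexp l
        _ ≤ _ := by
            rw [← Finset.sum_mul]
            gcongr
            exact sum_exp_neg_logLL_le d (R + 1)
    rw [← Finset.mul_sum, Finset.sum_add_distrib, ← Finset.mul_sum Finset.univ E 4]
    simp only [Finset.sum_const, Finset.card_univ, Fintype.card_fun, Fintype.card_bool,
      nsmul_eq_mul, signedConst]
    push_cast
    have h1 : 0 ≤ (Fintype.card A : ℝ) * v * 2 ^ d := by positivity
    have h2 := mul_le_mul_of_nonneg_left hEsum h1
    linear_combination 4 * h2

/-! ### Normalized maxima over finite boxes, symmetrization and random signs. -/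

lemma rpow_lintegral_le_lintegral_rpow {α : Type*} [MeasurableSpace α] {μ : Measure α}
    [IsProbabilityMeasure μ] {g : α → ℝ≥0∞} (hg : Measurable g) {p : ℝ} (hp : 1 ≤ p) :
    (∫⁻ x, g x ∂μ) ^ p ≤ ∫⁻ x, g x ^ p ∂μ := by
  have h := eLpNorm'_le_eLpNorm'_of_exponent_le zero_lt_one hp μ
    (hg.aestronglyMeasurable)
  simp only [eLpNorm', enorm_eq_self, ENNReal.rpow_one, div_one] at h
  calc (∫⁻ x, g x ∂μ) ^ p ≤ ((∫⁻ x, g x ^ p ∂μ) ^ (1 / p)) ^ p :=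
        ENNReal.rpow_le_rpow h (by linarith)
    _ = _ := by rw [← ENNReal.rpow_mul, one_div_mul_cancel (by linarith), ENNReal.rpow_one]

/-- The normalization `√(|n| LL(|n|))`. -/
noncomputable def lilNorm {d : ℕ} (n : Fin d → ℕ+) : ℝ :=
  √((∏ q, ((n q : ℕ) : ℝ)) * logLL (∏ q, ((n q : ℕ) : ℝ)))

/-- The maximum over `n ≼ (R, …, R)` of the normalized sums of `z` over `1 ≼ i ≼ n`. -/
noncomputable def boxMax {d : ℕ} (R : ℕ) (z : (Fin d → ℤ) → ℝ) : ℝ≥0∞ :=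
  ⨆ n : Fin d → ℕ+, ⨆ _ : ∀ q, (n q : ℕ) ≤ R, ENNReal.ofReal
    (|∑ i ∈ Finset.Icc (1 : Fin d → ℤ) (fun q => ((n q : ℕ) : ℤ)), z i| / lilNorm n)

section boxMax
variable {d R : ℕ}

lemma prod_pnat_pos (n : Fin d → ℕ+) : (0 : ℝ) < ∏ q, ((n q : ℕ) : ℝ) :=
  Finset.prod_pos fun q _ => by exact_mod_cast (n q).pos

lemma lilNorm_pos (n : Fin d → ℕ+) : 0 < lilNorm n :=
  Real.sqrt_pos.2 (mul_pos (prod_pnat_pos n) (zero_lt_one.trans_le (one_le_logLL _)))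

lemma boxMax_sum_le {E : Type*} (s : Finset E) (z : E → (Fin d → ℤ) → ℝ) :
    boxMax R (fun i => ∑ e ∈ s, z e i) ≤ ∑ e ∈ s, boxMax R (z e) := by
  refine iSup₂_le fun n hn => ?_
  rw [Finset.sum_comm]
  calc ENNReal.ofReal (|∑ e ∈ s, ∑ i ∈ Finset.Icc (1 : Fin d → ℤ) (fun q => ((n q : ℕ) : ℤ)), z e i| /
        lilNorm n)
      ≤ ENNReal.ofReal (∑ e ∈ s,
        |∑ i ∈ Finset.Icc (1 : Fin d → ℤ) (fun q => ((n q : ℕ) : ℤ)), z e i| / lilNorm n) := by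
        rw [← Finset.sum_div]
        exact ENNReal.ofReal_le_ofReal (div_le_div_of_nonneg_right
          (Finset.abs_sum_le_sum_abs _ _) (lilNorm_pos n).le)
    _ = ∑ e ∈ s, ENNReal.ofReal
        (|∑ i ∈ Finset.Icc (1 : Fin d → ℤ) (fun q => ((n q : ℕ) : ℤ)), z e i| / lilNorm n) :=
        ENNReal.ofReal_sum_of_nonneg fun e _ => div_nonneg (abs_nonneg _) (lilNorm_pos n).le
    _ ≤ _ := Finset.sum_le_sum fun e _ => le_iSup₂ (f := fun (n : Fin d → ℕ+)
        (_ : ∀ q, (n q : ℕ) ≤ R) => ENNReal.ofReal (|∑ i ∈ Finset.Icc (1 : Fin d → ℤ)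
          (fun q => ((n q : ℕ) : ℤ)), z e i| / lilNorm n)) n hn

lemma boxMax_sub_le (z z' : (Fin d → ℤ) → ℝ) :
    boxMax R (fun i => z i - z' i) ≤ boxMax R z + boxMax R z' := by
  refine iSup₂_le fun n hn => ?_
  have hn0 := (lilNorm_pos n).le
  rw [Finset.sum_sub_distrib]
  calc _ ≤ ENNReal.ofReal
        (|∑ i ∈ Finset.Icc (1 : Fin d → ℤ) (fun q => ((n q : ℕ) : ℤ)), z i| / lilNorm n +
        |∑ i ∈ Finset.Icc (1 : Fin d → ℤ) (fun q => ((n q : ℕ) : ℤ)), z' i| / lilNorm n) := by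
        rw [← add_div]
        exact ENNReal.ofReal_le_ofReal (div_le_div_of_nonneg_right (abs_sub _ _) hn0)
    _ = _ := ENNReal.ofReal_add (div_nonneg (abs_nonneg _) hn0) (div_nonneg (abs_nonneg _) hn0)
    _ ≤ _ := add_le_add
        (le_iSup₂ (f := fun (n : Fin d → ℕ+)
        (_ : ∀ q, (n q : ℕ) ≤ R) => ENNReal.ofReal (|∑ i ∈ Finset.Icc (1 : Fin d → ℤ)
          (fun q => ((n q : ℕ) : ℤ)), z i| / lilNorm n)) n hn)
        (le_iSup₂ (f := fun (n : Fin d → ℕ+)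
        (_ : ∀ q, (n q : ℕ) ≤ R) => ENNReal.ofReal (|∑ i ∈ Finset.Icc (1 : Fin d → ℤ)
          (fun q => ((n q : ℕ) : ℤ)), z' i| / lilNorm n)) n hn)

lemma measurable_boxMax {α : Type*} [MeasurableSpace α] {z : α → (Fin d → ℤ) → ℝ}
    (hz : ∀ i, Measurable fun x => z x i) : Measurable fun x => boxMax R (z x) :=
  Measurable.iSup fun _ => Measurable.iSup fun _ => ENNReal.measurable_ofReal.comp
    ((Finset.measurable_fun_sum _ fun i _ => hz i).norm.div_const _)

/-- Passage to the differences with an independent copy. -/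
lemma boxMax_le_lintegral {α : Type*} [MeasurableSpace α] {μ : Measure α} [IsProbabilityMeasure μ]
    {z : α → (Fin d → ℤ) → ℝ} (hz : ∀ i, Integrable (fun x => z x i) μ)
    (hz0 : ∀ i, ∫ x, z x i ∂μ = 0) (x : α) :
    boxMax R (z x) ≤ ∫⁻ x', boxMax R (fun i => z x i - z x' i) ∂μ := by
  refine iSup₂_le fun n hn => ?_
  set I := Finset.Icc (1 : Fin d → ℤ) (fun q => ((n q : ℕ) : ℤ))
  have h1 : ∑ i ∈ I, z x i = ∫ x', ∑ i ∈ I, (z x i - z x' i) ∂μ := by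
    rw [integral_finsetSum (f := fun i x' => z x i - z x' i) I
      fun i _ => (integrable_const _).sub (hz i)]
    refine Finset.sum_congr rfl fun i _ => ?_
    rw [integral_sub (integrable_const _) (hz i), hz0]
    simp
  have h2 : ENNReal.ofReal (|∑ i ∈ I, z x i| / lilNorm n) =
      ‖∫ x', (∑ i ∈ I, (z x i - z x' i)) / lilNorm n ∂μ‖ₑ := by
    rw [integral_div, ← h1, ← ofReal_norm, Real.norm_eq_abs, abs_div, abs_of_pos (lilNorm_pos n)]
  rw [h2]
  refine (enorm_integral_le_lintegral_enorm _).trans (lintegral_mono fun x' => ?_)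
  rw [← ofReal_norm, Real.norm_eq_abs, abs_div, abs_of_pos (lilNorm_pos n)]
  exact le_iSup₂ (f := fun (n : Fin d → ℕ+)
        (_ : ∀ q, (n q : ℕ) ≤ R) => ENNReal.ofReal (|∑ i ∈ Finset.Icc (1 : Fin d → ℤ)
          (fun q => ((n q : ℕ) : ℤ)), (z x i - z x' i)| / lilNorm n)) n hn

lemma rpow_half_le_one_add {t : ℝ≥0∞} {s : ℝ} (hs : 0 ≤ s) (hs1 : s ≤ 1) : t ^ s ≤ 1 + t := by
  rcases le_total t 1 with h | h
  · exact (ENNReal.rpow_le_one h hs).trans le_self_add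
  · refine le_trans ?_ le_add_self
    nth_rewrite 2 [← ENNReal.rpow_one t]
    exact ENNReal.rpow_le_rpow_of_exponent_le h hs1

/-- The mean over the signs of the `p`-th power of the maximum of signed sums. -/
lemma sum_boxMax_signed_rpow_le {κ A : Type*} [Fintype κ] [DecidableEq κ] [Fintype A]
    [DecidableEq A] (k : (Fin d → ℤ) → κ) (a : (Fin d → ℤ) → A) [Nonempty A]
    (hka : Set.InjOn (fun i => (k i, a i)) (Finset.Icc (1 : Fin d → ℤ) fun _ => (R : ℤ)))
    (x : (Fin d → ℤ) → ℝ) {p : ℝ} (hp : 0 < p) (hp2 : p ≤ 2) {V : ℝ≥0∞} (hV0 : 1 ≤ V)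
    (hV : ∀ n : Fin d → ℕ+, (∑ i ∈ Finset.Icc (1 : Fin d → ℤ) (fun q => ((n q : ℕ) : ℤ)),
      ENNReal.ofReal (x i ^ 2)) / (∏ q, ((n q : ℕ) : ℝ≥0∞)) ≤ V) :
    ∑ s : κ → Bool, boxMax R (fun i => boolSign (s (k i)) * x i) ^ p ≤
      2 * 2 ^ Fintype.card κ *
        (ENNReal.ofReal (signedConst d) * Fintype.card A * V) ^ (p / 2) := by
  have hp' : 0 < p / 2 := by positivity
  have hC : ENNReal.ofReal (signedConst d) ≠ 0 := by simpa using signedConst_pos d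
  rcases eq_or_ne V ⊤ with rfl | hVt
  · rw [ENNReal.mul_top (mul_ne_zero hC (by simp)), ENNReal.top_rpow_of_pos hp',
      ENNReal.mul_top (by simp)]
    exact le_top
  set v := V.toReal with hv
  have hVv : V = ENNReal.ofReal v := (ENNReal.ofReal_toReal hVt).symm
  have hv0 : 0 < v := ENNReal.toReal_pos (zero_lt_one.trans_le hV0).ne' hVt
  obtain ⟨W, hW0, hW, hWsum⟩ := exists_signed_maximal_bound R k a hka x hv0 fun n => by
    have h1 := hV n
    have hP : (∏ q, ((n q : ℕ) : ℝ≥0∞)) = ENNReal.ofReal (∏ q, ((n q : ℕ) : ℝ)) := by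
      rw [ENNReal.ofReal_prod_of_nonneg fun _ _ => Nat.cast_nonneg _]
      simp
    rw [hP, ENNReal.div_le_iff (by simpa using prod_pnat_pos n) (by simp), hVv,
      ← ENNReal.ofReal_sum_of_nonneg fun _ _ => sq_nonneg _, ← ENNReal.ofReal_mul hv0.le,
      ENNReal.ofReal_le_ofReal_iff (mul_nonneg hv0.le (prod_pnat_pos n).le)] at h1
    linarith
  set θ := signedConst d * (Fintype.card A * v) with hθ
  have hθ0 : 0 < θ := mul_pos (signedConst_pos d)
    (mul_pos (by exact_mod_cast Fintype.card_pos) hv0)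
  have hθe : ENNReal.ofReal (signedConst d) * Fintype.card A * V = ENNReal.ofReal θ := by
    rw [hθ, ENNReal.ofReal_mul (signedConst_pos d).le, ENNReal.ofReal_mul (by positivity), hVv,
      ENNReal.ofReal_natCast, mul_assoc]
  -- The mean of `W / θ` over the signs is at most `1`, so the crude bound `t ^ (p / 2) ≤ 1 + t` is
  -- enough.
  have hb : ∀ s, boxMax R (fun i => boolSign (s (k i)) * x i) ^ p ≤
      ENNReal.ofReal θ ^ (p / 2) * (1 + ENNReal.ofReal (W s / θ)) := fun s => by
    have h1 : boxMax R (fun i => boolSign (s (k i)) * x i) ≤ ENNReal.ofReal (√(W s)) := by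
      refine iSup₂_le fun n hn => ENNReal.ofReal_le_ofReal ?_
      rw [div_le_iff₀ (lilNorm_pos n), lilNorm, ← Real.sqrt_mul (hW0 s)]
      refine Real.abs_le_sqrt ?_
      rw [mul_comm (W s)]
      exact hW s n hn
    calc boxMax R (fun i => boolSign (s (k i)) * x i) ^ p
        ≤ ENNReal.ofReal (√(W s)) ^ p := ENNReal.rpow_le_rpow h1 hp.le
      _ = ENNReal.ofReal (W s) ^ (p / 2) := by
          rw [ENNReal.ofReal_rpow_of_nonneg (Real.sqrt_nonneg _) hp.le,
            ENNReal.ofReal_rpow_of_nonneg (hW0 s) hp'.le, Real.sqrt_eq_rpow, ← Real.rpow_mul (hW0 s)]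
          congr 2; ring
      _ = ENNReal.ofReal θ ^ (p / 2) * ENNReal.ofReal (W s / θ) ^ (p / 2) := by
          rw [← ENNReal.mul_rpow_of_nonneg _ _ hp'.le, ← ENNReal.ofReal_mul hθ0.le,
            mul_div_cancel₀ _ hθ0.ne']
      _ ≤ _ := by
          gcongr
          exact rpow_half_le_one_add hp'.le (by linarith)
  calc ∑ s : κ → Bool, boxMax R (fun i => boolSign (s (k i)) * x i) ^ p
      ≤ ∑ s : κ → Bool, ENNReal.ofReal θ ^ (p / 2) * (1 + ENNReal.ofReal (W s / θ)) :=
        Finset.sum_le_sum fun s _ => hb s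
    _ = ENNReal.ofReal θ ^ (p / 2) * (2 ^ Fintype.card κ + ENNReal.ofReal ((∑ s, W s) / θ)) := by
        rw [← Finset.mul_sum, Finset.sum_add_distrib, Finset.sum_div,
          ENNReal.ofReal_sum_of_nonneg fun s _ => div_nonneg (hW0 s) hθ0.le]
        simp
    _ ≤ ENNReal.ofReal θ ^ (p / 2) * (2 ^ Fintype.card κ + 2 ^ Fintype.card κ) := by
        gcongr
        have : (∑ s, W s) / θ ≤ 2 ^ Fintype.card κ := by
          rw [div_le_iff₀ hθ0, mul_comm]; exact hWsum
        refine (ENNReal.ofReal_le_ofReal this).trans ?_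
        rw [ENNReal.ofReal_pow (by norm_num), ENNReal.ofReal_ofNat]
    _ = _ := by rw [hθe]; ring

end boxMax

/-! ### Blocks and the maximal inequality for fields of finite range. -/

section blocks
variable {d : ℕ}

/-- The index, up to a bounded range, of the block of side `2 j + 1` containing `i`. -/
def blockIndex (R j : ℕ) (i : Fin d → ℤ) (q : Fin d) : Fin (R + 1) :=
  Fin.ofNat (R + 1) (i q / (2 * j + 1 : ℕ)).toNat

/-- The position of `i` in its block of side `2 j + 1`. -/
def blockResidue (j : ℕ) (i : Fin d → ℤ) (q : Fin d) : Fin (2 * j + 1) :=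
  Fin.ofNat (2 * j + 1) (i q % (2 * j + 1 : ℕ)).toNat

/-- The parity of the block of side `2 j + 1` containing `i`. -/
def blockParity (j : ℕ) (i : Fin d → ℤ) (q : Fin d) : Bool :=
  decide ((i q / (2 * j + 1 : ℕ)) % 2 = 0)

/-- For coordinates in `[1, R]` the quotient lies in `[0, R]`, so the reductions into `Fin` lose
nothing. -/
lemma injOn_blockIndex_blockResidue (R j : ℕ) :
    Set.InjOn (fun i : Fin d → ℤ => (blockIndex R j i, blockResidue j i))
      (Finset.Icc (1 : Fin d → ℤ) fun _ => (R : ℤ)) := by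
  intro i hi i' hi' h
  simp only [Finset.coe_Icc, Set.mem_Icc, Pi.le_def, Pi.one_apply] at hi hi'
  obtain ⟨h1, h2⟩ := Prod.ext_iff.1 h
  ext q
  have e1 := congrArg Fin.val (congrFun h1 q)
  have e2 := congrArg Fin.val (congrFun h2 q)
  simp only [blockIndex, blockResidue, Fin.val_ofNat] at e1 e2
  have hN : (0 : ℤ) < (2 * j + 1 : ℕ) := by positivity
  have key : ∀ a : ℤ, 1 ≤ a → a ≤ R → 0 ≤ a / (2 * j + 1 : ℕ) ∧ a / (2 * j + 1 : ℕ) ≤ R ∧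
      0 ≤ a % (2 * j + 1 : ℕ) ∧ a % (2 * j + 1 : ℕ) < (2 * j + 1 : ℕ) := fun a ha haR =>
    ⟨Int.ediv_nonneg (by omega) hN.le, (Int.ediv_le_self _ (by omega)).trans haR,
      Int.emod_nonneg _ hN.ne', Int.emod_lt_of_pos _ hN⟩
  obtain ⟨a1, a2, a3, a4⟩ := key (i q) (hi.1 q) (hi.2 q)
  obtain ⟨b1, b2, b3, b4⟩ := key (i' q) (hi'.1 q) (hi'.2 q)
  rw [Nat.mod_eq_of_lt (by omega), Nat.mod_eq_of_lt (by omega)] at e1 e2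
  have e1' : i q / (2 * j + 1 : ℕ) = i' q / (2 * j + 1 : ℕ) := by omega
  have e2' : i q % (2 * j + 1 : ℕ) = i' q % (2 * j + 1 : ℕ) := by omega
  rw [← Int.mul_ediv_add_emod (i q) (2 * j + 1 : ℕ), e1', e2', Int.mul_ediv_add_emod]

/-- Coordinates at distance at most `2 j` lie in equal or adjacent intervals, and equal parity
excludes adjacent ones. -/
lemma blockIndex_eq_of_near {R j : ℕ} {i i' : Fin d → ℤ} (hpar : blockParity j i = blockParity j i')
    (hnear : ∀ q, |i q - i' q| ≤ 2 * j) : blockIndex R j i = blockIndex R j i' := by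
  ext q
  have hq := congrFun hpar q
  simp only [blockParity, decide_eq_decide] at hq
  suffices h : i q / (2 * j + 1 : ℕ) = i' q / (2 * j + 1 : ℕ) by simp only [blockIndex, h]
  have hN : (0 : ℤ) < (2 * j + 1 : ℕ) := by positivity
  obtain ⟨h1, h2⟩ := abs_le.1 (hnear q)
  have a1 := Int.mul_ediv_add_emod (i q) (2 * j + 1 : ℕ)
  have a2 := Int.emod_nonneg (i q) hN.ne'
  have a3 := Int.emod_lt_of_pos (i q) hN
  have b1 := Int.mul_ediv_add_emod (i' q) (2 * j + 1 : ℕ)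
  have b2 := Int.emod_nonneg (i' q) hN.ne'
  have b3 := Int.emod_lt_of_pos (i' q) hN
  generalize i q / (2 * j + 1 : ℕ) = m at *
  generalize i' q / (2 * j + 1 : ℕ) = m' at *
  have c1 : m < m' + 2 := by
    by_contra! hc
    push_cast at *
    nlinarith
  have c2 : m' < m + 2 := by
    by_contra! hc
    push_cast at *
    nlinarith
  omega

variable {j R : ℕ} {h : ((Fin d → ℤ) → ℝ) → ℝ}

lemma comp_siteReflect_congr (hdep : DependsOn h {u | ∀ q, |u q| ≤ (j : ℤ)}) {i : Fin d → ℤ}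
    {ω ω' : (Fin d → ℤ) → ℝ} (hω : ∀ v, (∀ q, |i q - v q| ≤ (j : ℤ)) → ω v = ω' v) :
    h (siteReflect i ω) = h (siteReflect i ω') :=
  hdep fun u hu => hω _ fun q => by simpa using hu q

/-- The restriction of the field to the blocks of parity `e`. -/
noncomputable def parityField (j : ℕ) (e : Fin d → Bool) (h : ((Fin d → ℤ) → ℝ) → ℝ)
    (ω : (Fin d → ℤ) → ℝ) (i : Fin d → ℤ) : ℝ :=
  if blockParity j i = e then h (siteReflect i ω) else 0

lemma sum_parityField (ω : (Fin d → ℤ) → ℝ) (i : Fin d → ℤ) :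
    ∑ e, parityField j e h ω i = h (siteReflect i ω) := by
  simp [parityField]

lemma measurable_parityField (hh : Measurable h) (e : Fin d → Bool) (i : Fin d → ℤ) :
    Measurable fun ω => parityField j e h ω i := by
  unfold parityField
  split_ifs
  · exact hh.comp (measurable_siteReflect i)
  · exact measurable_const

/-- The sites on which the two copies are exchanged to change the signs of the blocks. -/
def swapSet (R j : ℕ) (e : Fin d → Bool) (s : (Fin d → Fin (R + 1)) → Bool) : Set (Fin d → ℤ) :=
  {v | ∃ i, blockParity j i = e ∧ s (blockIndex R j i) = false ∧ ∀ q, |i q - v q| ≤ (j : ℤ)}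

/-- The coordinates read at a site of a block with sign `false` are all exchanged. Those read at a
site of a block with sign `true` are all kept, since blocks of equal parity read disjoint sets. -/
lemma parityField_swap (hdep : DependsOn h {u | ∀ q, |u q| ≤ (j : ℤ)}) (e : Fin d → Bool)
    (s : (Fin d → Fin (R + 1)) → Bool) (ω ω' : (Fin d → ℤ) → ℝ) (i : Fin d → ℤ) :
    parityField j e h (merge (swapSet R j e s) ω' ω) i -
      parityField j e h (merge (swapSet R j e s) ω ω') i =
    boolSign (s (blockIndex R j i)) * parityField j e h ω i -
      boolSign (s (blockIndex R j i)) * parityField j e h ω' i := by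
  by_cases hi : blockParity j i = e
  · simp only [parityField, hi, if_true]
    cases hs : s (blockIndex R j i)
    · have hmem : ∀ v, (∀ q, |i q - v q| ≤ (j : ℤ)) → v ∈ swapSet R j e s := fun v hv =>
        ⟨i, hi, hs, hv⟩
      rw [comp_siteReflect_congr hdep (ω := merge (swapSet R j e s) ω' ω) (ω' := ω')
        fun v hv => by simp [merge, hmem v hv],
        comp_siteReflect_congr hdep (ω := merge (swapSet R j e s) ω ω') (ω' := ω)
        fun v hv => by simp [merge, hmem v hv]]
      simp only [boolSign]
      norm_num
      ring
    · have hmem : ∀ v, (∀ q, |i q - v q| ≤ (j : ℤ)) → v ∉ swapSet R j e s := by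
        rintro v hv ⟨i', hi', hs', hv'⟩
        have : blockIndex R j i = blockIndex R j i' :=
          blockIndex_eq_of_near (hi.trans hi'.symm) fun q => by
            have h1 := abs_le.1 (hv q)
            have h2 := abs_le.1 (hv' q)
            rw [abs_le]
            constructor <;> linarith [h1.1, h1.2, h2.1, h2.2]
        rw [← this, hs] at hs'
        exact absurd hs' (by simp)
      rw [comp_siteReflect_congr hdep (ω := merge (swapSet R j e s) ω' ω) (ω' := ω)
        fun v hv => by simp [merge, hmem v hv],
        comp_siteReflect_congr hdep (ω := merge (swapSet R j e s) ω ω') (ω' := ω')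
        fun v hv => by simp [merge, hmem v hv]]
      simp [boolSign]
  · simp [parityField, hi]

variable {μ₀ : Measure ℝ} [IsProbabilityMeasure μ₀]

/-- Centering permits the subtraction of an independent copy; the exchange, which preserves the
joint law, inserts the signs; the triangle inequality separates the two copies again, at the price
`2 ^ p`. -/
lemma lintegral_boxMax_le_signed (hh : Measurable h) (hint : Integrable h (iidMeasure _ μ₀))
    (h0 : ∫ η, h η ∂iidMeasure _ μ₀ = 0) (hdep : DependsOn h {u | ∀ q, |u q| ≤ (j : ℤ)})
    (e : Fin d → Bool) (s : (Fin d → Fin (R + 1)) → Bool) {p : ℝ} (hp : 1 ≤ p) :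
    ∫⁻ ω, boxMax R (parityField j e h ω) ^ p ∂iidMeasure _ μ₀ ≤
      2 ^ p * ∫⁻ ω, boxMax R (fun i => boolSign (s (blockIndex R j i)) * parityField j e h ω i) ^ p
        ∂iidMeasure _ μ₀ := by
  set μ := iidMeasure (Fin d → ℤ) μ₀
  have hy : ∀ i, Measurable fun ω => parityField j e h ω i := measurable_parityField hh e
  have hyint : ∀ i, Integrable (fun ω => parityField j e h ω i) μ := fun i => by
    unfold parityField
    split_ifs
    · exact (measurePreserving_siteReflect μ₀ i).integrable_comp_of_integrable hint
    · exact integrable_zero _ _ _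
  have hy0 : ∀ i, ∫ ω, parityField j e h ω i ∂μ = 0 := fun i => by
    unfold parityField
    split_ifs
    · have hm : Measure.map (siteReflect i) μ = μ := (measurePreserving_siteReflect μ₀ i).map_eq
      rw [← h0]
      conv_rhs => rw [← hm]
      rw [integral_map (measurable_siteReflect i).aemeasurable hh.aestronglyMeasurable]
    · simp
  let D : ((Fin d → ℤ) → ℝ) × ((Fin d → ℤ) → ℝ) → ℝ≥0∞ := fun z =>
    boxMax R (fun i => parityField j e h z.1 i - parityField j e h z.2 i) ^ p
  have hD : Measurable D := (measurable_boxMax fun i =>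
    ((hy i).comp measurable_fst).sub ((hy i).comp measurable_snd)).pow_const p
  have hS : Measurable fun ω =>
      boxMax R (fun i => boolSign (s (blockIndex R j i)) * parityField j e h ω i) ^ p :=
    (measurable_boxMax fun i => (hy i).const_mul _).pow_const p
  calc ∫⁻ ω, boxMax R (parityField j e h ω) ^ p ∂μ
      ≤ ∫⁻ ω, ∫⁻ ω', D (ω, ω') ∂μ ∂μ := by
        refine lintegral_mono fun ω => ?_
        refine (ENNReal.rpow_le_rpow (boxMax_le_lintegral hyint hy0 ω) (by linarith)).trans ?_
        exact rpow_lintegral_le_lintegral_rpow (measurable_boxMax fun i =>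
          measurable_const.sub (hy i)) hp
    _ = ∫⁻ z, D z ∂μ.prod μ := (lintegral_prod _ hD.aemeasurable).symm
    _ = ∫⁻ z, D (merge (swapSet R j e s) z.2 z.1, merge (swapSet R j e s) z.1 z.2) ∂μ.prod μ :=
        ((measurePreserving_swap μ₀ (swapSet R j e s)).lintegral_comp hD).symm
    _ ≤ ∫⁻ z, 2 ^ (p - 1) *
          (boxMax R (fun i => boolSign (s (blockIndex R j i)) * parityField j e h z.1 i) ^ p +
          boxMax R (fun i => boolSign (s (blockIndex R j i)) * parityField j e h z.2 i) ^ p)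
          ∂μ.prod μ := by
        refine lintegral_mono fun z => ?_
        refine le_trans ?_ (ENNReal.rpow_add_le_mul_rpow_add_rpow _ _ hp)
        simp only [D, parityField_swap hdep]
        exact ENNReal.rpow_le_rpow (boxMax_sub_le _ _) (by linarith)
    _ = 2 ^ p * ∫⁻ ω, boxMax R (fun i => boolSign (s (blockIndex R j i)) *
          parityField j e h ω i) ^ p ∂μ := by
        have hS1 : Measurable fun z : ((Fin d → ℤ) → ℝ) × ((Fin d → ℤ) → ℝ) => boxMax R (fun i =>
            boolSign (s (blockIndex R j i)) * parityField j e h z.1 i) ^ p :=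
          hS.comp measurable_fst
        have hS2 : Measurable fun z : ((Fin d → ℤ) → ℝ) × ((Fin d → ℤ) → ℝ) => boxMax R (fun i =>
            boolSign (s (blockIndex R j i)) * parityField j e h z.2 i) ^ p :=
          hS.comp measurable_snd
        rw [lintegral_const_mul _ (hS1.fun_add hS2), lintegral_add_left hS1,
          measurePreserving_fst.lintegral_comp hS, measurePreserving_snd.lintegral_comp hS,
          ← two_mul, ← mul_assoc]
        congr 1
        nth_rewrite 2 [← ENNReal.rpow_one 2]
        rw [← ENNReal.rpow_add _ _ (by norm_num) (by simp), sub_add_cancel]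

/-- The bound for the maximum over a finite box of sites. -/
lemma lintegral_boxMax_rpow_le (hh : Measurable h) (hint : Integrable h (iidMeasure _ μ₀))
    (h0 : ∫ η, h η ∂iidMeasure _ μ₀ = 0) (hdep : DependsOn h {u | ∀ q, |u q| ≤ (j : ℤ)})
    {p : ℝ} (hp : 1 ≤ p) (hp2 : p ≤ 2) (R : ℕ) :
    ∫⁻ ω, boxMax R (fun i => h (siteReflect i ω)) ^ p ∂iidMeasure _ μ₀ ≤
      (2 ^ d) ^ p * (2 ^ p * (2 * (ENNReal.ofReal (signedConst d) * ((2 * j + 1 : ℕ) : ℝ≥0∞) ^ d) ^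
        (p / 2) * (1 + ∫⁻ ω, rectMax (fun η => ENNReal.ofReal (h η ^ 2)) ω ^ (p / 2)
          ∂iidMeasure _ μ₀))) := by
  set μ := iidMeasure (Fin d → ℤ) μ₀
  set u : ((Fin d → ℤ) → ℝ) → ℝ≥0∞ := fun η => ENNReal.ofReal (h η ^ 2)
  have hu : Measurable u := (hh.pow_const 2).ennreal_ofReal
  have hp' : 0 ≤ p / 2 := by linarith
  set K : ℝ≥0∞ := (ENNReal.ofReal (signedConst d) * ((2 * j + 1 : ℕ) : ℝ≥0∞) ^ d) ^ (p / 2)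
  set T : ℝ≥0∞ := 1 + ∫⁻ ω, rectMax u ω ^ (p / 2) ∂μ
  have hrm : Measurable (rectMax u) := measurable_rectMax hu
  have hy : ∀ e i, Measurable fun ω => parityField j e h ω i := measurable_parityField hh
  have hone : ∀ e : Fin d → Bool,
      ∫⁻ ω, boxMax R (parityField j e h ω) ^ p ∂μ ≤ 2 ^ p * (2 * K * T) := by
    intro e
    set Nκ : ℕ := Fintype.card (Fin d → Fin (R + 1))
    -- The bound holds for every choice of signs, hence on average, and averaging inside the
    -- integral makes the signs random while the field stays fixed.
    have h1 : (2 : ℝ≥0∞) ^ Nκ * ∫⁻ ω, boxMax R (parityField j e h ω) ^ p ∂μ ≤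
        2 ^ Nκ * (2 ^ p * (2 * K * T)) := by
      calc (2 : ℝ≥0∞) ^ Nκ * ∫⁻ ω, boxMax R (parityField j e h ω) ^ p ∂μ
          = ∑ _s : (Fin d → Fin (R + 1)) → Bool,
            ∫⁻ ω, boxMax R (parityField j e h ω) ^ p ∂μ := by
            rw [Finset.sum_const, Finset.card_univ, Fintype.card_fun, Fintype.card_bool,
              nsmul_eq_mul]
            push_cast
            rfl
        _ ≤ ∑ s : (Fin d → Fin (R + 1)) → Bool, 2 ^ p * ∫⁻ ω, boxMax R (fun i =>
              boolSign (s (blockIndex R j i)) * parityField j e h ω i) ^ p ∂μ :=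
            Finset.sum_le_sum fun s _ => lintegral_boxMax_le_signed hh hint h0 hdep e s hp
        _ = 2 ^ p * ∫⁻ ω, ∑ s : (Fin d → Fin (R + 1)) → Bool, boxMax R (fun i =>
              boolSign (s (blockIndex R j i)) * parityField j e h ω i) ^ p ∂μ := by
            rw [← Finset.mul_sum, lintegral_finsetSum _ fun s _ =>
              (measurable_boxMax fun i => (hy e i).const_mul _).pow_const p]
        _ ≤ 2 ^ p * ∫⁻ ω, 2 * 2 ^ Nκ * K * (1 + rectMax u ω ^ (p / 2)) ∂μ := by
            gcongr with ω
            refine (sum_boxMax_signed_rpow_le (blockIndex R j) (blockResidue j)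
              (injOn_blockIndex_blockResidue R j) (parityField j e h ω) (by linarith) hp2
              -- The summand `1` keeps the variance bound away from zero.
              (V := 1 + rectMax u ω) le_self_add fun n => ?_).trans ?_
            · refine le_trans ?_ ((le_iSup (fun n : Fin d → ℕ+ =>
                (∑ i ∈ Finset.Icc (1 : Fin d → ℤ) (fun q => ((n q : ℕ) : ℤ)),
                u (siteReflect i ω)) / ∏ q, ((n q : ℕ) : ℝ≥0∞)) n).trans le_add_self)
              refine ENNReal.div_le_div_right (Finset.sum_le_sum fun i _ => ?_) _
              simp only [parityField, u]
              split_ifs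
              · exact le_rfl
              · simp
            · rw [ENNReal.mul_rpow_of_nonneg _ _ hp', ← mul_assoc]
              have hcard : ((Fintype.card (Fin d → Fin (2 * j + 1)) : ℕ) : ℝ≥0∞) =
                  ((2 * j + 1 : ℕ) : ℝ≥0∞) ^ d := by
                rw [Fintype.card_fun, Fintype.card_fin, Fintype.card_fin]
                push_cast; rfl
              rw [hcard]
              refine mul_le_mul_right ?_ _
              refine (ENNReal.rpow_add_le_add_rpow _ _ hp' (by linarith)).trans ?_
              simp
        _ = 2 ^ Nκ * (2 ^ p * (2 * K * T)) := by
            rw [lintegral_const_mul _ (measurable_const.fun_add (hrm.pow_const _)),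
              lintegral_add_left measurable_const]
            simp only [lintegral_const, measure_univ, mul_one, T]
            ring
    rwa [ENNReal.mul_le_mul_iff_right (by simp) (by simp)] at h1
  calc ∫⁻ ω, boxMax R (fun i => h (siteReflect i ω)) ^ p ∂μ
      ≤ ∫⁻ ω, ((Finset.univ : Finset (Fin d → Bool)).card : ℝ≥0∞) ^ (p - 1) *
          ∑ e, boxMax R (parityField j e h ω) ^ p ∂μ := by
        refine lintegral_mono fun ω => ?_
        have h1 : boxMax R (fun i => h (siteReflect i ω)) ≤
            ∑ e, boxMax R (parityField j e h ω) := by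
          simp only [← sum_parityField (j := j) (h := h) ω]
          exact boxMax_sum_le Finset.univ fun e => parityField j e h ω
        exact (ENNReal.rpow_le_rpow h1 (by linarith)).trans
          (ENNReal.rpow_sum_le_const_mul_sum_rpow _ _ hp)
    _ = (2 ^ d) ^ (p - 1) * ∑ e : Fin d → Bool,
          ∫⁻ ω, boxMax R (parityField j e h ω) ^ p ∂μ := by
        rw [lintegral_const_mul _ (Finset.measurable_fun_sum _ fun e _ =>
          (measurable_boxMax (hy e)).pow_const p), lintegral_finsetSum _ fun e _ =>
          (measurable_boxMax (hy e)).pow_const p]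
        simp
    _ ≤ (2 ^ d) ^ (p - 1) * ∑ e : Fin d → Bool, 2 ^ p * (2 * K * T) := by
        gcongr with e
        exact hone e
    _ = (2 ^ d) ^ p * (2 ^ p * (2 * K * T)) := by
        rw [Finset.sum_const, Finset.card_univ, Fintype.card_fun, Fintype.card_bool,
          Fintype.card_fin, nsmul_eq_mul, ← mul_assoc]
        congr 1
        push_cast
        nth_rewrite 2 [← ENNReal.rpow_one (2 ^ d)]
        rw [← ENNReal.rpow_add _ _ (by simp) (by simp), sub_add_cancel]

end blocks

/-! ### Passage from finite boxes to all rectangles. -/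

lemma maximalFun_eq_iSup_boxMax {d : ℕ} {Ω : Type*} (X : (Fin d → ℤ) → Ω → ℝ) (ω : Ω) :
    maximalFun X ω = ⨆ R : ℕ, boxMax R (fun i => X i ω) := by
  refine le_antisymm (iSup_le fun n => ?_) (iSup_le fun R => iSup₂_le fun n _ => ?_)
  · refine le_trans ?_ (le_iSup (fun R : ℕ => boxMax R (fun i => X i ω)) (∑ q, (n q : ℕ)))
    have hn : ∀ q, (n q : ℕ) ≤ ∑ q, (n q : ℕ) := fun q => Finset.single_le_sum
      (f := fun q => (n q : ℕ)) (fun _ _ => Nat.zero_le _) (Finset.mem_univ q)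
    generalize ∑ q, (n q : ℕ) = N at hn ⊢
    exact le_iSup₂ (f := fun (n : Fin d → ℕ+) (_ : ∀ q, (n q : ℕ) ≤ N) =>
      ENNReal.ofReal (|∑ i ∈ Finset.Icc (1 : Fin d → ℤ) (fun q => ((n q : ℕ) : ℤ)), X i ω| /
        lilNorm n)) n hn
  · exact le_iSup (fun n : Fin d → ℕ+ => ENNReal.ofReal
      (|rectSum X n ω| / √((∏ q, ((n q : ℕ) : ℝ)) * logLL (∏ q, ((n q : ℕ) : ℝ))))) n

lemma boxMax_mono {d : ℕ} {R R' : ℕ} (hR : R ≤ R') (z : (Fin d → ℤ) → ℝ) :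
    boxMax R z ≤ boxMax R' z :=
  iSup_mono fun _ => iSup_mono' fun h => ⟨fun q => (h q).trans hR, le_rfl⟩

/-- The maximal inequality for a centered stationary field with finite range of dependence. -/
theorem exists_lintegral_maximalFun_rpow_le {d : ℕ} (hd : 1 ≤ d) {p : ℝ} (hp1 : 1 < p)
    (hp2 : p < 2) {B : ℝ≥0∞} (hB : B ≠ ⊤) :
    ∃ C : ℝ≥0∞, C ≠ ⊤ ∧ ∀ (μ₀ : Measure ℝ) [IsProbabilityMeasure μ₀] (j : ℕ)
      (h : ((Fin d → ℤ) → ℝ) → ℝ), Measurable h → Integrable h (iidMeasure _ μ₀) →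
      ∫ η, h η ∂iidMeasure _ μ₀ = 0 → DependsOn h {u | ∀ q, |u q| ≤ (j : ℤ)} →
      ∫⁻ η, layerSum (d - 1) (ENNReal.ofReal (h η ^ 2)) ∂iidMeasure _ μ₀ ≤ B →
      ∫⁻ ω, maximalFun (fun i ω => h (siteReflect i ω)) ω ^ p ∂iidMeasure _ μ₀ ≤
        C * (((2 * j + 1 : ℕ) : ℝ≥0∞) ^ d) ^ (p / 2) := by
  obtain ⟨C, hC, hrect⟩ := exists_lintegral_rectMax_rpow_le hd (s := p / 2) (by linarith)
    (by linarith) hB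
  have hp' : 0 ≤ p / 2 := by linarith
  refine ⟨(2 ^ d) ^ p * (2 ^ p * (2 * ENNReal.ofReal (signedConst d) ^ (p / 2) * (1 + C))), ?_, ?_⟩
  · have h1 : (2 : ℝ≥0∞) ^ p ≠ ⊤ := ENNReal.rpow_ne_top_of_nonneg (by linarith) (by simp)
    have h2 : ((2 : ℝ≥0∞) ^ d) ^ p ≠ ⊤ := ENNReal.rpow_ne_top_of_nonneg (by linarith) (by simp)
    have h3 : ENNReal.ofReal (signedConst d) ^ (p / 2) ≠ ⊤ :=
      ENNReal.rpow_ne_top_of_nonneg hp' (by simp)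
    have h4 : 1 + C ≠ ⊤ := by simp [hC]
    exact ENNReal.mul_ne_top h2 (ENNReal.mul_ne_top h1 (ENNReal.mul_ne_top
      (ENNReal.mul_ne_top (by simp) h3) h4))
  · intro μ₀ _ j h hh hint h0 hdep hlayer
    set μ := iidMeasure (Fin d → ℤ) μ₀
    have hmeas : ∀ R, Measurable fun ω => boxMax R (fun i => h (siteReflect i ω)) ^ p := fun R =>
      (measurable_boxMax fun i => hh.comp (measurable_siteReflect i)).pow_const p
    have hpow : ∀ ω, maximalFun (fun i ω => h (siteReflect i ω)) ω ^ p =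
        ⨆ R, boxMax R (fun i => h (siteReflect i ω)) ^ p := fun ω => by
      rw [maximalFun_eq_iSup_boxMax]
      exact (ENNReal.orderIsoRpow p (by linarith)).map_iSup _
    simp only [hpow]
    rw [lintegral_iSup hmeas fun R R' hR ω =>
      ENNReal.rpow_le_rpow (boxMax_mono hR _) (by linarith)]
    refine iSup_le fun R => (lintegral_boxMax_rpow_le hh hint h0 hdep hp1.le hp2.le R).trans ?_
    rw [ENNReal.mul_rpow_of_nonneg _ _ hp']
    calc _ ≤ (2 ^ d) ^ p * (2 ^ p * (2 * (ENNReal.ofReal (signedConst d) ^ (p / 2) *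
          (((2 * j + 1 : ℕ) : ℝ≥0∞) ^ d) ^ (p / 2)) * (1 + C))) := by
          gcongr
          exact hrect μ₀ _ (hh.pow_const 2).ennreal_ofReal hlayer
      _ = _ := by ring

/-! ### The function `y ^ 2 ℓ(|y|) ^ r` and its behavior under conditional means. -/

/-- `ℓ(t) = 1 + log (1 + t)`. -/
noncomputable def logOne (t : ℝ) : ℝ := 1 + Real.log (1 + t)

lemma one_le_logOne {t : ℝ} (ht : 0 ≤ t) : 1 ≤ logOne t :=
  le_add_of_nonneg_right (Real.log_nonneg (by linarith))

lemma logOne_mono {s t : ℝ} (hs : 0 ≤ s) (h : s ≤ t) : logOne s ≤ logOne t :=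
  add_le_add_right (Real.log_le_log (by linarith) (by linarith)) 1

lemma logOne_le_mul {s t : ℝ} {n : ℕ} (hs : 0 ≤ s) (hn : 1 ≤ n)
    (h : 1 + s ≤ (1 + t) ^ n) : logOne s ≤ n * logOne t := by
  have h1 := Real.log_le_log (by linarith) h
  rw [Real.log_pow] at h1
  have h2 : (1 : ℝ) ≤ n := by exact_mod_cast hn
  unfold logOne
  linarith

lemma logOne_add_le {s t : ℝ} (hs : 0 ≤ s) (ht : 0 ≤ t) : logOne (s + 4 * t) ≤
    logOne s + 4 * logOne t := by
  have h1 : 1 + (s + 4 * t) ≤ (1 + s) * (1 + t) ^ 4 := by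
    have := one_add_mul_le_pow (show (-2 : ℝ) ≤ t by linarith) 4
    push_cast at this
    nlinarith
  have h2 := Real.log_le_log (by linarith) h1
  rw [Real.log_mul (by linarith) (by positivity), Real.log_pow] at h2
  push_cast at h2
  unfold logOne
  linarith

lemma logOne_pow_le (r : ℕ) {s : ℝ} (hs : 0 ≤ s) : logOne s ^ r ≤ 3 * r.factorial * (1 + s) := by
  have h1 := Real.pow_div_factorial_le_exp (logOne s) (by linarith [one_le_logOne hs]) r
  rw [div_le_iff₀ (by positivity)] at h1
  refine h1.trans ?_
  have h2 : Real.exp (logOne s) = Real.exp 1 * (1 + s) := by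
    rw [logOne, Real.exp_add, Real.exp_log (by linarith)]
  rw [h2]
  have h3 : Real.exp 1 ≤ 3 := by linarith [Real.exp_one_lt_d9]
  have : 0 ≤ (3 - Real.exp 1) * ((r.factorial : ℝ) * (1 + s)) :=
    mul_nonneg (by linarith) (by positivity)
  linarith

/-- The even function `y² ℓ(|y|) ^ r`. -/
noncomputable def sqLog (r : ℕ) (y : ℝ) : ℝ := y ^ 2 * logOne |y| ^ r

lemma sqLog_nonneg (r : ℕ) (y : ℝ) : 0 ≤ sqLog r y :=
  mul_nonneg (sq_nonneg y) (pow_nonneg (by linarith [one_le_logOne (abs_nonneg y)]) r)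

lemma sq_le_sqLog (r : ℕ) (y : ℝ) : y ^ 2 ≤ sqLog r y :=
  le_mul_of_one_le_right (sq_nonneg y) (one_le_pow₀ (one_le_logOne (abs_nonneg y)))

lemma sqLog_mono (r : ℕ) {x y : ℝ} (h : |x| ≤ |y|) : sqLog r x ≤ sqLog r y := by
  have h1 := one_le_logOne (abs_nonneg x)
  exact mul_le_mul (sq_le_sq.2 h) (pow_le_pow_left₀ (by linarith)
    (logOne_mono (abs_nonneg x) h) r) (by positivity) (sq_nonneg y)

lemma measurable_sqLog (r : ℕ) : Measurable (sqLog r) := by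
  unfold sqLog logOne
  have : Measurable fun y : ℝ => |y| := measurable_norm
  fun_prop

/-- A substitute for Jensen's inequality that requires no convexity. With `s = |∫ w|`, the function
`ℓ(s / 2) ^ r * (s * |y| - s ^ 2 / 2)` lies below `sqLog r`: it is nonpositive for `|y| ≤ s / 2`,
and beyond that `ℓ` is increasing. Integrating it gives at least `2 * sqLog r (s / 2)`. -/
lemma sqLog_half_le_integral {α : Type*} [MeasurableSpace α] {ρ : Measure α}
    [IsProbabilityMeasure ρ] {r : ℕ} {w : α → ℝ} (hw : Integrable w ρ)
    (hφ : Integrable (fun a => sqLog r (w a)) ρ) :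
    2 * sqLog r ((∫ a, w a ∂ρ) / 2) ≤ ∫ a, sqLog r (w a) ∂ρ := by
  set s := |∫ a, w a ∂ρ|
  have hs : 0 ≤ s := abs_nonneg _
  have hL := one_le_logOne (show 0 ≤ s / 2 by positivity)
  have hpt : ∀ y, logOne (s / 2) ^ r * (s * |y| - s ^ 2 / 2) ≤ sqLog r y := by
    intro y
    rcases le_total (s / 2) |y| with h | h
    · have h1 : logOne (s / 2) ^ r ≤ logOne |y| ^ r :=
        pow_le_pow_left₀ (by linarith) (logOne_mono (by positivity) h) r
      have h2 : s * |y| - s ^ 2 / 2 ≤ y ^ 2 := by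
        nlinarith [sq_nonneg (|y| - s / 2), sq_abs y]
      calc _ ≤ logOne (s / 2) ^ r * y ^ 2 := by gcongr
        _ ≤ logOne |y| ^ r * y ^ 2 := by gcongr
        _ = _ := mul_comm _ _
    · refine le_trans (mul_nonpos_of_nonneg_of_nonpos (by positivity) ?_) (sqLog_nonneg r y)
      nlinarith
  have hint : Integrable (fun a => logOne (s / 2) ^ r * (s * |w a| - s ^ 2 / 2)) ρ :=
    ((hw.abs.const_mul s).sub (integrable_const _)).const_mul _
  have h1 := integral_mono hint hφ fun a => hpt (w a)
  rw [integral_const_mul, integral_sub (hw.abs.const_mul s) (integrable_const _),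
    integral_const_mul, integral_const] at h1
  simp only [probReal_univ, smul_eq_mul, one_mul] at h1
  have h2 : s ≤ ∫ a, |w a| ∂ρ := abs_integral_le_integral_abs
  refine le_trans ?_ h1
  have h3 : sqLog r ((∫ a, w a ∂ρ) / 2) = s ^ 2 / 4 * logOne (s / 2) ^ r := by
    rw [sqLog, abs_div, abs_two, div_pow, ← sq_abs (∫ a, w a ∂ρ)]
    norm_num [s]
  rw [h3]
  have h4 : s ^ 2 / 2 ≤ s * (∫ a, |w a| ∂ρ) - s ^ 2 / 2 := by nlinarith
  have h5 := mul_le_mul_of_nonneg_left h4 (show 0 ≤ logOne (s / 2) ^ r by positivity)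
  linarith

lemma memLp_two_of_sqLog {α : Type*} [MeasurableSpace α] {ρ : Measure α} {r : ℕ} {w : α → ℝ}
    (hw : Measurable w) (hφ : Integrable (fun x => sqLog r (w x)) ρ) : MemLp w 2 ρ :=
  (memLp_two_iff_integrable_sq hw.aestronglyMeasurable).2
    (hφ.mono' (hw.pow_const 2).aestronglyMeasurable (Filter.Eventually.of_forall fun x => by
      rw [Real.norm_of_nonneg (sq_nonneg _)]
      exact sq_le_sqLog r _))

section fiber
variable {ι : Type*} {μ₀ : Measure ℝ} [IsProbabilityMeasure μ₀] {w : (ι → ℝ) → ℝ} {r : ℕ}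

lemma sqLog_fiberMean (hw : Measurable w)
    (hφ : Integrable (fun x => sqLog r (w x)) (iidMeasure ι μ₀)) (A : Set ι) :
    Integrable (fun x => sqLog r (fiberMean μ₀ A w x / 2)) (iidMeasure ι μ₀) ∧
      2 * ∫ x, sqLog r (fiberMean μ₀ A w x / 2) ∂iidMeasure ι μ₀ ≤
        ∫ x, sqLog r (w x) ∂iidMeasure ι μ₀ := by
  have hwi := (memLp_two_of_sqLog hw hφ).integrable one_le_two
  have hae : ∀ᵐ x ∂iidMeasure ι μ₀, 2 * sqLog r (fiberMean μ₀ A w x / 2) ≤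
      fiberMean μ₀ A (fun x => sqLog r (w x)) x := by
    filter_upwards [(integrable_comp_merge (A := A) hwi).prod_right_ae,
      (integrable_comp_merge (A := A) hφ).prod_right_ae] with x h1 h2
    exact sqLog_half_le_integral h1 h2
  have hm : Measurable fun x => sqLog r (fiberMean μ₀ A w x / 2) :=
    (measurable_sqLog r).comp ((measurable_fiberMean hw).div_const 2)
  have hint : Integrable (fun x => sqLog r (fiberMean μ₀ A w x / 2)) (iidMeasure ι μ₀) := by
    refine (integrable_fiberMean (A := A) hφ).mono' hm.aestronglyMeasurable ?_
    filter_upwards [hae] with x hx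
    rw [Real.norm_of_nonneg (sqLog_nonneg r _)]
    linarith [sqLog_nonneg r (fiberMean μ₀ A w x / 2)]
  refine ⟨hint, ?_⟩
  rw [← integral_const_mul, ← integral_fiberMean (A := A) hφ]
  exact integral_mono_ae (hint.const_mul 2) (integrable_fiberMean hφ) hae

/-- A quarter of a difference is at most the larger of the two halves, and each half contributes at
most half of the integral on the right. -/
lemma sqLog_fiberMean_sub (hw : Measurable w)
    (hφ : Integrable (fun x => sqLog r (w x)) (iidMeasure ι μ₀)) (A A' : Set ι) :
    Integrable (fun x => sqLog r ((fiberMean μ₀ A w x - fiberMean μ₀ A' w x) / 4))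
        (iidMeasure ι μ₀) ∧
      ∫ x, sqLog r ((fiberMean μ₀ A w x - fiberMean μ₀ A' w x) / 4) ∂iidMeasure ι μ₀ ≤
        ∫ x, sqLog r (w x) ∂iidMeasure ι μ₀ := by
  obtain ⟨h1, h1'⟩ := sqLog_fiberMean hw hφ A
  obtain ⟨h2, h2'⟩ := sqLog_fiberMean hw hφ A'
  have hpt : ∀ a b : ℝ, sqLog r ((a - b) / 4) ≤ sqLog r (a / 2) + sqLog r (b / 2) := by
    intro a b
    have key : |(a - b) / 4| ≤ max |a / 2| |b / 2| := by
      rw [abs_div, abs_div, abs_div, abs_two, show |(4 : ℝ)| = 4 by norm_num]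
      have := abs_sub a b
      have h1 := le_max_left (|a| / 2) (|b| / 2)
      have h2 := le_max_right (|a| / 2) (|b| / 2)
      linarith
    rcases le_max_iff.1 key with h | h
    · linarith [sqLog_mono r h, sqLog_nonneg r (b / 2)]
    · linarith [sqLog_mono r h, sqLog_nonneg r (a / 2)]
  have hm : Measurable fun x => sqLog r ((fiberMean μ₀ A w x - fiberMean μ₀ A' w x) / 4) :=
    (measurable_sqLog r).comp
      (((measurable_fiberMean hw).sub (measurable_fiberMean hw)).div_const 4)
  have hint := (h1.add h2).mono' hm.aestronglyMeasurable (Filter.Eventually.of_forall fun x => by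
    rw [Real.norm_of_nonneg (sqLog_nonneg r _)]
    exact hpt _ _)
  refine ⟨hint, (integral_mono hint (h1.add h2) fun x => hpt _ _).trans ?_⟩
  rw [integral_add' h1 h2]
  linarith

end fiber

/-! ### A smooth enough surrogate for `y ^ 2 ℓ(|y|) ^ r`. -/

/-- Soft thresholding: the signed distance of `y` to `[-τ, τ]`. -/
noncomputable def softThreshold (τ y : ℝ) : ℝ := y - max (-τ) (min τ y)

lemma abs_softThreshold_le_abs_sub {τ : ℝ} (hτ : 0 ≤ τ) (y : ℝ) {c : ℝ} (hc : -τ ≤ c)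
    (hc' : c ≤ τ) : |softThreshold τ y| ≤ |y - c| := by
  unfold softThreshold
  rcases max_cases (-τ) (min τ y) with ⟨h, h'⟩ | ⟨h, h'⟩ <;>
  rcases min_cases τ y with ⟨k, k'⟩ | ⟨k, k'⟩ <;>
  rcases abs_cases (y - c) with ⟨a, a'⟩ | ⟨a, a'⟩ <;> rw [a, abs_le] <;> constructor <;> linarith

lemma abs_softThreshold_le {τ : ℝ} (hτ : 0 ≤ τ) (y : ℝ) : |softThreshold τ y| ≤ |y| := by
  simpa using abs_softThreshold_le_abs_sub hτ y (c := 0) (by linarith) hτ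

lemma le_abs_softThreshold {τ : ℝ} (hτ : 0 ≤ τ) (y : ℝ) : |y| - τ ≤ |softThreshold τ y| := by
  unfold softThreshold
  have h1 : |max (-τ) (min τ y)| ≤ τ :=
    abs_le.2 ⟨le_max_left _ _, max_le (by linarith) (min_le_left _ _)⟩
  linarith [abs_sub_abs_le_abs_sub y (max (-τ) (min τ y))]

lemma softThreshold_eq_zero {τ y : ℝ} (h : |y| ≤ τ) : softThreshold τ y = 0 := by
  obtain ⟨h1, h2⟩ := abs_le.1 h
  rw [softThreshold, min_eq_right h2, max_eq_right h1, sub_self]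

lemma abs_softThreshold_add_le {τ : ℝ} (hτ : 0 ≤ τ) (x y : ℝ) :
    |softThreshold τ (x + y)| ≤ |softThreshold τ x + y| := by
  rw [show softThreshold τ x + y = x + y - max (-τ) (min τ x) by unfold softThreshold; ring]
  exact abs_softThreshold_le_abs_sub hτ _ (le_max_left _ _) (max_le (by linarith) (min_le_left _ _))

/-- The squared distance to `[-τ, τ]` is at most the squared distance to the projection of `x`,
which gives the quadratic expansion. If `|x| + |y| ≤ τ` everything vanishes, so curvature is paid
only beyond the threshold. -/
lemma softThreshold_add_sq_le {τ : ℝ} (hτ : 0 ≤ τ) (x y : ℝ) :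
    softThreshold τ (x + y) ^ 2 ≤ softThreshold τ x ^ 2 + 2 * softThreshold τ x * y +
      y ^ 2 * (if τ < |x| + |y| then 1 else 0) := by
  split_ifs with h
  · have := sq_le_sq.2 (abs_softThreshold_add_le hτ x y)
    linarith
  · push Not at h
    rw [softThreshold_eq_zero (τ := τ) (y := x) (by linarith [abs_nonneg y]),
      softThreshold_eq_zero ((abs_add_le x y).trans h)]
    simp

lemma measurable_softThreshold (τ : ℝ) : Measurable (softThreshold τ) := by
  unfold softThreshold
  fun_prop

/-- The increments of `k ^ r`. -/
def powIncr (r k : ℕ) : ℝ := ((k : ℝ) + 1) ^ r - (k : ℝ) ^ r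

lemma powIncr_nonneg (r k : ℕ) : 0 ≤ powIncr r k :=
  sub_nonneg.2 (pow_le_pow_left₀ (by positivity) (by linarith) r)

lemma sum_powIncr (r N : ℕ) : ∑ k ∈ Finset.range N, powIncr r k = (N : ℝ) ^ r - 0 ^ r := by
  have := Finset.sum_range_sub (fun k : ℕ => (k : ℝ) ^ r) N
  simpa [powIncr] using this

/-- The thresholds `2 ^ (k / 2) / 2`. -/
noncomputable def dyadicThreshold (k : ℕ) : ℝ := √(2 ^ k) / 2

lemma dyadicThreshold_nonneg (k : ℕ) : 0 ≤ dyadicThreshold k := by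
  unfold dyadicThreshold; positivity

lemma dyadicThreshold_mono {k l : ℕ} (h : k ≤ l) : dyadicThreshold k ≤ dyadicThreshold l := by
  unfold dyadicThreshold
  gcongr
  norm_num

/-- A function of growth `y² ℓ(|y|) ^ r` whose second differences are under control. -/
noncomputable def growthFun (r N : ℕ) (y : ℝ) : ℝ :=
  y ^ 2 + ∑ k ∈ Finset.range N, powIncr r k * softThreshold (dyadicThreshold k) y ^ 2

/-- The derivative of `growthFun r N`. -/
noncomputable def growthDeriv (r N : ℕ) (y : ℝ) : ℝ :=
  2 * y + ∑ k ∈ Finset.range N, powIncr r k * (2 * softThreshold (dyadicThreshold k) y)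

/-- The weight bounding the second differences of `growthFun r N`. -/
noncomputable def growthWeight (r N : ℕ) (t : ℝ) : ℝ :=
  1 + ∑ k ∈ Finset.range N, powIncr r k * (if dyadicThreshold k < t then 1 else 0)

lemma sq_le_growthFun (r N : ℕ) (y : ℝ) : y ^ 2 ≤ growthFun r N y :=
  le_add_of_nonneg_right (Finset.sum_nonneg fun k _ =>
    mul_nonneg (powIncr_nonneg r k) (sq_nonneg _))

lemma growthFun_nonneg (r N : ℕ) (y : ℝ) : 0 ≤ growthFun r N y :=
  (sq_nonneg y).trans (sq_le_growthFun r N y)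

lemma growthFun_zero (r N : ℕ) : growthFun r N 0 = 0 := by
  have h (k : ℕ) : softThreshold (dyadicThreshold k) 0 = 0 :=
    softThreshold_eq_zero (by simpa using dyadicThreshold_nonneg k)
  simp [growthFun, h]

lemma measurable_growthFun (r N : ℕ) : Measurable (growthFun r N) :=
  (measurable_id.pow_const 2).add (Finset.measurable_fun_sum _ fun _ _ =>
    ((measurable_softThreshold _).pow_const 2).const_mul _)

lemma measurable_growthDeriv (r N : ℕ) : Measurable (growthDeriv r N) :=
  (measurable_id.const_mul 2).add (Finset.measurable_fun_sum _ fun _ _ =>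
    ((measurable_softThreshold _).const_mul _).const_mul _)

lemma growthFun_add_le (r N : ℕ) (x y : ℝ) : growthFun r N (x + y) ≤
    growthFun r N x + growthDeriv r N x * y + y ^ 2 * growthWeight r N (|x| + |y|) := by
  have h : ∑ k ∈ Finset.range N, powIncr r k * softThreshold (dyadicThreshold k) (x + y) ^ 2 ≤
      ∑ k ∈ Finset.range N, powIncr r k * (softThreshold (dyadicThreshold k) x ^ 2 +
        2 * softThreshold (dyadicThreshold k) x * y +
        y ^ 2 * (if dyadicThreshold k < |x| + |y| then 1 else 0)) :=
    Finset.sum_le_sum fun k _ => mul_le_mul_of_nonneg_left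
      (softThreshold_add_sq_le (dyadicThreshold_nonneg k) x y) (powIncr_nonneg r k)
  have e : ∑ k ∈ Finset.range N, powIncr r k * (softThreshold (dyadicThreshold k) x ^ 2 +
        2 * softThreshold (dyadicThreshold k) x * y +
        y ^ 2 * (if dyadicThreshold k < |x| + |y| then 1 else 0)) =
      ∑ k ∈ Finset.range N, powIncr r k * softThreshold (dyadicThreshold k) x ^ 2 +
      (∑ k ∈ Finset.range N, powIncr r k * (2 * softThreshold (dyadicThreshold k) x)) * y +
      y ^ 2 * ∑ k ∈ Finset.range N, powIncr r k *
        (if dyadicThreshold k < |x| + |y| then 1 else 0) := by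
    rw [Finset.sum_mul, Finset.mul_sum, ← Finset.sum_add_distrib, ← Finset.sum_add_distrib]
    refine Finset.sum_congr rfl fun k _ => ?_
    ring
  unfold growthFun growthDeriv growthWeight
  linarith

/-- A linear bound for the derivative of `growthFun`. -/
lemma abs_growthDeriv_le (r N : ℕ) (y : ℝ) :
    |growthDeriv r N y| ≤ (2 + ∑ k ∈ Finset.range N, powIncr r k * 2) * |y| := by
  have h1 : |2 * y| = 2 * |y| := by rw [abs_mul, abs_two]
  refine (abs_add_le _ _).trans ?_
  rw [h1, add_mul, Finset.sum_mul]
  gcongr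
  refine (Finset.abs_sum_le_sum_abs _ _).trans (Finset.sum_le_sum fun k _ => ?_)
  rw [abs_mul, abs_of_nonneg (powIncr_nonneg r k), abs_mul, abs_two, mul_assoc]
  have := powIncr_nonneg r k
  exact mul_le_mul_of_nonneg_left (mul_le_mul_of_nonneg_left
    (abs_softThreshold_le (dyadicThreshold_nonneg k) y) zero_le_two) this

/-- If the last threshold is active then all are, and the weights telescope to a power of the number
of thresholds. An active threshold means `2 ^ N ≤ 4 * (1 + t) ^ 2`, hence `N + 1 ≤ 3 * logOne t`.
The bound does not depend on `N`. -/
lemma growthWeight_le (r N : ℕ) {t : ℝ} (ht : 0 ≤ t) :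
    growthWeight r N t ≤ 2 * (3 * logOne t) ^ r := by
  have hL := one_le_logOne ht
  induction N with
  | zero =>
    have : 1 ≤ (3 * logOne t) ^ r := one_le_pow₀ (by linarith)
    simp only [growthWeight, Finset.range_zero, Finset.sum_empty]
    linarith
  | succ N ih =>
    by_cases h : dyadicThreshold N < t
    · have h1 : growthWeight r (N + 1) t = 1 + (((N + 1 : ℕ) : ℝ) ^ r - 0 ^ r) := by
        rw [growthWeight, ← sum_powIncr]
        congr 1
        refine Finset.sum_congr rfl fun k hk => ?_
        rw [if_pos ((dyadicThreshold_mono (by simp at hk; omega)).trans_lt h), mul_one]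
      have h2 : ((N + 1 : ℕ) : ℝ) ≤ 3 * logOne t := by
        have h3 : (2 : ℝ) ^ N ≤ 4 * (1 + t) ^ 2 := by
          have : √(2 ^ N) ≤ 2 * (1 + t) := by
            unfold dyadicThreshold at h
            linarith
          calc (2 : ℝ) ^ N = √(2 ^ N) ^ 2 := (Real.sq_sqrt (by positivity)).symm
            _ ≤ (2 * (1 + t)) ^ 2 := by gcongr
            _ = _ := by ring
        have h4 := Real.log_le_log (by positivity) h3
        rw [Real.log_mul (by norm_num) (by positivity), Real.log_pow, Real.log_pow,
          show (4 : ℝ) = 2 ^ 2 by norm_num, Real.log_pow] at h4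
        push_cast at h4 ⊢
        have h5 := Real.log_two_gt_d9
        have h6 : 0 ≤ Real.log (1 + t) := Real.log_nonneg (by linarith)
        unfold logOne
        by_contra! hc
        nlinarith
      have h3 : (1 : ℝ) ≤ (3 * logOne t) ^ r := one_le_pow₀ (by linarith)
      have h4 : ((N + 1 : ℕ) : ℝ) ^ r ≤ (3 * logOne t) ^ r := by gcongr
      have h5 : (0 : ℝ) ≤ 0 ^ r := by positivity
      rw [h1]
      linarith
    · have : growthWeight r (N + 1) t = growthWeight r N t := by
        simp [growthWeight, Finset.sum_range_succ, h]
      rw [this]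
      exact ih

/-- The highest active layer dominates, by a geometric sum. If it is layer `N`, the thresholds up to
`N` are at most `|y| / 2`, so each soft threshold keeps half of `|y|` and the weights telescope to
about `(N + 1) ^ r`. -/
lemma sum_layer_le_growthFun (r N : ℕ) (y : ℝ) :
    ∑ k ∈ Finset.range N, ((k : ℝ) + 1) ^ r * 2 ^ k * (if 2 ^ k < y ^ 2 then 1 else 0) ≤
      8 * growthFun r N y := by
  induction N with
  | zero => simpa using growthFun_nonneg r 0 y
  | succ N ih =>
    by_cases h : 2 ^ N < y ^ 2
    · have h1 : ∑ k ∈ Finset.range (N + 1),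
          ((k : ℝ) + 1) ^ r * 2 ^ k * (if 2 ^ k < y ^ 2 then 1 else 0) ≤
          ∑ k ∈ Finset.range (N + 1), ((N : ℝ) + 1) ^ r * 2 ^ k := by
        refine Finset.sum_le_sum fun k hk => ?_
        have hk' : (k : ℝ) ≤ N := by exact_mod_cast Nat.lt_succ_iff.1 (Finset.mem_range.1 hk)
        calc _ ≤ ((k : ℝ) + 1) ^ r * 2 ^ k * 1 := by
              gcongr
              split_ifs <;> norm_num
          _ ≤ _ := by rw [mul_one]; gcongr
      have h2 : ∑ k ∈ Finset.range (N + 1), (2 : ℝ) ^ k ≤ 2 * 2 ^ N := by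
        rw [geom_sum_eq (by norm_num)]
        norm_num [pow_succ]
        linarith
      have h3 : y ^ 2 / 4 * ((N : ℝ) + 1) ^ r ≤ growthFun r (N + 1) y := by
        have h4 : ∑ k ∈ Finset.range (N + 1), powIncr r k * (y ^ 2 / 4) ≤
            ∑ k ∈ Finset.range (N + 1), powIncr r k *
              softThreshold (dyadicThreshold k) y ^ 2 := by
          refine Finset.sum_le_sum fun k hk => mul_le_mul_of_nonneg_left ?_ (powIncr_nonneg r k)
          have h5 : dyadicThreshold k ≤ |y| / 2 := by
            refine (dyadicThreshold_mono (Nat.lt_succ_iff.1 (Finset.mem_range.1 hk))).trans ?_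
            unfold dyadicThreshold
            rw [← Real.sqrt_sq_eq_abs]
            gcongr
          have h6 : |y| / 2 ≤ |softThreshold (dyadicThreshold k) y| := by
            linarith [le_abs_softThreshold (dyadicThreshold_nonneg k) y]
          rw [← sq_abs (softThreshold _ _), ← sq_abs y]
          nlinarith [abs_nonneg y]
        rw [← Finset.sum_mul, sum_powIncr] at h4
        unfold growthFun
        have h7 : (0 : ℝ) ^ r ≤ 1 := pow_le_one₀ le_rfl zero_le_one
        push_cast at h4
        nlinarith [sq_nonneg y]
      rw [← Finset.mul_sum] at h1
      have h8 : (0 : ℝ) ≤ ((N : ℝ) + 1) ^ r := by positivity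
      have h9 : ((N : ℝ) + 1) ^ r * ∑ k ∈ Finset.range (N + 1), (2 : ℝ) ^ k ≤
          ((N : ℝ) + 1) ^ r * (2 * y ^ 2) := by
        gcongr
        linarith
      linarith
    · rw [Finset.sum_range_succ, if_neg h, mul_zero, add_zero]
      refine ih.trans ?_
      gcongr
      unfold growthFun
      rw [Finset.sum_range_succ]
      have := mul_nonneg (powIncr_nonneg r N) (sq_nonneg (softThreshold (dyadicThreshold N) y))
      linarith

/-- The constant of `sq_mul_growthWeight_le`. -/
noncomputable def growthConst (r : ℕ) : ℝ := 32 * 15 ^ r * (1 + 2 ^ r + 6 * r.factorial)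

lemma growthConst_nonneg (r : ℕ) : 0 ≤ growthConst r := by
  unfold growthConst; positivity

/-- Either `1 + s ≤ (1 + t) ^ 2` and the logarithms are comparable, or `t ^ 2 ≤ s` and a power of a
logarithm is at most linear. -/
lemma sq_mul_logOne_pow_le (r : ℕ) {s t : ℝ} (hs : 0 ≤ s) (ht : 0 ≤ t) :
    t ^ 2 * logOne s ^ r ≤ 2 ^ r * (t ^ 2 * logOne t ^ r) + 6 * r.factorial * (1 + s ^ 2) := by
  have h1 := one_le_logOne hs
  have h2 := one_le_logOne ht
  rcases le_total (1 + s) ((1 + t) ^ 2) with h | h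
  · have h3 := logOne_le_mul hs one_le_two h
    push_cast at h3
    have h4 : logOne s ^ r ≤ (2 * logOne t) ^ r := by gcongr
    rw [mul_pow] at h4
    have h5 : 0 ≤ 6 * (r.factorial : ℝ) * (1 + s ^ 2) := by positivity
    have := mul_le_mul_of_nonneg_left h4 (sq_nonneg t)
    linarith
  · have h3 : t ^ 2 ≤ s := by nlinarith
    have h4 := logOne_pow_le r hs
    have h5 : 0 ≤ 2 ^ r * (t ^ 2 * logOne t ^ r) := by positivity
    have h6 : (0 : ℝ) ≤ 3 * r.factorial := by positivity
    calc t ^ 2 * logOne s ^ r ≤ s * (3 * r.factorial * (1 + s)) := by gcongr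
      _ ≤ 3 * r.factorial * (2 * (1 + s ^ 2)) := by nlinarith [sq_nonneg (s - 1)]
      _ ≤ _ := by linarith

/-- The mixed term, where the size of `x` enters the logarithm and that of `u` the square, is
absorbed by `x ^ 2` and `sqLog r u`. The bound `a ≤ 1` keeps `a` out of the logarithm, so that
exactly `a ^ 2` remains. -/
lemma sq_mul_growthWeight_le (r N : ℕ) {a : ℝ} (ha0 : 0 ≤ a) (ha : a ≤ 1) (x u : ℝ) :
    (4 * a * u) ^ 2 * growthWeight r N (|x| + |4 * a * u|) ≤
      growthConst r * a ^ 2 * (sqLog r u + 1 + x ^ 2) := by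
  have hx := abs_nonneg x
  have hu := abs_nonneg u
  have lx := one_le_logOne hx
  have lu := one_le_logOne hu
  have h1 : |x| + |4 * a * u| ≤ |x| + 4 * |u| := by
    rw [abs_mul, abs_of_nonneg (by positivity : 0 ≤ 4 * a)]
    nlinarith
  have h2 : logOne (|x| + |4 * a * u|) ≤ logOne |x| + 4 * logOne |u| :=
    (logOne_mono (by positivity) h1).trans (logOne_add_le hx hu)
  have h3 : (3 * logOne (|x| + |4 * a * u|)) ^ r ≤ 15 ^ r * (logOne |x| ^ r + logOne |u| ^ r) := by
    have l0 := one_le_logOne (show 0 ≤ |x| + |4 * a * u| by positivity)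
    rcases le_total (logOne |x|) (logOne |u|) with h | h
    · calc _ ≤ (15 * logOne |u|) ^ r := by
            refine pow_le_pow_left₀ (by linarith) ?_ r
            linarith
        _ = 15 ^ r * logOne |u| ^ r := mul_pow _ _ _
        _ ≤ _ := by
          gcongr
          exact le_add_of_nonneg_left (by positivity)
    · calc _ ≤ (15 * logOne |x|) ^ r := by
            refine pow_le_pow_left₀ (by linarith) ?_ r
            linarith
        _ = 15 ^ r * logOne |x| ^ r := mul_pow _ _ _
        _ ≤ _ := by
          gcongr
          exact le_add_of_nonneg_right (by positivity)
  have h4 := growthWeight_le r N (show 0 ≤ |x| + |4 * a * u| by positivity)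
  have h5 := sq_mul_logOne_pow_le r hx hu
  rw [sq_abs, sq_abs] at h5
  have h6 : u ^ 2 * (logOne |x| ^ r + logOne |u| ^ r) ≤
      (1 + 2 ^ r + 6 * r.factorial) * (sqLog r u + 1 + x ^ 2) := by
    have e : u ^ 2 * logOne |u| ^ r = sqLog r u := rfl
    rw [e] at h5
    have h7 := sqLog_nonneg r u
    have h8 : (0 : ℝ) ≤ 6 * r.factorial := by positivity
    have h9 : (0 : ℝ) ≤ 2 ^ r := by positivity
    rw [mul_add, e]
    nlinarith [sq_nonneg x, mul_nonneg h8 h7, mul_nonneg h9 (add_nonneg zero_le_one (sq_nonneg x))]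
  calc _ ≤ (4 * a * u) ^ 2 * (2 * (15 ^ r * (logOne |x| ^ r + logOne |u| ^ r))) := by
        gcongr
        linarith
    _ = 32 * 15 ^ r * a ^ 2 * (u ^ 2 * (logOne |x| ^ r + logOne |u| ^ r)) := by ring
    _ ≤ 32 * 15 ^ r * a ^ 2 * ((1 + 2 ^ r + 6 * r.factorial) * (sqLog r u + 1 + x ^ 2)) := by
        gcongr
    _ = _ := by unfold growthConst; ring

lemma fiberMean_div_const {ι : Type*} {μ₀ : Measure ℝ} (A : Set ι) (g : (ι → ℝ) → ℝ) (a : ℝ)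
    (x : ι → ℝ) : fiberMean μ₀ A (fun y => g y / a) x = fiberMean μ₀ A g x / a :=
  integral_div a _

/-! ### The martingale that reveals one coordinate at a time. -/

section martingale
variable {ι : Type*} {μ₀ : Measure ℝ} [IsProbabilityMeasure μ₀] {r : ℕ}

lemma memLp_two_fiberMean {w : (ι → ℝ) → ℝ} (hw : Measurable w)
    (hφ : Integrable (fun x => sqLog r (w x)) (iidMeasure ι μ₀)) (A : Set ι) :
    MemLp (fiberMean μ₀ A w) 2 (iidMeasure ι μ₀) := by
  have h := (memLp_two_of_sqLog ((measurable_fiberMean hw).div_const 2)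
    (sqLog_fiberMean hw hφ A).1).const_mul 2
  convert h using 2
  ring

lemma integral_mul_fiberMean_sub {A A' : Set ι} (hA : A ⊆ A') {Z w : (ι → ℝ) → ℝ}
    (hZd : DependsOn Z A) (hZ : MemLp Z 2 (iidMeasure ι μ₀)) (hw : Measurable w)
    (hφ : Integrable (fun x => sqLog r (w x)) (iidMeasure ι μ₀)) :
    ∫ x, Z x * (fiberMean μ₀ A' w x - fiberMean μ₀ A w x) ∂iidMeasure ι μ₀ = 0 := by
  have hZw : Integrable (fun x => Z x * w x) (iidMeasure ι μ₀) :=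
    hZ.integrable_mul (memLp_two_of_sqLog hw hφ)
  have hi (A : Set ι) : Integrable (fun x => Z x * fiberMean μ₀ A w x) (iidMeasure ι μ₀) :=
    hZ.integrable_mul (memLp_two_fiberMean hw hφ A)
  simp only [mul_sub]
  rw [integral_sub (hi A') (hi A), integral_mul_fiberMean hZd hZw,
    integral_mul_fiberMean (fun x y hxy => hZd fun v hv => hxy v (hA hv)) hZw, sub_self]

/-- One step of the martingale. -/
lemma growthFun_step {N : ℕ} {A A' : Set ι} (hA : A ⊆ A') {a : ℝ} (ha0 : 0 ≤ a) (ha : a ≤ 1)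
    {S w : (ι → ℝ) → ℝ} (hS : Measurable S) (hSd : DependsOn S A)
    (hSi : Integrable (fun x => growthFun r N (S x)) (iidMeasure ι μ₀)) (hw : Measurable w)
    (hφ : Integrable (fun x => sqLog r (w x)) (iidMeasure ι μ₀))
    (hφ1 : ∫ x, sqLog r (w x) ∂iidMeasure ι μ₀ ≤ 1) :
    Integrable (fun x => growthFun r N (S x + a * (fiberMean μ₀ A' w x - fiberMean μ₀ A w x)))
        (iidMeasure ι μ₀) ∧
      1 + ∫ x, growthFun r N (S x + a * (fiberMean μ₀ A' w x - fiberMean μ₀ A w x))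
        ∂iidMeasure ι μ₀ ≤
      (1 + 2 * growthConst r * a ^ 2) * (1 + ∫ x, growthFun r N (S x) ∂iidMeasure ι μ₀) := by
  set μ := iidMeasure ι μ₀
  set D : (ι → ℝ) → ℝ := fun x => fiberMean μ₀ A' w x - fiberMean μ₀ A w x
  have hDm : Measurable D := (measurable_fiberMean hw).sub (measurable_fiberMean hw)
  obtain ⟨hU, hU1⟩ := sqLog_fiberMean_sub hw hφ A' A
  have hS2i : Integrable (fun x => S x ^ 2) μ :=
    hSi.mono' (hS.pow_const 2).aestronglyMeasurable (Filter.Eventually.of_forall fun x => by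
      rw [Real.norm_of_nonneg (sq_nonneg _)]
      exact sq_le_growthFun r N _)
  have hS2 : MemLp S 2 μ := (memLp_two_iff_integrable_sq hS.aestronglyMeasurable).2 hS2i
  have hZm : Measurable fun x => growthDeriv r N (S x) := (measurable_growthDeriv r N).comp hS
  have hZ : MemLp (fun x => growthDeriv r N (S x)) 2 μ :=
    hS2.of_le_mul hZm.aestronglyMeasurable
      (Filter.Eventually.of_forall fun x => abs_growthDeriv_le r N (S x))
  have hD2 : MemLp D 2 μ :=
    (memLp_two_fiberMean hw hφ A').sub (memLp_two_fiberMean hw hφ A)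
  have hZD : Integrable (fun x => growthDeriv r N (S x) * D x) μ := hZ.integrable_mul hD2
  -- The first-order term disappears, the increment being orthogonal to functions of the coordinates
  -- already revealed.
  have hZD0 : ∫ x, growthDeriv r N (S x) * D x ∂μ = 0 :=
    integral_mul_fiberMean_sub hA (fun x y hxy => by rw [hSd hxy]) hZ hw hφ
  have hK := growthConst_nonneg r
  have hpt : ∀ x, growthFun r N (S x + a * D x) ≤ growthFun r N (S x) +
      a * (growthDeriv r N (S x) * D x) +
      growthConst r * a ^ 2 * (sqLog r (D x / 4) + 1 + S x ^ 2) := fun x => by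
    have h1 := growthFun_add_le r N (S x) (a * D x)
    have h2 := sq_mul_growthWeight_le r N ha0 ha (S x) (D x / 4)
    rw [show 4 * a * (D x / 4) = a * D x by ring] at h2
    linarith
  have hU' : Integrable (fun x => sqLog r (D x / 4) + 1) μ := hU.add (integrable_const 1)
  have hE : Integrable (fun x => sqLog r (D x / 4) + 1 + S x ^ 2) μ := hU'.add hS2i
  have hT : Integrable (fun x => growthFun r N (S x) + a * (growthDeriv r N (S x) * D x)) μ :=
    hSi.add (hZD.const_mul a)
  have hR : Integrable (fun x => growthFun r N (S x) + a * (growthDeriv r N (S x) * D x) +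
      growthConst r * a ^ 2 * (sqLog r (D x / 4) + 1 + S x ^ 2)) μ :=
    hT.add (hE.const_mul _)
  have hint : Integrable (fun x => growthFun r N (S x + a * D x)) μ :=
    hR.mono' ((measurable_growthFun r N).comp (hS.add (hDm.const_mul a))).aestronglyMeasurable
      (Filter.Eventually.of_forall fun x => by
        rw [Real.norm_of_nonneg (growthFun_nonneg r N _)]
        exact hpt x)
  refine ⟨hint, ?_⟩
  have h1 := integral_mono hint hR hpt
  rw [integral_add hT (hE.const_mul _),
    integral_add hSi (hZD.const_mul a), integral_const_mul, integral_const_mul, hZD0,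
    integral_add hU' hS2i, integral_add hU (integrable_const 1)] at h1
  simp only [integral_const, probReal_univ, smul_eq_mul, mul_one, mul_zero, add_zero] at h1
  have h2 : ∫ x, S x ^ 2 ∂μ ≤ ∫ x, growthFun r N (S x) ∂μ :=
    integral_mono hS2i hSi fun x => sq_le_growthFun r N _
  have h3 : 0 ≤ ∫ x, growthFun r N (S x) ∂μ := integral_nonneg fun x => growthFun_nonneg r N _
  have h4 : growthConst r * a ^ 2 * (∫ x, sqLog r (D x / 4) ∂μ + 1 + ∫ x, S x ^ 2 ∂μ) ≤
      growthConst r * a ^ 2 * (2 * (1 + ∫ x, growthFun r N (S x) ∂μ)) := by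
    refine mul_le_mul_of_nonneg_left ?_ (by positivity)
    linarith
  linarith

/-- The growth of the martingale obtained by revealing the coordinates in `F` one at a time. -/
lemma integral_growthFun_le [DecidableEq ι] {g : (ι → ℝ) → ℝ} (hg : Measurable g)
    (hgi : Integrable g (iidMeasure ι μ₀)) {a : ι → ℝ} (N : ℕ) (A : Set ι) (F : Finset ι)
    (ha : ∀ u ∈ F, 0 < a u ∧ a u ≤ 1)
    (hosc : ∀ u ∈ F, ∃ t : ℝ, ∫⁻ x, ENNReal.ofReal (sqLog r ((g x - g (Function.update x u t)) /
      a u)) ∂iidMeasure ι μ₀ ≤ 1) :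
    Integrable (fun x => growthFun r N (fiberMean μ₀ (A ∪ F) g x - fiberMean μ₀ A g x))
        (iidMeasure ι μ₀) ∧
      1 + ∫ x, growthFun r N (fiberMean μ₀ (A ∪ F) g x - fiberMean μ₀ A g x) ∂iidMeasure ι μ₀ ≤
        ∏ u ∈ F, (1 + 2 * growthConst r * a u ^ 2) := by
  induction F using Finset.induction_on with
  | empty => simp [growthFun_zero]
  | insert u F hu ih =>
    obtain ⟨ih1, ih2⟩ := ih (fun v hv => ha v (Finset.mem_insert_of_mem hv))
      fun v hv => hosc v (Finset.mem_insert_of_mem hv)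
    obtain ⟨ha0, ha1⟩ := ha u (Finset.mem_insert_self u F)
    obtain ⟨t, ht⟩ := hosc u (Finset.mem_insert_self u F)
    set A₁ : Set ι := A ∪ F with hA₁
    have hA₂ : A ∪ (insert u F : Finset ι) = insert u A₁ := by
      rw [Finset.coe_insert, Set.union_insert]
    rw [hA₂]
    -- Freezing the coordinate `u` gives a function that does not contribute to the increment at
    -- `u`, so only the oscillation `g - h` matters.
    set h : (ι → ℝ) → ℝ := fun x => g (Function.update x u t) with hh
    have hhm : Measurable h := hg.comp (measurable_update'.comp (measurable_id.prodMk measurable_const))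
    have hhd : DependsOn h {u}ᶜ := fun x y hxy => by
      simp only [hh]
      congr 1
      ext v
      by_cases hv : v = u
      · simp [hv]
      · simp [Function.update_of_ne hv, hxy v hv]
    set w : (ι → ℝ) → ℝ := fun x => (g x - h x) / a u with hw
    have hwm : Measurable w := (hg.sub hhm).div_const _
    have hφm : Measurable fun x => sqLog r (w x) := (measurable_sqLog r).comp hwm
    have hφ : Integrable (fun x => sqLog r (w x)) (iidMeasure ι μ₀) :=
      (lintegral_ofReal_ne_top_iff_integrable hφm.aestronglyMeasurable
        (Filter.Eventually.of_forall fun x => sqLog_nonneg r _)).1 (ht.trans_lt (by simp)).ne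
    have hφ1 : ∫ x, sqLog r (w x) ∂iidMeasure ι μ₀ ≤ 1 := by
      rw [integral_eq_lintegral_of_nonneg_ae (Filter.Eventually.of_forall fun x =>
        sqLog_nonneg r _) hφm.aestronglyMeasurable]
      exact ENNReal.toReal_le_of_le_ofReal zero_le_one (by simpa using ht)
    have hwi := (memLp_two_of_sqLog hwm hφ).integrable one_le_two
    have hhi : Integrable h (iidMeasure ι μ₀) := by
      have := hgi.sub (hwi.const_mul (a u))
      refine this.congr (Filter.Eventually.of_forall fun x => ?_)
      simp only [Pi.sub_apply, hw]
      field_simp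
      ring
    have hS : Measurable fun x => fiberMean μ₀ A₁ g x - fiberMean μ₀ A g x :=
      (measurable_fiberMean hg).sub (measurable_fiberMean hg)
    have hSd : DependsOn (fun x => fiberMean μ₀ A₁ g x - fiberMean μ₀ A g x) A₁ :=
      fun x y hxy => by
        have h1 := dependsOn_fiberMean (μ₀ := μ₀) (g := g) (A := A₁) hxy
        have h2 := dependsOn_fiberMean (μ₀ := μ₀) (g := g) (A := A)
          fun v hv => hxy v (Or.inl hv)
        simp only [h1, h2]
    obtain ⟨h1, h2⟩ := growthFun_step (A' := insert u A₁) (Set.subset_insert u A₁) ha0.le ha1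
      hS hSd ih1 hwm hφ hφ1
    have hae : (fun x => growthFun r N (fiberMean μ₀ A₁ g x - fiberMean μ₀ A g x +
        a u * (fiberMean μ₀ (insert u A₁) w x - fiberMean μ₀ A₁ w x))) =ᵐ[iidMeasure ι μ₀]
        fun x => growthFun r N (fiberMean μ₀ (insert u A₁) g x - fiberMean μ₀ A g x) := by
      filter_upwards [fiberMean_sub (A := A₁) hgi hhi, fiberMean_sub (A := insert u A₁) hgi hhi]
        with x e1 e2
      rw [hw, fiberMean_div_const, fiberMean_div_const, e1, e2,
        fiberMean_insert_of_dependsOn hhd]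
      congr 1
      field_simp
      ring
    refine ⟨h1.congr hae, ?_⟩
    rw [← integral_congr_ae hae, Finset.prod_insert hu]
    refine h2.trans (mul_le_mul_of_nonneg_left ih2 ?_)
    have := growthConst_nonneg r
    positivity

/-- The Orlicz-type bound for the martingale obtained by revealing the coordinates in `F`. -/
theorem lintegral_layerSum_fiberMean_sub_le [DecidableEq ι] {g : (ι → ℝ) → ℝ} (hg : Measurable g)
    (hgi : Integrable g (iidMeasure ι μ₀)) {a : ι → ℝ} (A : Set ι) (F : Finset ι)
    (ha : ∀ u ∈ F, 0 < a u) (ha1 : ∑ u ∈ F, a u ^ 2 ≤ 1)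
    (hosc : ∀ u ∈ F, ∃ t : ℝ, ∫⁻ x, ENNReal.ofReal (sqLog r ((g x - g (Function.update x u t)) /
      a u)) ∂iidMeasure ι μ₀ ≤ 1) :
    ∫⁻ x, layerSum r (ENNReal.ofReal ((fiberMean μ₀ (A ∪ F) g x - fiberMean μ₀ A g x) ^ 2))
      ∂iidMeasure ι μ₀ ≤ ENNReal.ofReal (8 * Real.exp (2 * growthConst r)) := by
  set μ := iidMeasure ι μ₀
  have hK := growthConst_nonneg r
  set S : (ι → ℝ) → ℝ := fun x => fiberMean μ₀ (A ∪ F) g x - fiberMean μ₀ A g x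
  have hS : Measurable S := (measurable_fiberMean hg).sub (measurable_fiberMean hg)
  have hprod : ∏ u ∈ F, (1 + 2 * growthConst r * a u ^ 2) ≤ Real.exp (2 * growthConst r) := by
    calc ∏ u ∈ F, (1 + 2 * growthConst r * a u ^ 2)
        ≤ ∏ u ∈ F, Real.exp (2 * growthConst r * a u ^ 2) :=
          Finset.prod_le_prod (fun u _ => by positivity) fun u _ => by
            linarith [Real.add_one_le_exp (2 * growthConst r * a u ^ 2)]
      _ = Real.exp (2 * growthConst r * ∑ u ∈ F, a u ^ 2) := by
          rw [← Real.exp_sum, Finset.mul_sum]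
      _ ≤ Real.exp (2 * growthConst r) := by
          rw [Real.exp_le_exp]
          exact mul_le_of_le_one_right (by positivity) ha1
  have hm (k : ℕ) : Measurable fun x => ((k + 1 : ℕ) : ℝ≥0∞) ^ r * 2 ^ k *
      (if 2 ^ k < ENNReal.ofReal (S x ^ 2) then 1 else 0) :=
    (Measurable.ite (measurableSet_lt measurable_const (hS.pow_const 2).ennreal_ofReal)
      measurable_const measurable_const).const_mul _
  unfold layerSum
  rw [lintegral_tsum fun k => (hm k).aemeasurable]
  -- Only finitely many thresholds are used at a time, which keeps `growthDeriv` linearly bounded;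
  -- the resulting estimate is uniform in `N`.
  refine ENNReal.tsum_le_of_sum_range_le fun N => ?_
  rw [← lintegral_finsetSum _ fun k _ => hm k]
  obtain ⟨h1, h2⟩ := integral_growthFun_le hg hgi N A F (fun u hu => ⟨ha u hu, by
    have : a u ^ 2 ≤ 1 := (Finset.single_le_sum (f := fun u => a u ^ 2)
      (fun _ _ => sq_nonneg _) hu).trans ha1
    exact (sq_le_one_iff₀ (ha u hu).le).1 this⟩) hosc
  calc _ ≤ ∫⁻ x, ENNReal.ofReal (8 * growthFun r N (S x)) ∂μ := by
        refine lintegral_mono fun x => ?_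
        have hpt := ENNReal.ofReal_le_ofReal (sum_layer_le_growthFun r N (S x))
        refine le_trans (le_of_eq ?_) hpt
        rw [ENNReal.ofReal_sum_of_nonneg fun k _ => by positivity]
        refine Finset.sum_congr rfl fun k _ => ?_
        have hiff : (2 : ℝ≥0∞) ^ k < ENNReal.ofReal (S x ^ 2) ↔ (2 : ℝ) ^ k < S x ^ 2 := by
          rw [show (2 : ℝ≥0∞) ^ k = ENNReal.ofReal (2 ^ k) by
            rw [ENNReal.ofReal_pow zero_le_two]; simp]
          exact ENNReal.ofReal_lt_ofReal_iff_of_nonneg (by positivity)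
        simp only [hiff]
        split_ifs
        · rw [mul_one, mul_one, ENNReal.ofReal_mul (by positivity),
            ENNReal.ofReal_pow (by positivity), ENNReal.ofReal_pow zero_le_two,
            ENNReal.ofReal_ofNat, ← Nat.cast_add_one, ENNReal.ofReal_natCast]
        · simp
    _ = ENNReal.ofReal (∫ x, 8 * growthFun r N (S x) ∂μ) :=
        (ofReal_integral_eq_lintegral_ofReal (h1.const_mul 8) (Filter.Eventually.of_forall
          fun x => mul_nonneg (by norm_num) (growthFun_nonneg r N _))).symm
    _ ≤ _ := by
        rw [integral_const_mul]
        gcongr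
        linarith

end martingale

/-! ### Fiber means as conditional expectations, and Lévy's upward theorem. -/

section convergence
variable {ι : Type*}

/-- The `σ`-algebra generated by the coordinates in `A`. -/
noncomputable abbrev coordSigma (A : Set ι) : MeasurableSpace (ι → ℝ) :=
  MeasurableSpace.comap (fun x => merge A x 0) MeasurableSpace.pi

lemma measurable_merge_zero (A : Set ι) : Measurable fun x : ι → ℝ => merge A x 0 :=
  (measurable_merge A).comp (measurable_id.prodMk measurable_const)

lemma coordSigma_le (A : Set ι) : coordSigma A ≤ MeasurableSpace.pi :=
  (measurable_merge_zero A).comap_le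

lemma coordSigma_mono {A A' : Set ι} (h : A ⊆ A') : coordSigma A ≤ coordSigma A' := by
  have e : (fun x : ι → ℝ => merge A x 0) = (fun x => merge A x 0) ∘ fun x => merge A' x 0 := by
    ext x v
    by_cases hv : v ∈ A
    · simp [merge, hv, h hv]
    · simp [merge, hv]
  unfold coordSigma
  rw [e, ← MeasurableSpace.comap_comp]
  exact MeasurableSpace.comap_mono (measurable_merge_zero A).comap_le

lemma stronglyMeasurable_coordSigma {A : Set ι} {h : (ι → ℝ) → ℝ} (hh : Measurable h)
    (hd : DependsOn h A) : StronglyMeasurable[coordSigma A] h := by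
  have e : h = h ∘ fun x => merge A x 0 := by
    ext x
    exact (hd.merge_eq x 0).symm
  rw [e]
  exact (hh.comp (comap_measurable _)).stronglyMeasurable

lemma iSup_coordSigma {A : ℕ → Set ι} (hA : ∀ v, ∃ n, v ∈ A n) :
    ⨆ n, coordSigma (A n) = MeasurableSpace.pi := by
  refine le_antisymm (iSup_le fun n => coordSigma_le _) (iSup_le fun v => ?_)
  obtain ⟨n, hn⟩ := hA v
  refine le_trans ?_ (le_iSup (fun n => coordSigma (A n)) n)
  have e : (fun x : ι → ℝ => x v) = (fun x => x v) ∘ fun x => merge (A n) x 0 := by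
    ext x
    simp [merge, hn]
  rw [e, ← MeasurableSpace.comap_comp]
  exact MeasurableSpace.comap_mono (measurable_pi_apply v).comap_le

variable {μ₀ : Measure ℝ} [IsProbabilityMeasure μ₀] {g : (ι → ℝ) → ℝ}

lemma fiberMean_ae_eq_condExp (hg : Measurable g) (hgi : Integrable g (iidMeasure ι μ₀))
    (A : Set ι) : fiberMean μ₀ A g =ᵐ[iidMeasure ι μ₀] (iidMeasure ι μ₀)[g | coordSigma A] := by
  refine ae_eq_condExp_of_forall_setIntegral_eq (coordSigma_le A) hgi
    (fun s _ _ => (integrable_fiberMean hgi).integrableOn) (fun s hs _ => ?_)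
    (stronglyMeasurable_coordSigma (measurable_fiberMean hg)
      dependsOn_fiberMean).aestronglyMeasurable
  have hsm : MeasurableSet s := coordSigma_le A s hs
  obtain ⟨t, -, rfl⟩ := hs
  set s := (fun x : ι → ℝ => merge A x 0) ⁻¹' t
  have hd : DependsOn (s.indicator fun _ => (1 : ℝ)) A := fun x y hxy => by
    have : x ∈ s ↔ y ∈ s := by
      simp only [s, Set.mem_preimage, merge_eq_of_eqOn hxy]
    by_cases hx : x ∈ s
    · rw [Set.indicator_of_mem hx, Set.indicator_of_mem (this.1 hx)]
    · rw [Set.indicator_of_notMem hx, Set.indicator_of_notMem fun h => hx (this.2 h)]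
  have hmul : ∀ h : (ι → ℝ) → ℝ, (fun x => s.indicator (fun _ => (1 : ℝ)) x * h x) =
      s.indicator h := fun h => by
    ext x
    by_cases hx : x ∈ s <;> simp [hx]
  have key := integral_mul_fiberMean (μ₀ := μ₀) (g := g) hd
    (by rw [hmul]; exact hgi.indicator hsm)
  rwa [hmul, hmul, integral_indicator hsm, integral_indicator hsm] at key

/-- Lévy's upward theorem for the means over fibers. -/
lemma tendsto_fiberMean (hg : Measurable g) (hgi : Integrable g (iidMeasure ι μ₀))
    {A : ℕ → Set ι} (hmono : Monotone A) (hA : ∀ v, ∃ n, v ∈ A n) :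
    ∀ᵐ x ∂iidMeasure ι μ₀, Filter.Tendsto (fun n => fiberMean μ₀ (A n) g x) Filter.atTop
      (nhds (g x)) := by
  let ℱ : Filtration ℕ (MeasurableSpace.pi (X := fun _ : ι => ℝ)) :=
    ⟨fun n => coordSigma (A n), fun m n h => coordSigma_mono (hmono h), fun n => coordSigma_le _⟩
  have hsm : StronglyMeasurable[⨆ n, ℱ n] g := by
    have : (⨆ n, ℱ n) = MeasurableSpace.pi := iSup_coordSigma hA
    rw [this]
    exact hg.stronglyMeasurable
  have hall : ∀ᵐ x ∂iidMeasure ι μ₀, ∀ n, fiberMean μ₀ (A n) g x =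
      ((iidMeasure ι μ₀)[g | coordSigma (A n)]) x :=
    ae_all_iff.2 fun n => fiberMean_ae_eq_condExp hg hgi (A n)
  filter_upwards [hgi.tendsto_ae_condExp hsm, hall] with x h1 h2
  simpa only [h2] using h1

end convergence

/-! ### Countable subadditivity of the maximal function and of the `L ^ p` norm. -/

/-- Minkowski's inequality for infinite sums. -/
lemma lintegral_tsum_rpow_le {α : Type*} [MeasurableSpace α] {ρ : Measure α} {p : ℝ} (hp : 1 ≤ p)
    {M : ℕ → α → ℝ≥0∞} (hM : ∀ j, Measurable (M j)) :
    (∫⁻ x, (∑' j, M j x) ^ p ∂ρ) ^ (1 / p) ≤ ∑' j, (∫⁻ x, M j x ^ p ∂ρ) ^ (1 / p) := by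
  have hp0 : 0 < p := by linarith
  have hfin : ∀ n : ℕ, (∫⁻ x, (∑ j ∈ Finset.range n, M j x) ^ p ∂ρ) ^ (1 / p) ≤
      ∑ j ∈ Finset.range n, (∫⁻ x, M j x ^ p ∂ρ) ^ (1 / p) := by
    intro n
    induction n with
    | zero => simp [hp0]
    | succ n ih =>
      simp only [Finset.sum_range_succ]
      exact (ENNReal.lintegral_Lp_add_le (f := fun x => ∑ j ∈ Finset.range n, M j x)
        (Finset.measurable_fun_sum _ fun j _ => hM j).aemeasurable (hM n).aemeasurable hp).trans
        (add_le_add_left ih _)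
  have hpow : ∀ x, (∑' j, M j x) ^ p = ⨆ n : ℕ, (∑ j ∈ Finset.range n, M j x) ^ p := fun x => by
    rw [ENNReal.tsum_eq_iSup_nat]
    exact (ENNReal.orderIsoRpow p hp0).map_iSup _
  simp only [hpow]
  rw [lintegral_iSup (fun n => (Finset.measurable_fun_sum _ fun j _ => hM j).pow_const p)
    fun m n h x => ENNReal.rpow_le_rpow (Finset.sum_le_sum_of_subset
      (Finset.range_mono h)) hp0.le,
    show (⨆ n, ∫⁻ x, (∑ j ∈ Finset.range n, M j x) ^ p ∂ρ) ^ (1 / p) =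
      ⨆ n, (∫⁻ x, (∑ j ∈ Finset.range n, M j x) ^ p ∂ρ) ^ (1 / p) from
      (ENNReal.orderIsoRpow (1 / p) (by positivity)).map_iSup _]
  exact iSup_le fun n => (hfin n).trans (ENNReal.sum_le_tsum _)

section maximalFun
variable {d : ℕ} {Ω : Type*}

lemma measurable_maximalFun [MeasurableSpace Ω] {X : (Fin d → ℤ) → Ω → ℝ}
    (hX : ∀ i, Measurable (X i)) : Measurable (maximalFun X) := by
  refine Measurable.iSup fun n => ?_
  have h : Measurable (rectSum X n) := Finset.measurable_fun_sum _ fun i _ => hX i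
  exact ((continuous_abs.measurable.comp h).div_const _).ennreal_ofReal

lemma maximalFun_const_mul {c : ℝ} (hc : 0 ≤ c) (X : (Fin d → ℤ) → Ω → ℝ) (ω : Ω) :
    maximalFun (fun i ω => c * X i ω) ω = ENNReal.ofReal c * maximalFun X ω := by
  unfold maximalFun
  rw [ENNReal.mul_iSup]
  refine iSup_congr fun n => ?_
  rw [← ENNReal.ofReal_mul hc, rectSum, ← Finset.mul_sum, abs_mul, abs_of_nonneg hc, mul_div_assoc]
  rfl

lemma maximalFun_le_tsum {X : (Fin d → ℤ) → Ω → ℝ} {Y : ℕ → (Fin d → ℤ) → Ω → ℝ} {ω : Ω}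
    (h : ∀ i, Filter.Tendsto (fun n => ∑ j ∈ Finset.range n, Y j i ω) Filter.atTop
      (nhds (X i ω))) : maximalFun X ω ≤ ∑' j, maximalFun (Y j) ω := by
  refine iSup_le fun n => ?_
  set c : ℝ := √((∏ q, ((n q : ℕ) : ℝ)) * logLL (∏ q, ((n q : ℕ) : ℝ)))
  have hc : 0 ≤ c := Real.sqrt_nonneg _
  have hlim : Filter.Tendsto (fun m => ENNReal.ofReal
      (|∑ i ∈ Finset.Icc (1 : Fin d → ℤ) (fun q => ((n q : ℕ) : ℤ)),
        ∑ j ∈ Finset.range m, Y j i ω| / c)) Filter.atTop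
      (nhds (ENNReal.ofReal (|rectSum X n ω| / c))) :=
    ENNReal.tendsto_ofReal ((tendsto_finsetSum _ fun i _ => h i).abs.div_const c)
  refine le_of_tendsto' hlim fun m => ?_
  rw [Finset.sum_comm]
  calc _ ≤ ENNReal.ofReal (∑ j ∈ Finset.range m, |rectSum (Y j) n ω| / c) := by
        refine ENNReal.ofReal_le_ofReal ?_
        rw [← Finset.sum_div]
        exact div_le_div_of_nonneg_right (Finset.abs_sum_le_sum_abs _ _) hc
    _ = ∑ j ∈ Finset.range m, ENNReal.ofReal (|rectSum (Y j) n ω| / c) :=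
        ENNReal.ofReal_sum_of_nonneg fun j _ => by positivity
    _ ≤ ∑ j ∈ Finset.range m, maximalFun (Y j) ω :=
        Finset.sum_le_sum fun j _ => le_iSup (fun n : Fin d → ℕ+ => ENNReal.ofReal
          (|rectSum (Y j) n ω| / √((∏ q, ((n q : ℕ) : ℝ)) * logLL (∏ q, ((n q : ℕ) : ℝ))))) n
    _ ≤ _ := ENNReal.sum_le_tsum _

end maximalFun

/-! ### Decomposition into shells and the inequality on the canonical space. -/

section shell
variable {d : ℕ}

/-- The sites of norm less than `n`. -/
def siteBall (d n : ℕ) : Set (Fin d → ℤ) := {u | ‖u‖ < n}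

lemma finite_norm_eq (d j : ℕ) : {u : Fin d → ℤ | ‖u‖ = j}.Finite := by
  refine (Set.finite_Icc (fun _ : Fin d => -(j : ℤ)) fun _ => (j : ℤ)).subset fun u hu => ?_
  have h : ∀ q, |u q| ≤ (j : ℤ) := fun q => by
    have := (norm_le_pi_norm u q).trans (le_of_eq hu)
    rw [Int.norm_eq_abs] at this
    exact_mod_cast this
  exact ⟨fun q => (abs_le.1 (h q)).1, fun q => (abs_le.1 (h q)).2⟩

/-- The sites of norm `j`. -/
noncomputable def siteSphere (d j : ℕ) : Finset (Fin d → ℤ) := (finite_norm_eq d j).toFinset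

lemma mem_siteSphere {j : ℕ} {u : Fin d → ℤ} : u ∈ siteSphere d j ↔ ‖u‖ = j := by
  simp [siteSphere]

lemma exists_norm_eq_natCast (u : Fin d → ℤ) : ∃ n : ℕ, ‖u‖ = n := by
  refine ⟨Finset.univ.sup fun q => (u q).natAbs, le_antisymm ?_ ?_⟩
  · refine (pi_norm_le_iff_of_nonneg (by positivity)).2 fun q => ?_
    rw [Int.norm_eq_abs, ← Int.cast_abs, Int.abs_eq_natAbs]
    exact_mod_cast Finset.le_sup (f := fun q => (u q).natAbs) (Finset.mem_univ q)
  · rcases (Finset.univ : Finset (Fin d)).eq_empty_or_nonempty with h | h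
    · simp [h]
    · obtain ⟨q, -, hq⟩ := Finset.exists_mem_eq_sup _ h fun q => (u q).natAbs
      rw [hq]
      refine le_trans (le_of_eq ?_) (norm_le_pi_norm u q)
      rw [Int.norm_eq_abs, ← Int.cast_abs, Int.abs_eq_natAbs]
      simp

lemma siteBall_union_siteSphere (d j : ℕ) :
    siteBall d j ∪ siteSphere d j = siteBall d (j + 1) := by
  ext u
  obtain ⟨n, hn⟩ := exists_norm_eq_natCast u
  simp only [siteBall, Set.mem_union, Set.mem_ofPred_eq, Finset.mem_coe, mem_siteSphere, hn,
    Nat.cast_lt, Nat.cast_inj]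
  omega

lemma siteBall_zero (d : ℕ) : siteBall d 0 = ∅ := by
  ext u
  simp [siteBall]

lemma monotone_siteBall (d : ℕ) : Monotone (siteBall d) := fun m n h u hu =>
  lt_of_lt_of_le (show ‖u‖ < m from hu) (by exact_mod_cast h)

lemma abs_le_of_mem_siteBall {j : ℕ} {u : Fin d → ℤ} (hu : u ∈ siteBall d (j + 1)) (q : Fin d) :
    |u q| ≤ (j : ℤ) := by
  have h := (norm_le_pi_norm u q).trans_lt hu
  rw [Int.norm_eq_abs, ← Int.cast_abs] at h
  have : |u q| < ((j + 1 : ℕ) : ℤ) := by exact_mod_cast h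
  omega

/-- The difference of the means of `f` given the coordinates of norm less than `j + 1`
and less than `j`. -/
noncomputable def shellDiff (μ₀ : Measure ℝ) (f : ((Fin d → ℤ) → ℝ) → ℝ) (j : ℕ)
    (x : (Fin d → ℤ) → ℝ) : ℝ :=
  fiberMean μ₀ (siteBall d (j + 1)) f x - fiberMean μ₀ (siteBall d j) f x

lemma measurable_shellDiff {μ₀ : Measure ℝ} [IsProbabilityMeasure μ₀]
    {f : ((Fin d → ℤ) → ℝ) → ℝ} (hf : Measurable f) (j : ℕ) : Measurable (shellDiff μ₀ f j) :=
  (measurable_fiberMean hf).sub (measurable_fiberMean hf)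

lemma sum_range_shellDiff {μ₀ : Measure ℝ} {f : ((Fin d → ℤ) → ℝ) → ℝ}
    (h0 : ∫ x, f x ∂iidMeasure _ μ₀ = 0) (n : ℕ) (x : (Fin d → ℤ) → ℝ) :
    ∑ j ∈ Finset.range n, shellDiff μ₀ f j x = fiberMean μ₀ (siteBall d n) f x := by
  have h := Finset.sum_range_sub (fun j => fiberMean μ₀ (siteBall d j) f x) n
  rw [siteBall_zero, fiberMean_empty] at h
  simpa [shellDiff, h0] using h

/-- The maximal inequality for the contribution of the sites of norm `j`, with a slack `η` in the
bound of the dependence coefficients. -/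
lemma exists_lintegral_shellDiff_le_of_pos (hd : 1 ≤ d) {p : ℝ} (hp1 : 1 < p) (hp2 : p < 2) :
    ∃ C : ℝ≥0∞, C ≠ ⊤ ∧ ∀ (μ₀ : Measure ℝ) [IsProbabilityMeasure μ₀]
      (f : ((Fin d → ℤ) → ℝ) → ℝ) (j : ℕ) (a : (Fin d → ℤ) → ℝ) (κ : ℝ), Measurable f →
      Integrable f (iidMeasure _ μ₀) → (∀ u ∈ siteSphere d j, 0 < a u) → 0 < κ →
      ∑ u ∈ siteSphere d j, a u ^ 2 ≤ κ ^ 2 →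
      (∀ u ∈ siteSphere d j, ∃ t : ℝ, ∫⁻ x, ENNReal.ofReal
        (sqLog (d - 1) ((f x - f (Function.update x u t)) / a u)) ∂iidMeasure _ μ₀ ≤ 1) →
      (∫⁻ ω, maximalFun (fun i ω => shellDiff μ₀ f j (siteReflect i ω)) ω ^ p
          ∂iidMeasure _ μ₀) ^ (1 / p) ≤
        C * ((j : ℝ≥0∞) + 1) ^ ((d : ℝ) / 2) * ENNReal.ofReal κ := by
  obtain ⟨C, hC, hmax⟩ := exists_lintegral_maximalFun_rpow_le hd hp1 hp2
    (B := ENNReal.ofReal (8 * Real.exp (2 * growthConst (d - 1)))) ENNReal.ofReal_ne_top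
  have hp0 : 0 < p := by linarith
  refine ⟨C ^ (1 / p) * 2 ^ ((d : ℝ) / 2), ENNReal.mul_ne_top
    (ENNReal.rpow_ne_top_of_nonneg (by positivity) hC)
    (ENNReal.rpow_ne_top_of_nonneg (by positivity) (by simp)), ?_⟩
  intro μ₀ _ f j a κ hf hfi ha hκ hsum hosc
  set μ := iidMeasure (Fin d → ℤ) μ₀
  set h : ((Fin d → ℤ) → ℝ) → ℝ := fun x => shellDiff μ₀ f j x / κ
  have hhm : Measurable h := (measurable_shellDiff hf j).div_const κ
  have hsi : Integrable (shellDiff μ₀ f j) μ :=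
    (integrable_fiberMean hfi).sub (integrable_fiberMean hfi)
  have hh0 : ∫ x, h x ∂μ = 0 := by
    simp only [h, shellDiff]
    rw [integral_div, integral_sub (integrable_fiberMean hfi) (integrable_fiberMean hfi),
      integral_fiberMean hfi, integral_fiberMean hfi, sub_self, zero_div]
  have hdep : DependsOn h {u | ∀ q, |u q| ≤ (j : ℤ)} := fun x y hxy => by
    have h1 := dependsOn_fiberMean (μ₀ := μ₀) (g := f) (A := siteBall d (j + 1)) (x := x) (y := y)
      fun v hv => hxy v (abs_le_of_mem_siteBall hv)
    have h2 := dependsOn_fiberMean (μ₀ := μ₀) (g := f) (A := siteBall d j) (x := x) (y := y)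
      fun v hv => hxy v (abs_le_of_mem_siteBall (monotone_siteBall d (Nat.le_succ j) hv))
    simp only [h, shellDiff, h1, h2]
  have hlayer : ∫⁻ x, layerSum (d - 1) (ENNReal.ofReal (h x ^ 2)) ∂μ ≤
      ENNReal.ofReal (8 * Real.exp (2 * growthConst (d - 1))) := by
    -- After division by `κ` the coefficients have squared sum at most `1`. Revealing the sphere
    -- after the ball produces exactly the shell increment.
    have key := lintegral_layerSum_fiberMean_sub_le (μ₀ := μ₀) (r := d - 1)
      (g := fun x => f x / κ) (hf.div_const κ) (hfi.div_const κ) (a := fun u => a u / κ)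
      (siteBall d j) (siteSphere d j) (fun u hu => div_pos (ha u hu) hκ)
      (by
        simp only [div_pow]
        rw [← Finset.sum_div]
        exact (div_le_one (by positivity)).2 hsum)
      fun u hu => by
        obtain ⟨t, ht⟩ := hosc u hu
        refine ⟨t, le_trans (le_of_eq ?_) ht⟩
        refine lintegral_congr fun x => ?_
        rw [← sub_div, div_div_div_cancel_right₀ hκ.ne']
    rw [siteBall_union_siteSphere] at key
    simp only [fiberMean_div_const, ← sub_div] at key
    exact key
  have hM := hmax μ₀ j h hhm (hsi.div_const κ) hh0 hdep hlayer
  have hscale : ∀ ω, maximalFun (fun i ω => shellDiff μ₀ f j (siteReflect i ω)) ω =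
      ENNReal.ofReal κ * maximalFun (fun i ω => h (siteReflect i ω)) ω := fun ω => by
    rw [← maximalFun_const_mul hκ.le]
    congr 1
    ext i η
    simp only [h]
    field_simp
  have hmm : Measurable fun ω => maximalFun (fun i ω => h (siteReflect i ω)) ω ^ p :=
    (measurable_maximalFun fun i => hhm.comp (measurable_siteReflect i)).pow_const p
  simp only [hscale, ENNReal.mul_rpow_of_nonneg _ _ hp0.le]
  rw [lintegral_const_mul _ hmm, ENNReal.mul_rpow_of_nonneg _ _ (by positivity),
    ← ENNReal.rpow_mul, mul_one_div_cancel hp0.ne', ENNReal.rpow_one, mul_comm]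
  gcongr
  calc _ ≤ (C * (((2 * j + 1 : ℕ) : ℝ≥0∞) ^ d) ^ (p / 2)) ^ (1 / p) := by gcongr
    _ = C ^ (1 / p) * ((2 * j + 1 : ℕ) : ℝ≥0∞) ^ ((d : ℝ) / 2) := by
        rw [ENNReal.mul_rpow_of_nonneg _ _ (by positivity), ← ENNReal.rpow_natCast,
          ← ENNReal.rpow_mul, ← ENNReal.rpow_mul]
        congr 2
        field_simp
    _ ≤ C ^ (1 / p) * (2 * ((j : ℝ≥0∞) + 1)) ^ ((d : ℝ) / 2) := by
        gcongr
        push_cast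
        rw [mul_add]
        gcongr
        norm_num
    _ = _ := by
        rw [ENNReal.mul_rpow_of_nonneg _ _ (by positivity), mul_assoc]

/-- The maximal inequality for the contribution of the sites of norm `j`. -/
lemma exists_lintegral_shellDiff_le (hd : 1 ≤ d) {p : ℝ} (hp1 : 1 < p) (hp2 : p < 2) :
    ∃ C : ℝ≥0∞, C ≠ ⊤ ∧ ∀ (μ₀ : Measure ℝ) [IsProbabilityMeasure μ₀]
      (f : ((Fin d → ℤ) → ℝ) → ℝ) (j : ℕ) (δ : (Fin d → ℤ) → ℝ), Measurable f →
      Integrable f (iidMeasure _ μ₀) → (∀ u ∈ siteSphere d j, 0 ≤ δ u) →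
      (∀ u ∈ siteSphere d j, ∀ l, δ u < l → ∃ t : ℝ, ∫⁻ x, ENNReal.ofReal
        (sqLog (d - 1) ((f x - f (Function.update x u t)) / l)) ∂iidMeasure _ μ₀ ≤ 1) →
      (∫⁻ ω, maximalFun (fun i ω => shellDiff μ₀ f j (siteReflect i ω)) ω ^ p
          ∂iidMeasure _ μ₀) ^ (1 / p) ≤
        C * ((j : ℝ≥0∞) + 1) ^ ((d : ℝ) / 2) *
          ENNReal.ofReal (√(∑ u ∈ siteSphere d j, δ u ^ 2)) := by
  obtain ⟨C, hC, hmax⟩ := exists_lintegral_shellDiff_le_of_pos hd hp1 hp2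
  refine ⟨C, hC, fun μ₀ _ f j δ hf hfi hδ hosc => ?_⟩
  -- The infimum defining a coefficient need not be attained and may be zero: `δ + η` restores
  -- strict inequality and positivity, the last `η ^ 2` makes the scale positive, and `η` tends to
  -- `0`.
  set K : ℝ → ℝ := fun η => √(∑ u ∈ siteSphere d j, (δ u + η) ^ 2 + η ^ 2)
  have hK : Continuous K := by fun_prop
  have hc : C * ((j : ℝ≥0∞) + 1) ^ ((d : ℝ) / 2) ≠ ⊤ :=
    ENNReal.mul_ne_top hC (ENNReal.rpow_ne_top_of_nonneg (by positivity) (by simp))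
  have hlim : Filter.Tendsto (fun η => C * ((j : ℝ≥0∞) + 1) ^ ((d : ℝ) / 2) *
      ENNReal.ofReal (K η)) (nhdsWithin 0 (Set.Ioi 0))
      (nhds (C * ((j : ℝ≥0∞) + 1) ^ ((d : ℝ) / 2) * ENNReal.ofReal (K 0))) :=
    (ENNReal.Tendsto.const_mul (ENNReal.tendsto_ofReal hK.continuousAt.tendsto)
      (Or.inr hc)).mono_left nhdsWithin_le_nhds
  have hK0 : K 0 = √(∑ u ∈ siteSphere d j, δ u ^ 2) := by simp [K]
  rw [hK0] at hlim
  refine ge_of_tendsto hlim (Filter.eventually_of_mem self_mem_nhdsWithin fun η hη => ?_)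
  have hη : 0 < η := hη
  have hnn : 0 ≤ ∑ u ∈ siteSphere d j, (δ u + η) ^ 2 := Finset.sum_nonneg fun _ _ => sq_nonneg _
  refine hmax μ₀ f j (fun u => δ u + η) (K η) hf hfi (fun u hu => by linarith [hδ u hu])
    (Real.sqrt_pos.2 (by positivity)) ?_ fun u hu => hosc u hu _ (by linarith)
  rw [Real.sq_sqrt (by positivity)]
  linarith [sq_nonneg η]

/-- The maximal inequality on the canonical space. -/
theorem exists_lintegral_maximalFun_le_tsum (hd : 1 ≤ d) {p : ℝ} (hp1 : 1 < p) (hp2 : p < 2) :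
    ∃ C : ℝ≥0∞, C ≠ ⊤ ∧ ∀ (μ₀ : Measure ℝ) [IsProbabilityMeasure μ₀]
      (f : ((Fin d → ℤ) → ℝ) → ℝ) (δ : (Fin d → ℤ) → ℝ≥0∞), Measurable f →
      Integrable f (iidMeasure _ μ₀) → ∫ x, f x ∂iidMeasure _ μ₀ = 0 →
      (∀ u l, δ u < ENNReal.ofReal l → ∃ t : ℝ, ∫⁻ x, ENNReal.ofReal
        (sqLog (d - 1) ((f x - f (Function.update x u t)) / l)) ∂iidMeasure _ μ₀ ≤ 1) →
      (∫⁻ ω, maximalFun (fun i ω => f (siteReflect i ω)) ω ^ p ∂iidMeasure _ μ₀) ^ (1 / p) ≤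
        C * ∑' j : ℕ, ((j : ℝ≥0∞) + 1) ^ ((d : ℝ) / 2) *
          (∑' i : {i : Fin d → ℤ // ‖i‖ = j}, δ i ^ 2) ^ (1 / 2 : ℝ) := by
  obtain ⟨C, hC, hshell⟩ := exists_lintegral_shellDiff_le hd hp1 hp2
  -- A positive constant is needed for the right side to be infinite when some coefficient is.
  refine ⟨C + 1, by simp [hC], fun μ₀ _ f δ hf hfi h0 hosc => ?_⟩
  set μ := iidMeasure (Fin d → ℤ) μ₀
  have hsum : ∀ j : ℕ, ∑' i : {i : Fin d → ℤ // ‖i‖ = j}, δ i ^ 2 =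
      ∑ u ∈ siteSphere d j, δ u ^ 2 := fun j => by
    rw [← Finset.tsum_subtype' (siteSphere d j)]
    exact tsum_congr_set_coe (fun u => δ u ^ 2) (finite_norm_eq d j).coe_toFinset.symm
  have hae : ∀ᵐ ω ∂μ, ∀ i, Filter.Tendsto (fun n => ∑ j ∈ Finset.range n,
      shellDiff μ₀ f j (siteReflect i ω)) Filter.atTop (nhds (f (siteReflect i ω))) := by
    refine ae_all_iff.2 fun i => ?_
    simp only [sum_range_shellDiff h0]
    refine (measurePreserving_siteReflect μ₀ i).quasiMeasurePreserving.ae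
      (tendsto_fiberMean hf hfi (monotone_siteBall d) fun v => ?_)
    obtain ⟨n, hn⟩ := exists_norm_eq_natCast v
    exact ⟨n + 1, by simp [siteBall, hn]⟩
  calc (∫⁻ ω, maximalFun (fun i ω => f (siteReflect i ω)) ω ^ p ∂μ) ^ (1 / p)
      ≤ (∫⁻ ω, (∑' j, maximalFun (fun i ω => shellDiff μ₀ f j (siteReflect i ω)) ω) ^ p
          ∂μ) ^ (1 / p) := by
        refine ENNReal.rpow_le_rpow (lintegral_mono_ae ?_) (by positivity)
        filter_upwards [hae] with ω hω
        exact ENNReal.rpow_le_rpow (maximalFun_le_tsum hω) (by linarith)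
    _ ≤ ∑' j, (∫⁻ ω, maximalFun (fun i ω => shellDiff μ₀ f j (siteReflect i ω)) ω ^ p
          ∂μ) ^ (1 / p) :=
        lintegral_tsum_rpow_le hp1.le fun j => measurable_maximalFun fun i =>
          (measurable_shellDiff hf j).comp (measurable_siteReflect i)
    _ ≤ ∑' j : ℕ, (C + 1) * (((j : ℝ≥0∞) + 1) ^ ((d : ℝ) / 2) *
          (∑ u ∈ siteSphere d j, δ u ^ 2) ^ (1 / 2 : ℝ)) := by
        refine ENNReal.tsum_le_tsum fun j => ?_
        by_cases htop : ∀ u ∈ siteSphere d j, δ u ≠ ⊤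
        · refine (hshell μ₀ f j (fun u => (δ u).toReal) hf hfi
            (fun _ _ => ENNReal.toReal_nonneg) fun u hu l hl => hosc u l ?_).trans ?_
          · rwa [ENNReal.lt_ofReal_iff_toReal_lt (htop u hu)]
          · rw [mul_assoc]
            gcongr
            · exact le_self_add
            · rw [Real.sqrt_eq_rpow, ← ENNReal.ofReal_rpow_of_nonneg
                (Finset.sum_nonneg fun _ _ => sq_nonneg _) (by norm_num),
                ENNReal.ofReal_sum_of_nonneg fun _ _ => sq_nonneg _]
              gcongr with u hu
              rw [ENNReal.ofReal_pow ENNReal.toReal_nonneg, ENNReal.ofReal_toReal (htop u hu)]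
        · push Not at htop
          obtain ⟨u, hu, hδ⟩ := htop
          have h1 : ∑ u ∈ siteSphere d j, δ u ^ 2 = ⊤ :=
            ENNReal.sum_eq_top.2 ⟨u, hu, by simp [hδ]⟩
          rw [h1, ENNReal.top_rpow_of_pos (by norm_num), ENNReal.mul_top, ENNReal.mul_top]
          · exact le_top
          · simp
          · simp
    _ = _ := by
        rw [ENNReal.tsum_mul_left]
        simp only [hsum]

end shell

/-! ### Transfer from the canonical space to the given variables. -/

lemma orliczFun_abs_div {d : ℕ} (hd : 1 ≤ d) (y : ℝ) {l : ℝ} (hl : 0 < l) :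
    orliczFun 2 ((d : ℝ) - 1) (|y| / l) = sqLog (d - 1) (y / l) := by
  have h1 : |y| / l = |y / l| := by rw [abs_div, abs_of_pos hl]
  have h2 : (d : ℝ) - 1 = ((d - 1 : ℕ) : ℝ) := by
    rw [Nat.cast_sub hd, Nat.cast_one]
  rw [orliczFun, sqLog, h1, h2, Real.rpow_natCast, Real.rpow_two, sq_abs, logOne]

lemma exists_of_orliczNorm_lt {Ω : Type*} [MeasurableSpace Ω] {P : Measure Ω} {d : ℕ} (hd : 1 ≤ d)
    {Y : Ω → ℝ} {l : ℝ} (h : orliczNorm P 2 ((d : ℝ) - 1) Y < ENNReal.ofReal l) :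
    ∫⁻ ω, ENNReal.ofReal (sqLog (d - 1) (Y ω / l)) ∂P ≤ 1 := by
  simp only [orliczNorm, iInf_lt_iff] at h
  obtain ⟨l', hl', hint, hlt⟩ := h
  have hl : l' < l := (ENNReal.ofReal_lt_ofReal_iff_of_nonneg hl'.le).1 hlt
  refine (lintegral_mono fun ω => ENNReal.ofReal_le_ofReal ?_).trans hint
  rw [orliczFun_abs_div hd _ hl']
  refine sqLog_mono _ ?_
  rw [abs_div, abs_div, abs_of_pos hl', abs_of_pos (hl'.trans hl)]
  exact div_le_div_of_nonneg_left (abs_nonneg _) hl' hl.le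

/-- Replacing the innovation at the origin is, seen from the site `u`, replacing the coordinate `u`.
This turns the physical dependence at `u` into an oscillation of `f`. -/
lemma siteReflect_update {d : ℕ} (u : Fin d → ℤ) (η : (Fin d → ℤ) → ℝ) (t : ℝ) :
    siteReflect u (Function.update η 0 t) = Function.update (siteReflect u η) u t := by
  ext v
  by_cases hv : v = u
  · simp [siteReflect, hv]
  · rw [Function.update_of_ne hv, siteReflect, siteReflect,
      Function.update_of_ne (sub_ne_zero.2 (Ne.symm hv))]

/-- A replacement value for one coordinate with a small oscillation. -/
lemma exists_lintegral_update_le {d : ℕ} (hd : 1 ≤ d) {Ω : Type*} [MeasurableSpace Ω]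
    {P : Measure Ω} [IsProbabilityMeasure P] {μ₀ : Measure ℝ} [IsProbabilityMeasure μ₀]
    {ε : (Fin d → ℤ) → Ω → ℝ} {ε' : Ω → ℝ} {f : ((Fin d → ℤ) → ℝ) → ℝ}
    (hε : MeasurePreserving (fun ω u => ε u ω) P (iidMeasure _ μ₀)) (hε' : Measurable ε')
    (hind : IndepFun ε' (fun ω u => ε u ω) P) (hf : Measurable f) {u : Fin d → ℤ} {l : ℝ}
    (h : physDep P f ε ε' ((d : ℝ) - 1) u < ENNReal.ofReal l) :
    ∃ t : ℝ, ∫⁻ x, ENNReal.ofReal (sqLog (d - 1) ((f x - f (Function.update x u t)) / l))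
      ∂iidMeasure _ μ₀ ≤ 1 := by
  set μ := iidMeasure (Fin d → ℤ) μ₀
  set ν := P.map ε'
  have : IsProbabilityMeasure ν := Measure.isProbabilityMeasure_map hε'.aemeasurable
  have h1 := exists_of_orliczNorm_lt hd h
  let G : ℝ × ((Fin d → ℤ) → ℝ) → ℝ≥0∞ := fun z =>
    ENNReal.ofReal (sqLog (d - 1) ((f z.2 - f (Function.update z.2 u z.1)) / l))
  have hG : Measurable G := by
    have hup : Measurable fun z : ℝ × ((Fin d → ℤ) → ℝ) => Function.update z.2 u z.1 :=
      measurable_update'.comp measurable_swap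
    exact ((measurable_sqLog _).comp
      (((hf.comp measurable_snd).sub (hf.comp hup)).div_const l)).ennreal_ofReal
  have hσ : MeasurePreserving (fun z : ℝ × ((Fin d → ℤ) → ℝ) => (z.1, siteReflect u z.2))
      (ν.prod μ) (ν.prod μ) :=
    (MeasurePreserving.id ν).prod (measurePreserving_siteReflect μ₀ u)
  have hmap : MeasurePreserving (fun ω => (ε' ω, fun u => ε u ω)) P (ν.prod μ) := by
    refine ⟨hε'.prodMk hε.measurable, ?_⟩
    rw [(indepFun_iff_map_prod_eq_prod_map_map hε'.aemeasurable hε.measurable.aemeasurable).1 hind,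
      hε.map_eq]
  have h2 : ∫⁻ t, ∫⁻ x, G (t, x) ∂μ ∂ν ≤ 1 := by
    rw [← lintegral_prod _ hG.aemeasurable, ← (hσ.comp hmap).lintegral_comp hG]
    refine le_trans (le_of_eq (lintegral_congr fun ω => ?_)) h1
    have e1 : functionalField f ε u ω = f (siteReflect u fun v => ε v ω) := rfl
    have e2 : functionalField f (Function.update ε 0 ε') u ω =
        f (siteReflect u (Function.update (fun v => ε v ω) 0 (ε' ω))) := by
      unfold functionalField siteReflect
      congr 1
      ext v
      by_cases hv : u - v = 0
      · simp [hv]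
      · simp [hv, Function.update_of_ne]
    simp only [G, Function.comp_apply, e1, e2, siteReflect_update]
  -- Some value of the independent variable does no worse than the average. Its law is not used
  -- otherwise, so it need not be that of `ε 0`.
  obtain ⟨t, ht⟩ := exists_le_lintegral (μ := ν) (f := fun t => ∫⁻ x, G (t, x) ∂μ)
    hG.lintegral_prod_right'.aemeasurable
  exact ⟨t, ht.trans h2⟩

/-- The law of an i.i.d. field. -/
lemma measurePreserving_of_iIndepFun {ι Ω : Type*} [MeasurableSpace Ω] {P : Measure Ω}
    [IsProbabilityMeasure P] {ε : ι → Ω → ℝ} {o : ι} (hε : ∀ u, Measurable (ε u))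
    (hind : iIndepFun ε P) (hid : ∀ u, IdentDistrib (ε u) (ε o) P P) :
    MeasurePreserving (fun ω u => ε u ω) P (iidMeasure ι (P.map (ε o))) := by
  refine ⟨measurable_pi_lambda _ hε, ?_⟩
  rw [(iIndepFun_iff_map_fun_eq_infinitePi_map hε).1 hind]
  congr 1
  ext1 u
  exact (hid u).map_eq

/-- The space `(Ω', P')` with the map `π` is an arbitrary enlargement of the probability space
`(Ω, P)`, on which the variable `ε'` independent of the field `ε` lives (`π = id` is allowed).
On `Fin d → ℤ`, the norm `‖i‖` is the maximum of the `|i q|`. -/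
theorem mainTheorem4 (d : ℕ) (hd : 1 ≤ d) (p : ℝ) (hp1 : 1 < p) (hp2 : p < 2) :
    ∃ C : ℝ≥0, ∀ (Ω : Type*) [MeasurableSpace Ω] (P : Measure Ω) [IsProbabilityMeasure P]
      (ε : (Fin d → ℤ) → Ω → ℝ) (f : ((Fin d → ℤ) → ℝ) → ℝ) (X : (Fin d → ℤ) → Ω → ℝ)
      (Ω' : Type*) [MeasurableSpace Ω'] (P' : Measure Ω') (π : Ω' → Ω) (ε' : Ω' → ℝ),
      (∀ u, Measurable (ε u)) →
      iIndepFun ε P →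
      (∀ u, IdentDistrib (ε u) (ε 0) P P) →
      Measurable f →
      (∀ i ω, X i ω = functionalField f ε i ω) →
      (∀ i, Integrable (X i) P ∧ ∫ ω, X i ω ∂P = 0) →
      MeasurePreserving π P' P →
      Measurable ε' →
      IndepFun ε' (fun ω' u => ε u (π ω')) P' →
      eLpNorm (maximalFun X) (ENNReal.ofReal p) P ≤
        C * ∑' j : ℕ, ((j : ℝ≥0∞) + 1) ^ ((d : ℝ) / 2) *
          (∑' i : {i : Fin d → ℤ // ‖i‖ = j},
            physDep P' f (fun u ω' => ε u (π ω')) ε' ((d : ℝ) - 1) i ^ 2) ^ (1 / 2 : ℝ) := by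
  obtain ⟨C, hC, hmax⟩ := exists_lintegral_maximalFun_le_tsum hd hp1 hp2
  refine ⟨C.toNNReal, ?_⟩
  intro Ω _ P _ ε f X Ω' _ P' π ε' hε hind hid hf hX hXi hπ hε' hind'
  rw [ENNReal.coe_toNNReal hC]
  set μ₀ := P.map (ε 0)
  have : IsProbabilityMeasure μ₀ := Measure.isProbabilityMeasure_map (hε 0).aemeasurable
  have : IsProbabilityMeasure P' :=
    ⟨by rw [← Set.preimage_univ (f := π), hπ.measure_preimage nullMeasurableSet_univ, measure_univ]⟩
  have hΦ : MeasurePreserving (fun ω u => ε u ω) P (iidMeasure _ μ₀) :=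
    measurePreserving_of_iIndepFun hε hind hid
  -- Integrability and mean of `f` are read off from `X 0`, which evaluates `f` at the field
  -- reflected about the origin.
  have hΨ := (measurePreserving_siteReflect μ₀ (0 : Fin d → ℤ)).comp hΦ
  have hX0 : X 0 = f ∘ (siteReflect 0 ∘ fun ω u => ε u ω) := funext fun ω => hX 0 ω
  have hfi : Integrable f (iidMeasure _ μ₀) :=
    (hΨ.integrable_comp hf.aestronglyMeasurable).1 (hX0 ▸ (hXi 0).1)
  have hf0 : ∫ x, f x ∂iidMeasure _ μ₀ = 0 := by
    rw [← hΨ.map_eq, integral_map hΨ.measurable.aemeasurable hf.aestronglyMeasurable,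
      ← (hXi 0).2, hX0]
    rfl
  refine le_trans (le_of_eq ?_) (hmax μ₀ f
    (physDep P' f (fun u ω' => ε u (π ω')) ε' ((d : ℝ) - 1)) hf hfi hf0 fun u l hl =>
      exists_lintegral_update_le hd (hΦ.comp hπ) hε' hind' hf hl)
  have hp0 : 0 < p := by linarith
  rw [eLpNorm_eq_lintegral_rpow_enorm_toReal (by simpa using hp0) ENNReal.ofReal_ne_top,
    ENNReal.toReal_ofReal hp0.le]
  have hm : Measurable fun ω : (Fin d → ℤ) → ℝ =>
      maximalFun (fun i ω => f (siteReflect i ω)) ω ^ p :=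
    (measurable_maximalFun fun i => hf.comp (measurable_siteReflect i)).pow_const p
  rw [← hΦ.lintegral_comp hm]
  congr 1
  refine lintegral_congr fun ω => ?_
  rw [enorm_eq_self]
  congr 1
  unfold maximalFun rectSum
  simp only [hX]
  rfl
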